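/- Let $E>0$, and let $V\in L^\infty(\mathbb R^2)$ be real-valued with distributional gradient $\nabla V\in L^\infty(\mathbb R^2)$. Suppose that for some $\delta_0,c>0$ and almost all $x\in\mathbb R^2$, $$V(x)\le c(1+|x|)^{-\delta_0},\qquad |\nabla V(x)|\le c(1+|x|)^{-1-\delta_0}.$$ For $h>0$ let $P=P_h=-h^2\Delta+V-E$, as an unbounded operator on $L^2(\mathbb R^2)$ with domain the Sobolev space $H^2(\mathbb R^2)$. Then for every $s>1/2$ there are constants $C,R,h_0>0$ such that, for all $\varepsilon>0$ and all $h\in(0,h_0]$, the operator $P-i\varepsilon:H^2(\mathbb R^2)\to L^2(\mathbb R^2)$ is bijective with inverse $(P-i\varepsilon)^{-1}$ bounded on $L^2(\mathbb R^2)$, and $$\left\|(1+|x|)^{-s}(P-i\varepsilon)^{-1}(1+|x|)^{-s}\right\|_{L^2(\mathbb R^2)\to L^2(\mathbb R^2)}\le e^{C/h},$$ $$\left\|(1+|x|)^{-s}\mathbf 1_{\ge R}(P-i\varepsilon)^{-1}\mathbf 1_{\ge R}(1+|x|)^{-s}\right\|_{L^2(\mathbb R^2)\to L^2(\mathbb R^2)}\le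 \frac Ch,$$ where functions of $x$ act by multiplication and $\mathbf 1_{\ge R}$ is the characteristic function of $\{x\in\mathbb R^2:|x|\ge R\}$. -/

import Mathlib

open MeasureTheory TemperedDistribution
open scoped SchwartzMap Laplacian ContDiff

namespace SemiclassicalResolvent

noncomputable section

/-- The plane `ℝ²` with its Euclidean norm. -/
abbrev Plane : Type := EuclideanSpace ℝ (Fin 2)

/-- The complex Hilbert space `L²(ℝ²)`. -/
abbrev L2 : Type := Lp ℂ 2 (volume : Measure Plane)

/-- The Sobolev space `H²(ℝ²)`, as a subspace of `L²(ℝ²)`. -/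
def H2 : Submodule ℂ L2 where
  carrier := {u | MemSobolev 2 2 (u : 𝓢'(Plane, ℂ))}
  add_mem' {u v} hu hv := by
    have h := MemSobolev.add hu hv
    simp only [← Lp.toTemperedDistributionCLM_apply, ← map_add] at h
    exact h
  zero_mem' := by
    have h := memSobolev_fun_zero Plane ℂ 2 2
    rw [← map_zero (Lp.toTemperedDistributionCLM ℂ (volume : Measure Plane) 2)] at h
    exact h
  smul_mem' c u hu := by
    have h := MemSobolev.smul c hu
    simp only [← Lp.toTemperedDistributionCLM_apply, ← map_smul] at h
    exact h

theorem toTemperedDistribution_injective {f g : L2}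
    (h : (f : 𝓢'(Plane, ℂ)) = (g : 𝓢'(Plane, ℂ))) : f = g :=
  LinearMap.ker_eq_bot.mp (Lp.ker_toTemperedDistributionCLM_eq_bot
    (μ := (volume : Measure Plane)) (F := ℂ) (p := 2)) h

theorem exists_laplacian (u : H2) :
    ∃ g : L2, (g : 𝓢'(Plane, ℂ)) = Δ ((u : L2) : 𝓢'(Plane, ℂ)) := by
  have h : MemSobolev (2 - 2) 2 (Δ ((u : L2) : 𝓢'(Plane, ℂ))) := MemSobolev.laplacian u.2
  rw [sub_self] at h
  obtain ⟨g, hg⟩ := memSobolev_zero_iff.mp h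
  exact ⟨g, hg.symm⟩

/-- The distributional Laplacian `Δ : H²(ℝ²) → L²(ℝ²)`: `laplacianL2 u` is the element of `L²`
that represents the tempered distribution `Δ u`. -/
def laplacianL2 : H2 →ₗ[ℂ] L2 where
  toFun u := (exists_laplacian u).choose
  map_add' u v := by
    apply toTemperedDistribution_injective
    have h : ((((exists_laplacian u).choose + (exists_laplacian v).choose : L2)) : 𝓢'(Plane, ℂ))
        = ((exists_laplacian u).choose : 𝓢'(Plane, ℂ))
          + ((exists_laplacian v).choose : 𝓢'(Plane, ℂ)) := by
      simp only [← Lp.toTemperedDistributionCLM_apply, map_add]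
    rw [h, (exists_laplacian (u + v)).choose_spec, (exists_laplacian u).choose_spec,
      (exists_laplacian v).choose_spec]
    simp only [← Lp.toTemperedDistributionCLM_apply, ← laplacianCLM_apply, Submodule.coe_add,
      map_add]
  map_smul' c u := by
    apply toTemperedDistribution_injective
    have h : (((c • (exists_laplacian u).choose : L2)) : 𝓢'(Plane, ℂ))
        = c • ((exists_laplacian u).choose : 𝓢'(Plane, ℂ)) := by
      simp only [← Lp.toTemperedDistributionCLM_apply, map_smul]
    rw [RingHom.id_apply, h, (exists_laplacian (c • u)).choose_spec,
      (exists_laplacian u).choose_spec]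
    simp only [← Lp.toTemperedDistributionCLM_apply, ← laplacianCLM_apply, Submodule.coe_smul,
      map_smul]

/-- The bounded operator `u ↦ f u` on `L²(ℝ²)`, for a real-valued `f ∈ L^∞(ℝ²)`. -/
def mulOp (f : Plane → ℝ) (hf : MemLp f ⊤ volume) : L2 →L[ℂ] L2 :=
  (ContinuousLinearMap.mul ℂ ℂ).holderL volume ⊤ 2 2
    (MemLp.toLp (fun x => (f x : ℂ)) hf.ofReal)

/-- The semiclassical Schrödinger operator `P = -h² Δ + V - E`, as an unbounded operator on
`L²(ℝ²)` with domain `H²(ℝ²)`. -/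
def schrodinger (V : Plane → ℝ) (hV : MemLp V ⊤ volume) (E h : ℝ) : L2 →ₗ.[ℂ] L2 where
  domain := H2
  toFun := -((h : ℂ) ^ 2) • laplacianL2
    + (mulOp V hV : L2 →ₗ[ℂ] L2) ∘ₗ H2.subtype - (E : ℂ) • H2.subtype

/-- `G = (T - z)⁻¹`: the bounded operator `G` on `L²` maps into the domain of `T` and is a
two-sided inverse of `T - z`. There is at most one such `G`. -/
def IsResolvent (T : L2 →ₗ.[ℂ] L2) (z : ℂ) (G : L2 →L[ℂ] L2) : Prop :=
  (∀ f : L2, ∃ hf : G f ∈ T.domain, T ⟨G f, hf⟩ - z • G f = f) ∧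
    ∀ u : T.domain, G (T u - z • (u : L2)) = u

/-- `g` is the gradient of `V` in the sense of distributions on `ℝ²`. -/
def IsWeakGradient (V : Plane → ℝ) (g : Plane → Plane) : Prop :=
  ∀ φ : Plane → ℝ, ContDiff ℝ ∞ φ → HasCompactSupport φ → ∀ v : Plane,
    ∫ x, V x * fderiv ℝ φ x v = -∫ x, inner ℝ (g x) v * φ x

/-- The weight `(1 + |x|)^{-s}`. -/
def weight (s : ℝ) (x : Plane) : ℝ := (1 + ‖x‖) ^ (-s)

/-- The characteristic function of `{x : |x| ≥ R}`. -/
def exterior (R : ℝ) : Plane → ℝ := {x : Plane | R ≤ ‖x‖}.indicator 1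

theorem memLp_weight {s : ℝ} (hs : 1 / 2 < s) : MemLp (weight s) ⊤ volume := by
  refine memLp_top_of_bound ?_ 1 (Filter.Eventually.of_forall fun x => ?_)
  · exact (by unfold weight; fun_prop : Measurable (weight s)).aestronglyMeasurable
  · have hx : (1 : ℝ) ≤ 1 + ‖x‖ := by linarith [norm_nonneg x]
    rw [weight, Real.norm_of_nonneg (Real.rpow_nonneg (by linarith) _)]
    exact Real.rpow_le_one_of_one_le_of_nonpos hx (by linarith)

theorem memLp_exterior (R : ℝ) : MemLp (exterior R) ⊤ volume := by
  refine memLp_top_of_bound ?_ 1 (Filter.Eventually.of_forall fun x => ?_)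
  · exact (measurable_one.indicator
      (measurableSet_le measurable_const measurable_norm)).aestronglyMeasurable
  · by_cases hx : x ∈ {x : Plane | R ≤ ‖x‖} <;> simp [exterior, hx]

/-- Multiplication by `(1 + |x|)^{-s}` on `L²(ℝ²)`, for `s > 1/2`. -/
def weightOp (s : ℝ) (hs : 1 / 2 < s) : L2 →L[ℂ] L2 := mulOp (weight s) (memLp_weight hs)

/-- Multiplication by the characteristic function of `{x : |x| ≥ R}` on `L²(ℝ²)`. -/
def exteriorOp (R : ℝ) : L2 →L[ℂ] L2 := mulOp (exterior R) (memLp_exterior R)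

end

end SemiclassicalResolvent

open SemiclassicalResolvent

/-! The theorem reduces to one a priori estimate, uniform in 0 < ε ≤ 1: ‖m u‖ ≤ (κ/h) ‖m⁻¹ (P - iε)
u‖, where m² = d (1+|x|)^{-(1+δ)} and d equals 1 for |x| ≥ R and e^{-C/h} for |x| < R. If 1 + δ ≤
2s, then (1+|x|)^{-s} is at most m outside the disc and at most e^{C/h} m everywhere, which yields
the exterior and the global bound respectively. For ε > 1 the bound 1/ε coming from symmetry is
enough. The estimate is proved for test functions in `exists_testFunction_bound` and extended to H²
in `norm_halfWeight_le`.

The core is a Carleman estimate. With t = log|x|, |x|²Δ is the sum of the squares of the Euler field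
and the rotation field, which commute and preserve dx/|x|². The operator is conjugated by |x|^{1/2}
e^{φ(t)/h} and paired with the radial derivative, weighted by w(t) e^{-2t}. Every second-order term
is then an exact derivative up to terms with a sign (`integral_energyDefect`): the radial and
angular terms are favourable as long as 0 < w'/w ≤ 2, and what remains is a zeroth-order coefficient
that should dominate E w'/2. Where V and x·∇V are not small, a steep phase φ supplies the
positivity; farther out the energy E does, and φ can be flattened to zero. This is
`exists_carlemanWeight`, whose output enters `CarlemanWeight.energyDefect_le` and
`CarlemanWeight.carleman_punctured`.

Dimension two adds a difficulty: the factor |x|^{1/2} creates the attractive potential -h²/(4|x|²),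
too singular to be treated as an error. Choosing w of size |x|² at the origin cancels the
singularity (`centrifugal_le`). It also makes the cost of cutting out the origin tend to zero
(`CarlemanWeight.carleman_origin`). The price is that the estimate degenerates at its centre. It is
therefore used with two centres at distance one (`CarlemanWeight.carleman_translate`): the discs of
radius 1/2 that are lost are disjoint, so the sum controls u everywhere.

The non-selfadjoint part contributes (ε/h) ∫ (|u|² + 8h²|∇u|²). The imaginary part of the pairing of
(P - iε)u with u controls ε‖u‖², and the real part controls h²‖∇u‖² (`mass_energy_le`). Young's
inequality with a small multiple of h allows absorption into the left side.

Bijectivity is the usual argument for a symmetric operator: the lower bound ε‖u‖ ≤ ‖(P - iε)u‖,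
closedness of the Laplacian on H², and dense range by elliptic regularity. Schwartz functions,
truncated at radius 1/k with k → 0, carry the estimate to H². -/

namespace SemiclassicalResolvent

noncomputable section

/-! ### Coordinate derivatives on the plane -/

/-- The `i`-th standard basis vector of the plane. -/
def basisVec (i : Fin 2) : Plane := EuclideanSpace.single i (1 : ℝ)

/-- The partial derivative `∂ᵢ f`. -/
def pd (i : Fin 2) (f : Plane → ℝ) (x : Plane) : ℝ := fderiv ℝ f x (basisVec i)

/-- The Laplacian in coordinates. -/
def lap (f : Plane → ℝ) (x : Plane) : ℝ := pd 0 (pd 0 f) x + pd 1 (pd 1 f) x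

/-- The Euler field `x · ∇`. -/
def eulerD (f : Plane → ℝ) (x : Plane) : ℝ := x 0 * pd 0 f x + x 1 * pd 1 f x

/-- The rotation field `x₀ ∂₁ - x₁ ∂₀`. -/
def rotD (f : Plane → ℝ) (x : Plane) : ℝ := x 0 * pd 1 f x - x 1 * pd 0 f x

theorem basisVec_apply (i j : Fin 2) : basisVec i j = if j = i then 1 else 0 := by
  simp [basisVec]

theorem plane_norm_sq (x : Plane) : ‖x‖ ^ 2 = x 0 ^ 2 + x 1 ^ 2 := by
  simp [EuclideanSpace.norm_sq_eq, Fin.sum_univ_two]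

theorem plane_eq_sum (x : Plane) : x = x 0 • basisVec 0 + x 1 • basisVec 1 := by
  ext i
  fin_cases i <;> simp [basisVec]

theorem contDiff_coord (i : Fin 2) : ContDiff ℝ ∞ (fun x : Plane => x i) := by
  fun_prop

theorem pd_coord (i j : Fin 2) (x : Plane) :
    pd i (fun y : Plane => y j) x = if j = i then 1 else 0 := by
  have h : (fun y : Plane => y j) = EuclideanSpace.proj (𝕜 := ℝ) j := by ext; simp
  rw [pd, h, ContinuousLinearMap.fderiv]
  simp [basisVec_apply]

theorem pd_mul (i : Fin 2) {f g : Plane → ℝ} {x : Plane} (hf : DifferentiableAt ℝ f x)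
    (hg : DifferentiableAt ℝ g x) :
    pd i (fun y => f y * g y) x = pd i f x * g x + f x * pd i g x := by
  simp only [pd]
  rw [fderiv_fun_mul hf hg]
  simp
  ring

theorem pd_add (i : Fin 2) {f g : Plane → ℝ} {x : Plane} (hf : DifferentiableAt ℝ f x)
    (hg : DifferentiableAt ℝ g x) :
    pd i (fun y => f y + g y) x = pd i f x + pd i g x := by
  simp only [pd]
  rw [fderiv_fun_add hf hg]
  simp

theorem pd_sub (i : Fin 2) {f g : Plane → ℝ} {x : Plane} (hf : DifferentiableAt ℝ f x)
    (hg : DifferentiableAt ℝ g x) :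
    pd i (fun y => f y - g y) x = pd i f x - pd i g x := by
  simp only [pd]
  rw [fderiv_fun_sub hf hg]
  simp

theorem contDiff_pd (i : Fin 2) {f : Plane → ℝ} (hf : ContDiff ℝ ∞ f) :
    ContDiff ℝ ∞ (pd i f) :=
  (hf.fderiv_right (m := ∞) (by simp)).clm_apply contDiff_const

theorem pd_comm {f : Plane → ℝ} {x : Plane} (hf : ContDiffAt ℝ ∞ f x) :
    pd 0 (pd 1 f) x = pd 1 (pd 0 f) x := by
  have hd : DifferentiableAt ℝ (fderiv ℝ f) x :=
    (hf.fderiv_right (m := ∞) (by simp)).differentiableAt (by simp)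
  have hs : IsSymmSndFDerivAt ℝ f x := hf.isSymmSndFDerivAt (by simpa using (mod_cast le_top : ((2 : ℕ∞) : WithTop ℕ∞) ≤ ∞))
  have key : ∀ i j, pd i (pd j f) x = fderiv ℝ (fderiv ℝ f) x (basisVec i) (basisVec j) := by
    intro i j
    have : pd j f = fun y => fderiv ℝ f y (basisVec j) := rfl
    rw [pd, this, fderiv_clm_apply hd (differentiableAt_const _)]
    simp
  rw [key, key, hs.eq]

theorem differentiableAt_coord (i : Fin 2) (x : Plane) :
    DifferentiableAt ℝ (fun x : Plane => x i) x := by fun_prop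

theorem pd_eulerD (i : Fin 2) {f : Plane → ℝ} (hf : ContDiff ℝ ∞ f) (x : Plane) :
    pd i (eulerD f) x = pd i (fun y : Plane => y 0) x * pd 0 f x + x 0 * pd i (pd 0 f) x
      + (pd i (fun y : Plane => y 1) x * pd 1 f x + x 1 * pd i (pd 1 f) x) := by
  have hd : ∀ i, DifferentiableAt ℝ (pd i f) x := fun i =>
    (contDiff_pd i hf).contDiffAt.differentiableAt (by simp)
  have hc := differentiableAt_coord
  have : eulerD f = fun y => y 0 * pd 0 f y + y 1 * pd 1 f y := rfl
  rw [this, pd_add i ((hc 0 x).fun_mul (hd 0)) ((hc 1 x).fun_mul (hd 1)),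
    pd_mul i (hc 0 x) (hd 0), pd_mul i (hc 1 x) (hd 1)]

theorem pd_rotD (i : Fin 2) {f : Plane → ℝ} (hf : ContDiff ℝ ∞ f) (x : Plane) :
    pd i (rotD f) x = pd i (fun y : Plane => y 0) x * pd 1 f x + x 0 * pd i (pd 1 f) x
      - (pd i (fun y : Plane => y 1) x * pd 0 f x + x 1 * pd i (pd 0 f) x) := by
  have hd : ∀ i, DifferentiableAt ℝ (pd i f) x := fun i =>
    (contDiff_pd i hf).contDiffAt.differentiableAt (by simp)
  have hc := differentiableAt_coord
  have : rotD f = fun y => y 0 * pd 1 f y - y 1 * pd 0 f y := rfl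
  rw [this, pd_sub i ((hc 0 x).fun_mul (hd 1)) ((hc 1 x).fun_mul (hd 0)),
    pd_mul i (hc 0 x) (hd 1), pd_mul i (hc 1 x) (hd 0)]

/-- This is r²Δ = ∂_t² + ∂_θ² with t = log r. Working with the two vector fields keeps everything in
Cartesian coordinates and avoids both a change of variables and an expansion in angular modes. -/
theorem norm_sq_mul_lap {f : Plane → ℝ} (hf : ContDiff ℝ ∞ f) (x : Plane) :
    ‖x‖ ^ 2 * lap f x = eulerD (eulerD f) x + rotD (rotD f) x := by
  have hs := pd_comm (hf.contDiffAt (x := x))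
  rw [eulerD, rotD, pd_eulerD _ hf, pd_eulerD _ hf, pd_rotD _ hf, pd_rotD _ hf, plane_norm_sq, lap]
  simp only [pd_coord]
  simp
  rw [hs]
  ring

theorem eulerD_rotD_comm {f : Plane → ℝ} (hf : ContDiff ℝ ∞ f) (x : Plane) :
    eulerD (rotD f) x = rotD (eulerD f) x := by
  have hs := pd_comm (hf.contDiffAt (x := x))
  rw [eulerD, rotD, pd_eulerD _ hf, pd_eulerD _ hf, pd_rotD _ hf, pd_rotD _ hf]
  simp only [pd_coord]
  simp
  rw [hs]
  ring

theorem integral_pd_eq_zero (i : Fin 2) {f : Plane → ℝ} (hf : ContDiff ℝ ∞ f)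
    (hc : HasCompactSupport f) : ∫ x, pd i f x = 0 := by
  have hi : Integrable f := hf.continuous.integrable_of_hasCompactSupport hc
  have hc' : HasCompactSupport (pd i f) :=
    (hc.fderiv (𝕜 := ℝ)).comp_left (g := fun L : Plane →L[ℝ] ℝ => L (basisVec i)) (by simp)
  have hi' : Integrable (pd i f) := (contDiff_pd i hf).continuous.integrable_of_hasCompactSupport hc'
  have h := integral_mul_fderiv_eq_neg_fderiv_mul_of_integrable (μ := (volume : Measure Plane))
    (f := fun _ : Plane => (1 : ℝ)) (g := f) (v := basisVec i) (by simp)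
    (by simpa only [one_mul] using! hi') (by simpa using hi)
    (fun x _ => differentiableAt_const _) (fun x _ => hf.contDiffAt.differentiableAt (by simp))
  simpa [pd] using h

/-! ### Radial functions in the logarithmic variable -/

/-- The logarithm of the distance to the origin. -/
def ell (x : Plane) : ℝ := Real.log ‖x‖

theorem exp_ell {x : Plane} (hx : x ≠ 0) : Real.exp (ell x) = ‖x‖ :=
  Real.exp_log (norm_pos_iff.mpr hx)

theorem exp_two_ell {x : Plane} (hx : x ≠ 0) : Real.exp (2 * ell x) = ‖x‖ ^ 2 := by
  rw [two_mul, Real.exp_add, exp_ell hx, sq]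

theorem contDiffAt_ell {x : Plane} (hx : x ≠ 0) : ContDiffAt ℝ ∞ ell x :=
  (contDiffAt_norm ℝ hx).log (norm_ne_zero_iff.mpr hx)

theorem contDiffAt_radial {W : ℝ → ℝ} (hW : ContDiff ℝ ∞ W) {x : Plane} (hx : x ≠ 0) :
    ContDiffAt ℝ ∞ (fun y => W (ell y)) x :=
  hW.contDiffAt.comp x (contDiffAt_ell hx)

theorem pd_ell (i : Fin 2) {x : Plane} (hx : x ≠ 0) : pd i ell x = x i / ‖x‖ ^ 2 := by
  have h1 : ell = fun y : Plane => (1 / 2 : ℝ) * Real.log (‖y‖ ^ 2) := by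
    funext y
    rw [ell, Real.log_pow]
    push_cast
    ring
  have hn : ‖x‖ ^ 2 ≠ 0 := pow_ne_zero 2 (norm_ne_zero_iff.mpr hx)
  have h2 : HasFDerivAt ell ((1 / 2 : ℝ) • ((‖x‖ ^ 2)⁻¹ • (2 • innerSL ℝ x))) x := by
    rw [h1]
    exact ((hasStrictFDerivAt_norm_sq x).hasFDerivAt.log hn).const_mul (1 / 2 : ℝ)
  rw [pd, h2.fderiv]
  simp [basisVec, EuclideanSpace.inner_single_right]
  field_simp

theorem pd_radial (i : Fin 2) {W : ℝ → ℝ} (hW : ContDiff ℝ ∞ W) {x : Plane} (hx : x ≠ 0) :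
    pd i (fun y => W (ell y)) x = deriv W (ell x) * (x i / ‖x‖ ^ 2) := by
  have h1 : HasDerivAt W (deriv W (ell x)) (ell x) :=
    (hW.differentiable (by simp)).differentiableAt.hasDerivAt
  have h2 : HasFDerivAt ell (fderiv ℝ ell x) x :=
    ((contDiffAt_ell hx).differentiableAt (by simp)).hasFDerivAt
  have h3 := h1.comp_hasFDerivAt x h2
  have h4 : pd i (fun y => W (ell y)) x = deriv W (ell x) * pd i ell x := by
    simp only [pd]
    have : (fun y => W (ell y)) = W ∘ ell := rfl
    rw [this, h3.fderiv]
    simp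
  rw [h4, pd_ell i hx]

theorem eulerD_radial {W : ℝ → ℝ} (hW : ContDiff ℝ ∞ W) {x : Plane} (hx : x ≠ 0) :
    eulerD (fun y => W (ell y)) x = deriv W (ell x) := by
  have hn : ‖x‖ ^ 2 ≠ 0 := pow_ne_zero 2 (norm_ne_zero_iff.mpr hx)
  rw [eulerD, pd_radial 0 hW hx, pd_radial 1 hW hx]
  field_simp
  rw [plane_norm_sq]

theorem rotD_radial {W : ℝ → ℝ} (hW : ContDiff ℝ ∞ W) {x : Plane} (hx : x ≠ 0) :
    rotD (fun y => W (ell y)) x = 0 := by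
  rw [rotD, pd_radial 0 hW hx, pd_radial 1 hW hx]
  ring

/-! ### Test functions supported away from the origin -/

/-- Smooth real functions with compact support in the punctured plane. -/
structure PuncturedTest (f : Plane → ℝ) : Prop where
  smooth : ContDiff ℝ ∞ f
  compact : HasCompactSupport f
  zero_notMem : (0 : Plane) ∉ tsupport f

namespace PuncturedTest

variable {f g : Plane → ℝ}

theorem eventually_zero (hf : PuncturedTest f) : f =ᶠ[nhds 0] 0 :=
  notMem_tsupport_iff_eventuallyEq.mp hf.zero_notMem

theorem at_zero (hf : PuncturedTest f) : f 0 = 0 := hf.eventually_zero.eq_of_nhds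

theorem differentiableAt (hf : PuncturedTest f) (x : Plane) : DifferentiableAt ℝ f x :=
  hf.smooth.contDiffAt.differentiableAt (by simp)

theorem continuous (hf : PuncturedTest f) : Continuous f := hf.smooth.continuous

theorem integrable (hf : PuncturedTest f) : Integrable f :=
  hf.continuous.integrable_of_hasCompactSupport hf.compact

theorem of_support (hf : PuncturedTest f) (hg : ContDiff ℝ ∞ g) (h : tsupport g ⊆ tsupport f) :
    PuncturedTest g :=
  ⟨hg, hf.compact.of_isClosed_subset (isClosed_tsupport g) h, fun h0 => hf.zero_notMem (h h0)⟩

theorem mul_left {a : Plane → ℝ} (ha : ∀ x ≠ 0, ContDiffAt ℝ ∞ a x) (hf : PuncturedTest f) :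
    PuncturedTest (fun x => a x * f x) := by
  refine hf.of_support ?_ (tsupport_mul_subset_right (f := a) (g := f))
  rw [contDiff_iff_contDiffAt]
  intro x
  by_cases hx : x = 0
  · subst hx
    refine (contDiffAt_const (c := (0 : ℝ))).congr_of_eventuallyEq ?_
    filter_upwards [hf.eventually_zero] with y hy
    simp [hy]
  · exact (ha x hx).mul hf.smooth.contDiffAt

theorem mul (hf : PuncturedTest f) (hg : PuncturedTest g) : PuncturedTest (fun x => f x * g x) :=
  hg.mul_left fun _ _ => hf.smooth.contDiffAt

theorem radial_mul {W : ℝ → ℝ} (hW : ContDiff ℝ ∞ W) (hf : PuncturedTest f) :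
    PuncturedTest (fun x => W (ell x) * f x) :=
  hf.mul_left fun _ hx => contDiffAt_radial hW hx

theorem add (hf : PuncturedTest f) (hg : PuncturedTest g) :
    PuncturedTest (fun x => f x + g x) := by
  refine ⟨hf.smooth.add hg.smooth, hf.compact.add hg.compact, fun h => ?_⟩
  have h1 : tsupport (fun x => f x + g x) ⊆ tsupport f ∪ tsupport g := tsupport_add f g
  rcases h1 h with h | h
  exacts [hf.zero_notMem h, hg.zero_notMem h]

theorem const_mul (c : ℝ) (hf : PuncturedTest f) : PuncturedTest (fun x => c * f x) :=
  hf.mul_left fun _ _ => contDiffAt_const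

theorem pd (i : Fin 2) (hf : PuncturedTest f) : PuncturedTest (pd i f) := by
  refine hf.of_support (contDiff_pd i hf.smooth) ?_
  refine (closure_mono ?_).trans (tsupport_fderiv_subset ℝ (f := f))
  intro x hx h
  exact hx (by simp [SemiclassicalResolvent.pd, h])

theorem eulerD (hf : PuncturedTest f) : PuncturedTest (eulerD f) :=
  ((hf.pd 0).mul_left fun _ _ => (contDiff_coord 0).contDiffAt).add
    ((hf.pd 1).mul_left fun _ _ => (contDiff_coord 1).contDiffAt)

theorem rotD (hf : PuncturedTest f) : PuncturedTest (rotD f) := by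
  have h := ((hf.pd 1).mul_left fun _ _ => (contDiff_coord 0).contDiffAt).add
    (((hf.pd 0).mul_left fun _ _ => (contDiff_coord 1).contDiffAt).const_mul (-1))
  convert h using 2 with x
  simp [SemiclassicalResolvent.rotD]
  ring

end PuncturedTest

/-- The factor `a` may be singular at the origin; there both sides vanish because `f` is zero in a
neighbourhood. -/
theorem pd_mul_left (i : Fin 2) {a f : Plane → ℝ} (ha : ∀ x ≠ 0, ContDiffAt ℝ ∞ a x)
    (hf : PuncturedTest f) (x : Plane) :
    pd i (fun y => a y * f y) x = pd i a x * f x + a x * pd i f x := by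
  by_cases hx : x = 0
  · subst hx
    rw [(hf.pd i).at_zero, hf.at_zero, (hf.mul_left ha).pd i |>.at_zero]
    simp
  · exact pd_mul i ((ha x hx).differentiableAt (by simp)) (hf.differentiableAt x)

theorem eulerD_mul_left {a f : Plane → ℝ} (ha : ∀ x ≠ 0, ContDiffAt ℝ ∞ a x)
    (hf : PuncturedTest f) (x : Plane) :
    eulerD (fun y => a y * f y) x = eulerD a x * f x + a x * eulerD f x := by
  simp only [eulerD, pd_mul_left _ ha hf]
  ring

theorem rotD_mul_left {a f : Plane → ℝ} (ha : ∀ x ≠ 0, ContDiffAt ℝ ∞ a x)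
    (hf : PuncturedTest f) (x : Plane) :
    rotD (fun y => a y * f y) x = rotD a x * f x + a x * rotD f x := by
  simp only [rotD, pd_mul_left _ ha hf]
  ring

theorem eulerD_radial_mul {W : ℝ → ℝ} (hW : ContDiff ℝ ∞ W) {f : Plane → ℝ}
    (hf : PuncturedTest f) (x : Plane) :
    eulerD (fun y => W (ell y) * f y) x
      = deriv W (ell x) * f x + W (ell x) * eulerD f x := by
  rw [eulerD_mul_left (fun _ hx => contDiffAt_radial hW hx) hf]
  by_cases hx : x = 0
  · subst hx
    simp [hf.at_zero]
  · rw [eulerD_radial hW hx]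

theorem rotD_radial_mul {W : ℝ → ℝ} (hW : ContDiff ℝ ∞ W) {f : Plane → ℝ}
    (hf : PuncturedTest f) (x : Plane) :
    rotD (fun y => W (ell y) * f y) x = W (ell x) * rotD f x := by
  rw [rotD_mul_left (fun _ hx => contDiffAt_radial hW hx) hf]
  by_cases hx : x = 0
  · subst hx
    simp [hf.at_zero]
  · rw [rotD_radial hW hx]
    ring

theorem contDiff_exp_neg_two : ContDiff ℝ ∞ (fun t : ℝ => Real.exp (-2 * t)) := by fun_prop

theorem deriv_exp_neg_two (t : ℝ) :
    deriv (fun t : ℝ => Real.exp (-2 * t)) t = -2 * Real.exp (-2 * t) := by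
  have h : HasDerivAt (fun t : ℝ => -2 * t) (-2) t := by
    simpa using (hasDerivAt_id t).const_mul (-2 : ℝ)
  rw [h.exp.deriv]
  ring

/-- In two dimensions x/|x|² is divergence free away from the origin, so nothing is left over when
the weight is moved inside the divergence. -/
theorem exp_mul_eulerD_eq_div {f : Plane → ℝ} (hf : PuncturedTest f) (x : Plane) :
    Real.exp (-2 * ell x) * eulerD f x
      = pd 0 (fun x : Plane => x 0 * (Real.exp (-2 * ell x) * f x)) x
        + pd 1 (fun x : Plane => x 1 * (Real.exp (-2 * ell x) * f x)) x := by
  have hg := hf.radial_mul contDiff_exp_neg_two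
  have h1 := eulerD_radial_mul contDiff_exp_neg_two hf x
  rw [deriv_exp_neg_two] at h1
  rw [pd_mul_left 0 (fun _ _ => (contDiff_coord 0).contDiffAt) hg,
    pd_mul_left 1 (fun _ _ => (contDiff_coord 1).contDiffAt) hg, pd_coord, pd_coord]
  simp only [eulerD] at h1 ⊢
  simp only [if_true]
  linarith

/-- The invariant measure `dx / |x|²` is annihilated by the Euler field. -/
theorem integral_eulerD {f : Plane → ℝ} (hf : PuncturedTest f) :
    ∫ x, Real.exp (-2 * ell x) * eulerD f x = 0 := by
  have hc : ∀ i, PuncturedTest (fun x : Plane => x i * (Real.exp (-2 * ell x) * f x)) := fun i =>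
    (hf.radial_mul contDiff_exp_neg_two).mul_left fun _ _ => (contDiff_coord i).contDiffAt
  simp_rw [exp_mul_eulerD_eq_div hf]
  rw [integral_add ((hc 0).pd 0).integrable ((hc 1).pd 1).integrable,
    integral_pd_eq_zero 0 (hc 0).smooth (hc 0).compact,
    integral_pd_eq_zero 1 (hc 1).smooth (hc 1).compact, add_zero]

/-- The invariant measure `dx / |x|²` is annihilated by the rotation field. -/
theorem integral_rotD {f : Plane → ℝ} (hf : PuncturedTest f) :
    ∫ x, Real.exp (-2 * ell x) * rotD f x = 0 := by
  have hg := hf.radial_mul contDiff_exp_neg_two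
  have hc : ∀ i, PuncturedTest (fun x : Plane => x i * (Real.exp (-2 * ell x) * f x)) := fun i =>
    hg.mul_left fun _ _ => (contDiff_coord i).contDiffAt
  have h : ∀ x, Real.exp (-2 * ell x) * rotD f x
      = pd 1 (fun x : Plane => x 0 * (Real.exp (-2 * ell x) * f x)) x
        - pd 0 (fun x : Plane => x 1 * (Real.exp (-2 * ell x) * f x)) x := by
    intro x
    have h1 := rotD_radial_mul contDiff_exp_neg_two hf x
    rw [pd_mul_left 1 (fun _ _ => (contDiff_coord 0).contDiffAt) hg,
      pd_mul_left 0 (fun _ _ => (contDiff_coord 1).contDiffAt) hg, pd_coord, pd_coord, ← h1]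
    simp only [rotD]
    simp
  simp_rw [h]
  rw [integral_sub ((hc 0).pd 1).integrable ((hc 1).pd 0).integrable,
    integral_pd_eq_zero 1 (hc 0).smooth (hc 0).compact,
    integral_pd_eq_zero 0 (hc 1).smooth (hc 1).compact, sub_zero]

theorem _root_.MeasureTheory.Integrable.mul_memLp_top {f V : Plane → ℝ} (hf : Integrable f)
    (hV : MemLp V ⊤ volume) : Integrable (fun x => V x * f x) := by
  have h := MemLp.mul (p := ⊤) (q := 1) (r := 1) (memLp_one_iff_integrable.mpr hf) hV
  exact memLp_one_iff_integrable.mp h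

theorem exp_mul_inner_eq (g : Plane → Plane) (f : Plane → ℝ) (x : Plane) :
    Real.exp (-2 * ell x) * (inner ℝ (g x) x * f x)
      = inner ℝ (g x) (basisVec 0) * (x 0 * (Real.exp (-2 * ell x) * f x))
        + inner ℝ (g x) (basisVec 1) * (x 1 * (Real.exp (-2 * ell x) * f x)) := by
  have h : inner ℝ (g x) x = x 0 * inner ℝ (g x) (basisVec 0)
      + x 1 * inner ℝ (g x) (basisVec 1) := by
    have h1 := congrArg (inner ℝ (g x)) (plane_eq_sum x)
    rwa [inner_add_right, inner_smul_right, inner_smul_right] at h1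
  rw [h]
  ring

theorem integrable_exp_mul_inner {g : Plane → Plane} (hgm : MemLp g ⊤ volume) {f : Plane → ℝ}
    (hf : PuncturedTest f) :
    Integrable (fun x => Real.exp (-2 * ell x) * (inner ℝ (g x) x * f x)) := by
  have hc : ∀ i, PuncturedTest (fun x : Plane => x i * (Real.exp (-2 * ell x) * f x)) := fun i =>
    (hf.radial_mul contDiff_exp_neg_two).mul_left fun _ _ => (contDiff_coord i).contDiffAt
  simp_rw [exp_mul_inner_eq]
  exact ((hc 0).integrable.mul_memLp_top (hgm.inner_const _)).add
    ((hc 1).integrable.mul_memLp_top (hgm.inner_const _))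

/-- Integration of a weakly differentiable potential against an Euler derivative. -/
theorem IsWeakGradient.integral_eulerD {V : Plane → ℝ} {g : Plane → Plane}
    (hV : MemLp V ⊤ volume) (hgm : MemLp g ⊤ volume)
    (hg : IsWeakGradient V g) {f : Plane → ℝ} (hf : PuncturedTest f) :
    ∫ x, Real.exp (-2 * ell x) * (V x * eulerD f x)
      = -∫ x, Real.exp (-2 * ell x) * (inner ℝ (g x) x * f x) := by
  have hc : ∀ i, PuncturedTest (fun x : Plane => x i * (Real.exp (-2 * ell x) * f x)) := fun i =>
    (hf.radial_mul contDiff_exp_neg_two).mul_left fun _ _ => (contDiff_coord i).contDiffAt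
  have key := fun i => hg _ (hc i).smooth (hc i).compact (basisVec i)
  have hl : ∀ x, Real.exp (-2 * ell x) * (V x * eulerD f x)
      = V x * pd 0 (fun x : Plane => x 0 * (Real.exp (-2 * ell x) * f x)) x
        + V x * pd 1 (fun x : Plane => x 1 * (Real.exp (-2 * ell x) * f x)) x := by
    intro x
    rw [← mul_add, ← exp_mul_eulerD_eq_div hf]
    ring
  have hin : ∀ i, MemLp (fun x => inner ℝ (g x) (basisVec i)) ⊤ volume := fun i =>
    hgm.inner_const (basisVec i)
  simp_rw [hl, exp_mul_inner_eq]
  rw [integral_add (((hc 0).pd 0).integrable.mul_memLp_top hV)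
      (((hc 1).pd 1).integrable.mul_memLp_top hV),
    integral_add ((hc 0).integrable.mul_memLp_top (hin 0))
      ((hc 1).integrable.mul_memLp_top (hin 1)), neg_add]
  exact congrArg₂ _ (key 0) (key 1)

/-! ### The multiplier identity -/

/-- The integrand is the Euler derivative of W f², which integrates to zero against dx/|x|². -/
theorem integral_radial_sq {W : ℝ → ℝ} (hW : ContDiff ℝ ∞ W) {f : Plane → ℝ}
    (hf : PuncturedTest f) :
    Integrable (fun x => Real.exp (-2 * ell x)
      * (deriv W (ell x) * (f x * f x) + 2 * (W (ell x) * (f x * eulerD f x)))) ∧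
    ∫ x, Real.exp (-2 * ell x)
      * (deriv W (ell x) * (f x * f x) + 2 * (W (ell x) * (f x * eulerD f x))) = 0 := by
  have h1 := (hf.mul hf).radial_mul hW
  have h2 : ∀ x, deriv W (ell x) * (f x * f x) + 2 * (W (ell x) * (f x * eulerD f x))
      = eulerD (fun x => W (ell x) * (f x * f x)) x := by
    intro x
    rw [eulerD_radial_mul hW (hf.mul hf), eulerD_mul_left (fun _ _ => hf.smooth.contDiffAt) hf]
    ring
  simp_rw [h2]
  exact ⟨(h1.eulerD.radial_mul contDiff_exp_neg_two).integrable, integral_eulerD h1⟩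

theorem integral_radial_rotD {W : ℝ → ℝ} (hW : ContDiff ℝ ∞ W) {f g : Plane → ℝ}
    (hf : PuncturedTest f) (hg : PuncturedTest g) :
    Integrable (fun x => Real.exp (-2 * ell x)
      * (W (ell x) * (rotD f x * g x + f x * rotD g x))) ∧
    ∫ x, Real.exp (-2 * ell x) * (W (ell x) * (rotD f x * g x + f x * rotD g x)) = 0 := by
  have h1 := (hf.mul hg).radial_mul hW
  have h2 : ∀ x, W (ell x) * (rotD f x * g x + f x * rotD g x)
      = rotD (fun x => W (ell x) * (f x * g x)) x := by
    intro x
    rw [rotD_radial_mul hW (hf.mul hg), rotD_mul_left (fun _ _ => hf.smooth.contDiffAt) hg]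
  simp_rw [h2]
  exact ⟨(h1.rotD.radial_mul contDiff_exp_neg_two).integrable, integral_rotD h1⟩

/-- The Euler derivative of W f² is integrated by parts against V. The distributional gradient
suffices because W f² is itself a smooth test function. -/
theorem integral_potential {V : Plane → ℝ} {g : Plane → Plane}
    (hV : MemLp V ⊤ volume) (hgm : MemLp g ⊤ volume) (hg : IsWeakGradient V g)
    {W : ℝ → ℝ} (hW : ContDiff ℝ ∞ W) {f : Plane → ℝ} (hf : PuncturedTest f) :
    Integrable (fun x => Real.exp (-2 * ell x)
      * (V x * (deriv W (ell x) * (f x * f x) + 2 * (W (ell x) * (f x * eulerD f x)))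
        + inner ℝ (g x) x * (W (ell x) * (f x * f x)))) ∧
    ∫ x, Real.exp (-2 * ell x)
      * (V x * (deriv W (ell x) * (f x * f x) + 2 * (W (ell x) * (f x * eulerD f x)))
        + inner ℝ (g x) x * (W (ell x) * (f x * f x))) = 0 := by
  have h1 := (hf.mul hf).radial_mul hW
  have h2 : ∀ x, deriv W (ell x) * (f x * f x) + 2 * (W (ell x) * (f x * eulerD f x))
      = eulerD (fun x => W (ell x) * (f x * f x)) x := by
    intro x
    rw [eulerD_radial_mul hW (hf.mul hf), eulerD_mul_left (fun _ _ => hf.smooth.contDiffAt) hf]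
    ring
  simp_rw [h2, mul_add]
  have i1 : Integrable (fun x => Real.exp (-2 * ell x)
      * (V x * eulerD (fun x => W (ell x) * (f x * f x)) x)) := by
    have := (h1.eulerD.radial_mul contDiff_exp_neg_two).integrable.mul_memLp_top hV
    refine this.congr (Filter.Eventually.of_forall fun x => ?_)
    simp only
    ring
  have i2 := integrable_exp_mul_inner hgm h1
  refine ⟨i1.add i2, ?_⟩
  rw [integral_add i1 i2, hg.integral_eulerD hV hgm h1]
  ring

/-- The conjugated operator in logarithmic polar coordinates; `z` is the logarithmic derivative of
the conjugating factor, up to the factor `h`. -/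
def conjOp (V : Plane → ℝ) (E h : ℝ) (z : ℝ → ℝ) (y : Plane → ℝ) (x : Plane) : ℝ :=
  -h ^ 2 * (eulerD (eulerD y) x + rotD (rotD y) x) + 2 * h * z (ell x) * eulerD y x
    + (h * deriv z (ell x) - z (ell x) ^ 2) * y x
    + Real.exp (2 * ell x) * ((V x - E) * y x)

/-- The difference of the two sides of the energy identity, as an integrand. -/
def energyDefect (V : Plane → ℝ) (g : Plane → Plane) (E h : ℝ) (M z : ℝ → ℝ) (y : Plane → ℝ)
    (x : Plane) : ℝ :=
  2 * M (ell x) * conjOp V E h z y x * eulerD y x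
    - ((h ^ 2 * deriv M (ell x) + 4 * h * z (ell x) * M (ell x)) * eulerD y x ^ 2
    - h ^ 2 * deriv M (ell x) * rotD y x ^ 2
    + (-deriv (fun t => M t * (h * deriv z t - z t ^ 2 - E * Real.exp (2 * t))) (ell x)
        - V x * deriv (fun t => M t * Real.exp (2 * t)) (ell x)
        - inner ℝ (g x) x * (M (ell x) * Real.exp (2 * ell x))) * y x ^ 2)

/-- The energy identity obtained by pairing `conjOp` with the radial derivative. -/
theorem integral_energyDefect {V : Plane → ℝ} {g : Plane → Plane}
    (hV : MemLp V ⊤ volume) (hgm : MemLp g ⊤ volume) (hg : IsWeakGradient V g)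
    (E h : ℝ) {M z : ℝ → ℝ} (hM : ContDiff ℝ ∞ M) (hz : ContDiff ℝ ∞ z) {y : Plane → ℝ}
    (hy : PuncturedTest y) :
    Integrable (fun x => Real.exp (-2 * ell x) * energyDefect V g E h M z y x) ∧
    ∫ x, Real.exp (-2 * ell x) * energyDefect V g E h M z y x = 0 := by
  have hz' : ContDiff ℝ ∞ (deriv z) := (contDiff_infty_iff_deriv.mp hz).2
  have hM1 : ContDiff ℝ ∞ (fun t => -h ^ 2 * M t) := contDiff_const.mul hM
  have hM2 : ContDiff ℝ ∞ (fun t => h ^ 2 * M t) := contDiff_const.mul hM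
  have hM3 : ContDiff ℝ ∞ (fun t => -2 * h ^ 2 * M t) := contDiff_const.mul hM
  have hM4 : ContDiff ℝ ∞ (fun t => M t * (h * deriv z t - z t ^ 2 - E * Real.exp (2 * t))) := by
    fun_prop
  have hM5 : ContDiff ℝ ∞ (fun t => M t * Real.exp (2 * t)) := by fun_prop
  -- Five exact derivatives make up the defect: the first turns the second radial derivative into a
  -- square; the second and third move one rotation derivative across and then integrate radially;
  -- the last two treat the smooth and the rough part of the zeroth-order term. The first-order term
  -- of `conjOp` is already a square and needs no integration.
  obtain ⟨i1, e1⟩ := integral_radial_sq hM1 hy.eulerD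
  obtain ⟨i2, e2⟩ := integral_radial_sq hM2 hy.rotD
  obtain ⟨i3, e3⟩ := integral_radial_rotD hM3 hy.rotD hy.eulerD
  obtain ⟨i4, e4⟩ := integral_radial_sq hM4 hy
  obtain ⟨i5, e5⟩ := integral_potential hV hgm hg hM5 hy
  have d : ∀ (c t : ℝ), deriv (fun t => c * M t) t = c * deriv M t := fun c t =>
    deriv_const_mul c ((hM.differentiable (by simp)).differentiableAt)
  have hI := (((i1.add i2).add i3).add i4).add i5
  have hE := integral_add (((i1.add i2).add i3).add i4) i5
  rw [integral_add' ((i1.add i2).add i3) i4, integral_add' (i1.add i2) i3, integral_add' i1 i2,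
    e1, e2, e3, e4, e5] at hE
  refine ⟨hI.congr (Filter.Eventually.of_forall fun x => ?_),
    ((integral_congr_ae (Filter.Eventually.of_forall fun x => ?_)).trans hE).trans (by simp)⟩
  all_goals
    simp only [Pi.add_apply]
    rw [d, d, eulerD_rotD_comm hy.smooth, energyDefect, conjOp]
    ring

/-- Conjugation by a radial factor. -/
theorem conjOp_radial_mul (V : Plane → ℝ) (E : ℝ) {h : ℝ} (hh : h ≠ 0) {lam z : ℝ → ℝ}
    (hlam : ContDiff ℝ ∞ lam) (hz : ContDiff ℝ ∞ z) (hd : ∀ t, deriv lam t = z t / h * lam t)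
    {u : Plane → ℝ} (hu : PuncturedTest u) (x : Plane) :
    conjOp V E h z (fun x => lam (ell x) * u x) x
      = lam (ell x) * (‖x‖ ^ 2 * (-h ^ 2 * lap u x + (V x - E) * u x)) := by
  have h1 : eulerD (fun x => lam (ell x) * u x)
      = fun x => lam (ell x) * (z (ell x) / h * u x + eulerD u x) := by
    funext x
    rw [eulerD_radial_mul hlam hu, hd]
    ring
  have hz2 : ContDiff ℝ ∞ (fun t => z t / h) := hz.div_const h
  have hzd : ∀ t, deriv (fun t => z t / h) t = deriv z t / h := fun t => deriv_div_const h
  have hadd : ∀ {f g : Plane → ℝ}, PuncturedTest f → PuncturedTest g →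
      eulerD (fun x => f x + g x) x = eulerD f x + eulerD g x := by
    intro f g hf hg
    simp only [eulerD, pd_add _ (hf.differentiableAt x) (hg.differentiableAt x)]
    ring
  have hq := hu.radial_mul hz2
  have h2 : eulerD (eulerD (fun x => lam (ell x) * u x)) x
      = lam (ell x) * ((z (ell x) / h) ^ 2 * u x + 2 * (z (ell x) / h) * eulerD u x
        + deriv z (ell x) / h * u x + eulerD (eulerD u) x) := by
    rw [h1, eulerD_radial_mul hlam (hq.add hu.eulerD), hd, hadd hq hu.eulerD,
      eulerD_radial_mul hz2 hu, hzd]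
    ring
  have h3 : rotD (rotD (fun x => lam (ell x) * u x)) x = lam (ell x) * rotD (rotD u) x := by
    have : rotD (fun x => lam (ell x) * u x) = fun x => lam (ell x) * rotD u x := by
      funext x
      rw [rotD_radial_mul hlam hu]
    rw [this, rotD_radial_mul hlam hu.rotD]
  have h4 := norm_sq_mul_lap hu.smooth x
  have h5 : Real.exp (2 * ell x) * u x = ‖x‖ ^ 2 * u x := by
    by_cases hx : x = 0
    · subst hx
      simp [hu.at_zero]
    · rw [exp_two_ell hx]
  rw [conjOp, h2, h3, h1]
  have h6 : Real.exp (2 * ell x) * ((V x - E) * (lam (ell x) * u x))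
      = (V x - E) * lam (ell x) * (‖x‖ ^ 2 * u x) := by
    rw [← h5]
    ring
  rw [h6]
  have h7 : lam (ell x) * (‖x‖ ^ 2 * (-h ^ 2 * lap u x + (V x - E) * u x))
      = -h ^ 2 * lam (ell x) * (‖x‖ ^ 2 * lap u x)
        + (V x - E) * lam (ell x) * (‖x‖ ^ 2 * u x) := by ring
  rw [h7, h4]
  field_simp
  ring

/-! ### Carleman weights in the logarithmic variable -/

/-- Radial weights, as functions of `t = log |x|`, adapted to potentials bounded above by
`c (1 + |x|)^{-δ₀}` with radial derivative bounded by `c (1 + |x|)^{-1-δ₀}`. -/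
structure CarlemanWeight (E c δ₀ δ : ℝ) where
  (T a h₀ : ℝ)
  (w rate slope phase : ℝ → ℝ)
  T_nonneg : 0 ≤ T
  a_nonneg : 0 ≤ a
  h₀_pos : 0 < h₀
  w_smooth : ContDiff ℝ ∞ w
  slope_smooth : ContDiff ℝ ∞ slope
  phase_smooth : ContDiff ℝ ∞ phase
  deriv_w : ∀ t, deriv w t = rate t * w t
  deriv_phase : ∀ t, deriv phase t = Real.exp t * slope t
  w_pos : ∀ t, 0 < w t
  w_le_two : ∀ t, w t ≤ 2
  w_le_exp : ∀ t, w t ≤ 2 * Real.exp (2 * t)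
  w_ge : ∀ t, Real.exp (2 * (t - T)) / (1 + Real.exp (2 * (t - T))) ≤ w t
  rate_ge : ∀ t, δ / 2 * (1 + Real.exp (2 * (t - T))) ^ (-(δ / 2)) ≤ rate t
  rate_le : ∀ t, rate t ≤ 2
  slope_nonneg : ∀ t, 0 ≤ slope t
  phase_nonpos : ∀ t, phase t ≤ 0
  phase_ge : ∀ t, -(a * Real.exp T) ≤ phase t
  phase_eq_zero : ∀ t, T ≤ t → phase t = 0
  coercive : ∀ h, 0 < h → h ≤ h₀ → ∀ t v p, v ≤ c * (1 + Real.exp t) ^ (-δ₀) →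
    p ≤ c * (1 + Real.exp t) ^ (-δ₀) →
    rate t * (E / 2) ≤ rate t * (E - v + slope t ^ 2) + 2 * slope t * deriv slope t
      - (2 - rate t) * (h ^ 2 * Real.exp (-2 * t)) / 4
      + h * Real.exp (-t) * ((1 - rate t) * deriv slope t - deriv (deriv slope) t) - p

/-! ### Derivative bounds for the smooth transition, and decay of the potential in the variable t.
-/

theorem smoothTransition_deriv_eq_zero {x : ℝ} (hx : x < 0 ∨ 1 < x) :
    deriv Real.smoothTransition x = 0 ∧ deriv (deriv Real.smoothTransition) x = 0 := by
  have h : ∀ c : ℝ, Real.smoothTransition =ᶠ[nhds x] (fun _ => c) →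
      deriv Real.smoothTransition x = 0 ∧ deriv (deriv Real.smoothTransition) x = 0 := by
    intro c hc
    refine ⟨by rw [hc.deriv_eq]; simp, ?_⟩
    rw [hc.deriv.deriv_eq]
    simp
  rcases hx with hx | hx
  · apply h 0
    filter_upwards [gt_mem_nhds hx] with y hy
    exact Real.smoothTransition.zero_of_nonpos (le_of_lt hy)
  · apply h 1
    filter_upwards [lt_mem_nhds hx] with y hy
    exact Real.smoothTransition.one_of_one_le (le_of_lt hy)

theorem contDiff_smoothTransition : ContDiff ℝ ∞ Real.smoothTransition :=
  Real.smoothTransition.contDiff (n := ⊤)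

theorem exists_smoothTransition_deriv_bound : ∃ B : ℝ, 0 ≤ B ∧ ∀ x,
    |deriv Real.smoothTransition x| ≤ B ∧ |deriv (deriv Real.smoothTransition) x| ≤ B := by
  have h1 : ContDiff ℝ ∞ (deriv Real.smoothTransition) :=
    (contDiff_infty_iff_deriv.mp contDiff_smoothTransition).2
  have h2 : ContDiff ℝ ∞ (deriv (deriv Real.smoothTransition)) :=
    (contDiff_infty_iff_deriv.mp h1).2
  obtain ⟨B1, hB1⟩ := (isCompact_Icc (a := (0 : ℝ)) (b := 1)).exists_bound_of_continuousOn
    h1.continuous.continuousOn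
  obtain ⟨B2, hB2⟩ := (isCompact_Icc (a := (0 : ℝ)) (b := 1)).exists_bound_of_continuousOn
    h2.continuous.continuousOn
  refine ⟨max 0 (max B1 B2), le_max_left _ _, fun x => ?_⟩
  by_cases hx : x ∈ Set.Icc (0 : ℝ) 1
  · exact ⟨(hB1 x hx).trans ((le_max_left _ _).trans (le_max_right _ _)),
      (hB2 x hx).trans ((le_max_right _ _).trans (le_max_right _ _))⟩
  · have : x < 0 ∨ 1 < x := by
      simp only [Set.mem_Icc, not_and_or, not_le] at hx
      exact hx
    obtain ⟨e1, e2⟩ := smoothTransition_deriv_eq_zero this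
    rw [e1, e2]
    simp

theorem rpow_one_add_exp_le_one {δ₀ : ℝ} (hδ : 0 ≤ δ₀) (t : ℝ) :
    (1 + Real.exp t) ^ (-δ₀) ≤ 1 :=
  Real.rpow_le_one_of_one_le_of_nonpos (by linarith [Real.exp_pos t]) (by linarith)

theorem rpow_one_add_exp_le_exp {δ₀ : ℝ} (hδ : 0 ≤ δ₀) (t : ℝ) :
    (1 + Real.exp t) ^ (-δ₀) ≤ Real.exp (-δ₀ * t) := by
  have h := Real.rpow_le_rpow_of_nonpos (Real.exp_pos t)
    (show Real.exp t ≤ 1 + Real.exp t by linarith) (show -δ₀ ≤ 0 by linarith)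
  rwa [← Real.exp_mul, mul_comm] at h

/-! ### The phase: steep near the origin, zero far out. -/

/-- The slope of the phase: constant up to `t = T - L` and zero from `t = T` on. -/
def phaseSlope (a T L t : ℝ) : ℝ := a * Real.smoothTransition ((T - t) / L)

theorem contDiff_phaseSlope (a T L : ℝ) : ContDiff ℝ ∞ (phaseSlope a T L) := by
  have h := contDiff_smoothTransition
  unfold phaseSlope
  exact contDiff_const.mul (h.comp (by fun_prop))

theorem deriv_phaseSlope (a T L t : ℝ) : deriv (phaseSlope a T L) t
    = -(a / L) * deriv Real.smoothTransition ((T - t) / L) := by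
  have h1 : HasDerivAt (fun t => (T - t) / L) (-1 / L) t :=
    ((hasDerivAt_id t).const_sub T).div_const L
  have h2 := ((contDiff_smoothTransition.differentiable (by simp)
    ((T - t) / L)).hasDerivAt.comp t h1).const_mul a
  have h3 : phaseSlope a T L
      = fun t => a * (Real.smoothTransition ∘ fun t => (T - t) / L) t := rfl
  rw [h3, h2.deriv]
  ring

theorem deriv_deriv_phaseSlope (a T L t : ℝ) : deriv (deriv (phaseSlope a T L)) t
    = a / L ^ 2 * deriv (deriv Real.smoothTransition) ((T - t) / L) := by
  have hs : ContDiff ℝ ∞ (deriv Real.smoothTransition) :=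
    (contDiff_infty_iff_deriv.mp contDiff_smoothTransition).2
  have h1 : HasDerivAt (fun t => (T - t) / L) (-1 / L) t :=
    ((hasDerivAt_id t).const_sub T).div_const L
  have h2 := ((hs.differentiable (by simp)
    ((T - t) / L)).hasDerivAt.comp t h1).const_mul (-(a / L))
  have h3 : deriv (phaseSlope a T L)
      = fun t => -(a / L) * (deriv Real.smoothTransition ∘ fun t => (T - t) / L) t := by
    funext t
    exact deriv_phaseSlope a T L t
  rw [h3, h2.deriv]
  ring

/-- The phase with derivative `e^t` times `phaseSlope`, normalised to vanish at `T`. -/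
def phaseFun (a T L t : ℝ) : ℝ := ∫ s in T..t, Real.exp s * phaseSlope a T L s

theorem hasDerivAt_phaseFun (a T L t : ℝ) :
    HasDerivAt (phaseFun a T L) (Real.exp t * phaseSlope a T L t) t := by
  have hc : Continuous (fun s => Real.exp s * phaseSlope a T L s) :=
    Real.continuous_exp.mul (contDiff_phaseSlope a T L).continuous
  exact intervalIntegral.integral_hasDerivAt_right (hc.intervalIntegrable _ _)
    (hc.stronglyMeasurableAtFilter _ _) hc.continuousAt

theorem contDiff_phaseFun (a T L : ℝ) : ContDiff ℝ ∞ (phaseFun a T L) := by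
  rw [contDiff_infty_iff_deriv]
  refine ⟨fun t => (hasDerivAt_phaseFun a T L t).differentiableAt, ?_⟩
  have : deriv (phaseFun a T L) = fun t => Real.exp t * phaseSlope a T L t := by
    funext t
    exact (hasDerivAt_phaseFun a T L t).deriv
  rw [this]
  exact Real.contDiff_exp.mul (contDiff_phaseSlope a T L)

theorem phaseSlope_bounds {a : ℝ} (ha : 0 ≤ a) (T L t : ℝ) :
    0 ≤ phaseSlope a T L t ∧ phaseSlope a T L t ≤ a :=
  ⟨mul_nonneg ha (Real.smoothTransition.nonneg _),
    mul_le_of_le_one_right ha (Real.smoothTransition.le_one _)⟩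

theorem phaseSlope_eq_zero (a : ℝ) {T L : ℝ} (hL : 0 < L) {t : ℝ} (ht : T ≤ t) :
    phaseSlope a T L t = 0 := by
  rw [phaseSlope, Real.smoothTransition.zero_of_nonpos, mul_zero]
  exact div_nonpos_of_nonpos_of_nonneg (by linarith) hL.le

theorem phaseFun_eq_zero (a : ℝ) {T L : ℝ} (hL : 0 < L) {t : ℝ} (ht : T ≤ t) :
    phaseFun a T L t = 0 := by
  rw [phaseFun, intervalIntegral.integral_congr (g := fun _ => (0 : ℝ))]
  · simp
  · intro s hs
    rw [Set.uIcc_of_le ht] at hs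
    simp [phaseSlope_eq_zero a hL hs.1]

theorem phaseFun_bounds {a : ℝ} (ha : 0 ≤ a) {T L : ℝ} (hL : 0 < L) (t : ℝ) :
    -(a * Real.exp T) ≤ phaseFun a T L t ∧ phaseFun a T L t ≤ 0 := by
  rcases le_total T t with ht | ht
  · rw [phaseFun_eq_zero a hL ht]
    exact ⟨by have := Real.exp_pos T; nlinarith, le_rfl⟩
  · have hc : Continuous (fun s => Real.exp s * phaseSlope a T L s) :=
      Real.continuous_exp.mul (contDiff_phaseSlope a T L).continuous
    rw [phaseFun, intervalIntegral.integral_symm]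
    have h1 : 0 ≤ ∫ s in t..T, Real.exp s * phaseSlope a T L s :=
      intervalIntegral.integral_nonneg ht fun s _ =>
        mul_nonneg (Real.exp_pos s).le (phaseSlope_bounds ha T L s).1
    have h2 : ∫ s in t..T, Real.exp s * phaseSlope a T L s ≤ ∫ s in t..T, Real.exp s * a := by
      refine intervalIntegral.integral_mono_on ht (hc.intervalIntegrable _ _)
        ((Real.continuous_exp.mul continuous_const).intervalIntegrable _ _) fun s _ => ?_
      exact mul_le_mul_of_nonneg_left (phaseSlope_bounds ha T L s).2 (Real.exp_pos s).le
    rw [intervalIntegral.integral_mul_const, integral_exp] at h2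
    have := Real.exp_pos t
    constructor <;> nlinarith

/-! ### The weight w: quadratic at the origin, bounded, with slowly decaying logarithmic derivative.
-/

/-- The bounded increasing weight. -/
def growth (δ T t : ℝ) : ℝ :=
  (1 - (1 + Real.exp (2 * (t - T)))⁻¹) * (2 - (1 + Real.exp (2 * (t - T))) ^ (-(δ / 2)))

/-- The logarithmic derivative of `growth`. -/
def growthRate (δ T t : ℝ) : ℝ :=
  2 * (1 + Real.exp (2 * (t - T)))⁻¹
    + δ * (1 - (1 + Real.exp (2 * (t - T)))⁻¹) * (1 + Real.exp (2 * (t - T))) ^ (-(δ / 2))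
      / (2 - (1 + Real.exp (2 * (t - T))) ^ (-(δ / 2)))

theorem growth_aux {δ : ℝ} (hδ : 0 < δ) (hδ1 : δ ≤ 1) {σ : ℝ} (hσ : 1 < σ) :
    0 < σ⁻¹ ∧ σ⁻¹ < 1 ∧ σ⁻¹ ≤ σ ^ (-(δ / 2)) ∧ σ ^ (-(δ / 2)) ≤ 1 := by
  refine ⟨by positivity, inv_lt_one_of_one_lt₀ hσ, ?_, ?_⟩
  · rw [← Real.rpow_neg_one]
    exact Real.rpow_le_rpow_of_exponent_le hσ.le (by linarith)
  · exact Real.rpow_le_one_of_one_le_of_nonpos hσ.le (by linarith)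

theorem one_lt_sigma (T t : ℝ) : 1 < 1 + Real.exp (2 * (t - T)) := by
  linarith [Real.exp_pos (2 * (t - T))]

theorem contDiff_growth (δ T : ℝ) : ContDiff ℝ ∞ (growth δ T) := by
  have h : ContDiff ℝ ∞ (fun t => 1 + Real.exp (2 * (t - T))) := by fun_prop
  have h0 : ∀ t, 1 + Real.exp (2 * (t - T)) ≠ 0 := fun t => by linarith [one_lt_sigma T t]
  unfold growth
  exact (contDiff_const.sub (h.inv h0)).mul (contDiff_const.sub (h.rpow_const_of_ne h0))

theorem deriv_growth {δ : ℝ} (hδ : 0 < δ) (hδ1 : δ ≤ 1) (T t : ℝ) :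
    deriv (growth δ T) t = growthRate δ T t * growth δ T t := by
  set σ := 1 + Real.exp (2 * (t - T)) with hσ
  have h1 : 1 < σ := one_lt_sigma T t
  obtain ⟨a1, a2, a3, a4⟩ := growth_aux hδ hδ1 h1
  have hd : HasDerivAt (fun t => 1 + Real.exp (2 * (t - T))) (2 * (σ - 1)) t := by
    have h : HasDerivAt (fun t : ℝ => 2 * (t - T)) 2 t := by
      simpa using ((hasDerivAt_id t).sub_const T).const_mul 2
    have := h.exp.const_add 1
    have h2 : 2 * (σ - 1) = Real.exp (2 * (t - T)) * 2 := by
      rw [hσ]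
      ring
    rwa [h2]
  have hd1 := (hd.inv (by linarith : σ ≠ 0)).const_sub 1
  have hd2 := (hd.rpow_const (p := -(δ / 2)) (Or.inl (by linarith : σ ≠ 0))).const_sub 2
  have hd3 := hd1.mul hd2
  have he : growth δ T = (fun x => (1 - (fun t => 1 + Real.exp (2 * (t - T)))⁻¹ x))
      * fun x => 2 - (1 + Real.exp (2 * (x - T))) ^ (-(δ / 2)) := by
    funext x
    simp [growth]
  rw [he, hd3.deriv, ← he, growthRate, growth]
  simp only [Pi.inv_apply, ← hσ]
  rw [show -(δ / 2) - 1 = -(δ / 2) + (-1 : ℝ) by ring, Real.rpow_add (by linarith),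
    Real.rpow_neg_one]
  generalize σ ^ (-(δ / 2)) = p at *
  have : 2 - p ≠ 0 := by linarith
  field_simp

/-- The two summands of the rate are the logarithmic derivatives of the two factors of `growth`. The
first tends to 2 at the origin, and the last bound records that it does so with an error of order
|x|². The second decays only like σ^{-δ/2}, with σ = 1 + e^{2(t-T)}, and gives the lower bound at
infinity. -/
theorem growthRate_bounds {δ : ℝ} (hδ : 0 < δ) (hδ1 : δ ≤ 1) (T t : ℝ) :
    δ / 2 * (1 + Real.exp (2 * (t - T))) ^ (-(δ / 2)) ≤ growthRate δ T t ∧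
    growthRate δ T t ≤ 2 ∧ 2 - growthRate δ T t ≤ 2 * (1 - (1 + Real.exp (2 * (t - T)))⁻¹) := by
  have h1 := one_lt_sigma T t
  obtain ⟨a1, a2, a3, a4⟩ := growth_aux hδ hδ1 h1
  rw [growthRate]
  set q := (1 + Real.exp (2 * (t - T)))⁻¹
  set p := (1 + Real.exp (2 * (t - T))) ^ (-(δ / 2))
  have hp : 0 < p := by linarith
  have h2 : p / 2 ≤ p / (2 - p) := div_le_div_of_nonneg_left hp.le (by linarith) (by linarith)
  have h3 : p / (2 - p) ≤ 1 := by rw [div_le_one (by linarith)]; linarith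
  have h4 : 0 ≤ δ * (1 - q) := mul_nonneg hδ.le (by linarith)
  have h5 := mul_le_mul_of_nonneg_left h2 h4
  have h6 := mul_le_mul_of_nonneg_left h3 h4
  have h7 : δ * (1 - q) * p / (2 - p) = δ * (1 - q) * (p / (2 - p)) := by ring
  rw [h7]
  have h8 : δ * q * p ≤ q := by
    have : δ * p ≤ 1 := by nlinarith
    nlinarith
  have h9 : δ * (1 - q) ≤ 1 - q := by nlinarith
  refine ⟨by nlinarith, by nlinarith, by nlinarith⟩

theorem growth_bounds {δ : ℝ} (hδ : 0 < δ) (hδ1 : δ ≤ 1) (T t : ℝ) :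
    Real.exp (2 * (t - T)) / (1 + Real.exp (2 * (t - T))) ≤ growth δ T t ∧ growth δ T t ≤ 2 ∧
      growth δ T t ≤ 2 * Real.exp (2 * (t - T)) := by
  have h1 := one_lt_sigma T t
  obtain ⟨a1, a2, a3, a4⟩ := growth_aux hδ hδ1 h1
  have he := Real.exp_pos (2 * (t - T))
  have h2 : Real.exp (2 * (t - T)) / (1 + Real.exp (2 * (t - T)))
      = 1 - (1 + Real.exp (2 * (t - T)))⁻¹ := by
    field_simp
    ring
  have h3 : Real.exp (2 * (t - T)) / (1 + Real.exp (2 * (t - T))) ≤ Real.exp (2 * (t - T)) :=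
    div_le_self he.le h1.le
  rw [growth, h2] at *
  refine ⟨by nlinarith, by nlinarith, by nlinarith⟩

/-! ### Coercivity of the zeroth-order coefficient. -/

theorem exists_exp_decay_le {c δ₀ η : ℝ} (hδ₀ : 0 < δ₀) (hη : 0 < η) :
    ∃ T₀ : ℝ, 0 ≤ T₀ ∧ c * Real.exp (-δ₀ * T₀) ≤ η := by
  have h : Filter.Tendsto (fun t : ℝ => c * Real.exp (-δ₀ * t)) Filter.atTop (nhds (c * 0)) := by
    refine Filter.Tendsto.const_mul c (Real.tendsto_exp_atBot.comp ?_)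
    exact Filter.Tendsto.const_mul_atTop_of_neg (by linarith) Filter.tendsto_id
  rw [mul_zero] at h
  obtain ⟨t, ht, ht0⟩ := ((h.eventually (ge_mem_nhds hη)).and
    (Filter.eventually_ge_atTop (0 : ℝ))).exists
  exact ⟨t, ht0, ht⟩

theorem growthRate_ge_of_le {δ : ℝ} (hδ : 0 < δ) (hδ1 : δ ≤ 1) {T t : ℝ} (ht : t ≤ T) :
    δ / 4 ≤ growthRate δ T t := by
  have h1 := (growthRate_bounds hδ hδ1 T t).1
  have h2 : 1 + Real.exp (2 * (t - T)) ≤ 2 := by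
    have : Real.exp (2 * (t - T)) ≤ 1 := Real.exp_le_one_iff.mpr (by linarith)
    linarith
  have h3 : (2 : ℝ) ^ (-(δ / 2)) ≤ (1 + Real.exp (2 * (t - T))) ^ (-(δ / 2)) :=
    Real.rpow_le_rpow_of_nonpos (by linarith [one_lt_sigma T t]) h2 (by linarith)
  have h4 : (2 : ℝ) ^ (-1 : ℝ) ≤ (2 : ℝ) ^ (-(δ / 2)) :=
    Real.rpow_le_rpow_of_exponent_le (by norm_num) (by linarith)
  rw [Real.rpow_neg_one] at h4
  nlinarith

theorem growthRate_ge_of_ge {δ : ℝ} (hδ : 0 < δ) (hδ1 : δ ≤ 1) {T t : ℝ} (ht : T ≤ t) :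
    δ / 4 * Real.exp (-δ * (t - T)) ≤ growthRate δ T t := by
  have h1 := (growthRate_bounds hδ hδ1 T t).1
  have h2 : 1 + Real.exp (2 * (t - T)) ≤ 2 * Real.exp (2 * (t - T)) := by
    have : 1 ≤ Real.exp (2 * (t - T)) := Real.one_le_exp (by linarith)
    linarith
  have h3 : (2 * Real.exp (2 * (t - T))) ^ (-(δ / 2)) ≤ (1 + Real.exp (2 * (t - T))) ^ (-(δ / 2)) :=
    Real.rpow_le_rpow_of_nonpos (by linarith [one_lt_sigma T t]) h2 (by linarith)
  have h4 : (2 : ℝ) ^ (-1 : ℝ) ≤ (2 : ℝ) ^ (-(δ / 2)) :=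
    Real.rpow_le_rpow_of_exponent_le (by norm_num) (by linarith)
  rw [Real.rpow_neg_one] at h4
  rw [Real.mul_rpow (by norm_num) (Real.exp_pos _).le, ← Real.exp_mul,
    show 2 * (t - T) * -(δ / 2) = -δ * (t - T) by ring] at h3
  have h5 := mul_le_mul_of_nonneg_right h4 (Real.exp_pos (-δ * (t - T))).le
  have h6 := mul_le_mul_of_nonneg_left (h5.trans h3) (by linarith : 0 ≤ δ / 2)
  linarith

/-- The potential -h²/(4|x|²) enters the energy identity multiplied by 2 - rate. This factor is
O(e^{2(t-T)}) at the origin, which cancels e^{-2t} up to the constant e^{-2T} ≤ 1. What remains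
decays at least as fast as the rate itself. -/
theorem centrifugal_le {δ : ℝ} (hδ : 0 < δ) (hδ1 : δ ≤ 1) {T : ℝ} (hT : 0 ≤ T) (h t : ℝ) :
    (2 - growthRate δ T t) * (h ^ 2 * Real.exp (-2 * t)) / 4 ≤ h ^ 2 / δ * growthRate δ T t := by
  obtain ⟨b1, b2, b3⟩ := growthRate_bounds hδ hδ1 T t
  obtain ⟨a1, a2, a3, a4⟩ := growth_aux hδ hδ1 (one_lt_sigma T t)
  have h1 : (1 - (1 + Real.exp (2 * (t - T)))⁻¹) * Real.exp (-2 * t)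
      = Real.exp (-2 * T) * (1 + Real.exp (2 * (t - T)))⁻¹ := by
    have h2 : Real.exp (2 * (t - T)) * Real.exp (-2 * t) = Real.exp (-2 * T) := by
      rw [← Real.exp_add]
      ring_nf
    have h3 := one_lt_sigma T t
    rw [← h2]
    field_simp
    ring
  have h2 : Real.exp (-2 * T) ≤ 1 := Real.exp_le_one_iff.mpr (by linarith)
  have h3 : (2 - growthRate δ T t) * Real.exp (-2 * t)
      ≤ 2 * (1 + Real.exp (2 * (t - T))) ^ (-(δ / 2)) := by
    have := mul_le_mul_of_nonneg_right b3 (Real.exp_pos (-2 * t)).le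
    nlinarith
  have h4 : (1 + Real.exp (2 * (t - T))) ^ (-(δ / 2)) ≤ 2 / δ * growthRate δ T t := by
    rw [div_mul_eq_mul_div, le_div_iff₀ hδ]
    linarith
  have h5 : (2 - growthRate δ T t) * (h ^ 2 * Real.exp (-2 * t)) / 4
      = h ^ 2 / 4 * ((2 - growthRate δ T t) * Real.exp (-2 * t)) := by ring
  have h6 : h ^ 2 / δ * growthRate δ T t = h ^ 2 / 4 * (2 * (2 / δ * growthRate δ T t)) := by ring
  rw [h5, h6]
  exact mul_le_mul_of_nonneg_left (by linarith) (by positivity)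

/-- There are three zones. For t < T₀ the constant slope `a` outweighs V and its radial derivative.
For T₀ ≤ t ≤ T both are small and the slope descends so slowly that its derivative is an error. For
t > T the phase is flat and E alone wins, since the rate decays no faster than e^{-δ₀ t}. -/
theorem exists_carlemanWeight {E c δ₀ δ : ℝ} (hE : 0 < E) (hc : 0 < c) (hδ₀ : 0 < δ₀)
    (hδ : 0 < δ) (hδ1 : δ ≤ 1) (hδδ : δ ≤ δ₀) : Nonempty (CarlemanWeight E c δ₀ δ) := by
  obtain ⟨B, hB, hBd⟩ := exists_smoothTransition_deriv_bound
  obtain ⟨T₀, hT₀, hT₀c⟩ := exists_exp_decay_le (c := c) hδ₀ (η := E * δ / 64) (by positivity)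
  -- In a² the summand c absorbs `rate * v`. The summand 4c/δ, multiplied by a rate of at least δ/4,
  -- absorbs `p`.
  set a : ℝ := Real.sqrt (c + 4 * c / δ) with ha
  have ha0 : 0 ≤ a := Real.sqrt_nonneg _
  have ha2 : a ^ 2 = c + 4 * c / δ := Real.sq_sqrt (by positivity)
  -- The descent of the slope is spread over length L, so that 2·slope·slope' is bounded below by
  -- -Eδ/64.
  set L : ℝ := max 1 (128 * a ^ 2 * B / (E * δ)) with hLdef
  have hL1 : 1 ≤ L := le_max_left _ _
  have hL : 0 < L := by linarith
  have hL2 : 128 * a ^ 2 * B ≤ E * δ * L := by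
    have h := le_max_right 1 (128 * a ^ 2 * B / (E * δ))
    rw [div_le_iff₀ (by positivity)] at h
    linarith
  set T : ℝ := T₀ + L with hT
  have hT0 : 0 ≤ T := by linarith
  -- The second entry makes h²/δ ≤ E/16 for the centrifugal term (using h ≤ 1). The third controls
  -- the term of order h containing derivatives of the slope.
  set h₀ : ℝ := min 1 (min (E * δ / 16) (E * δ / (64 * (2 * a * B + 1)))) with hh₀
  refine ⟨⟨T, a, h₀, growth δ T, growthRate δ T, phaseSlope a T L, phaseFun a T L, hT0, ha0,
    by positivity, contDiff_growth δ T, contDiff_phaseSlope a T L, contDiff_phaseFun a T L,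
    deriv_growth hδ hδ1 T, fun t => (hasDerivAt_phaseFun a T L t).deriv, fun t => ?_,
    fun t => (growth_bounds hδ hδ1 T t).2.1, fun t => ?_, fun t => (growth_bounds hδ hδ1 T t).1,
    fun t => (growthRate_bounds hδ hδ1 T t).1, fun t => (growthRate_bounds hδ hδ1 T t).2.1,
    fun t => (phaseSlope_bounds ha0 T L t).1, fun t => (phaseFun_bounds ha0 hL t).2,
    fun t => (phaseFun_bounds ha0 hL t).1, fun t => phaseFun_eq_zero a hL, ?_⟩⟩
  · exact lt_of_lt_of_le (by positivity) (growth_bounds hδ hδ1 T t).1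
  · refine (growth_bounds hδ hδ1 T t).2.2.trans ?_
    have := Real.exp_le_exp.mpr (by linarith : 2 * (t - T) ≤ 2 * t)
    linarith
  · intro h hh0 hhle t v p hv hp
    have hh1 : h ≤ 1 := hhle.trans (min_le_left _ _)
    have hh2 : h ≤ E * δ / 16 := hhle.trans ((min_le_right _ _).trans (min_le_left _ _))
    have hh3 : h ≤ E * δ / (64 * (2 * a * B + 1)) :=
      hhle.trans ((min_le_right _ _).trans (min_le_right _ _))
    have haB : 0 ≤ a * B := mul_nonneg ha0 hB
    have hh4 : h * (2 * a * B) ≤ E * δ / 64 := by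
      rw [le_div_iff₀ (by positivity)] at hh3
      nlinarith
    have hcen := centrifugal_le hδ hδ1 hT0 h t
    set lam := growthRate δ T t with hlam
    have hlam_pos : 0 < lam := lt_of_lt_of_le
      (mul_pos (by linarith) (Real.rpow_pos_of_pos (by linarith [one_lt_sigma T t]) _))
      (growthRate_bounds hδ hδ1 T t).1
    have hlam2 : lam ≤ 2 := (growthRate_bounds hδ hδ1 T t).2.1
    have hcen2 : (2 - lam) * (h ^ 2 * Real.exp (-2 * t)) / 4 ≤ lam * (E / 16) := by
      refine hcen.trans ?_
      have : h ^ 2 / δ ≤ E / 16 := by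
        rw [div_le_iff₀ hδ]
        nlinarith
      nlinarith
    rcases lt_or_ge t T₀ with ht | ht
    -- The slope is exactly constant here, so the factor e^{-t}, unbounded as t → -∞, multiplies
    -- zero.
    · have hx : 1 < (T - t) / L := by
        rw [lt_div_iff₀ hL]
        linarith
      obtain ⟨e1, e2⟩ := smoothTransition_deriv_eq_zero (Or.inr hx)
      rw [deriv_phaseSlope, deriv_deriv_phaseSlope, e1, e2, phaseSlope,
        Real.smoothTransition.one_of_one_le hx.le]
      have hr := rpow_one_add_exp_le_one hδ₀.le t
      have hc1 := mul_le_of_le_one_right hc.le hr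
      have hv1 : v ≤ c := hv.trans hc1
      have hp1 : p ≤ c := hp.trans hc1
      have hl := growthRate_ge_of_le hδ hδ1 (by linarith : t ≤ T)
      have h1 : c ≤ lam * (4 * c / δ) := by
        have h3 : δ / 4 * (4 * c / δ) = c := by field_simp
        have h4 := mul_le_mul_of_nonneg_right hl (by positivity : 0 ≤ 4 * c / δ)
        linarith
      have h2 : lam * v ≤ lam * c := mul_le_mul_of_nonneg_left hv1 hlam_pos.le
      simp only [mul_one, mul_zero, add_zero, sub_zero]
      have h5 : lam * a ^ 2 = lam * c + lam * (4 * c / δ) := by rw [ha2]; ring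
      have h6 := mul_pos hlam_pos hE
      linarith
    · have hv0 : c * (1 + Real.exp t) ^ (-δ₀) ≤ E * δ / 64 := by
        refine le_trans ?_ hT₀c
        refine mul_le_mul_of_nonneg_left ((rpow_one_add_exp_le_exp hδ₀.le t).trans ?_) hc.le
        have := mul_le_mul_of_nonneg_left ht hδ₀.le
        exact Real.exp_le_exp.mpr (by linarith)
      have hEδ : E * δ ≤ E := mul_le_of_le_one_right hE.le hδ1
      have hv1 : lam * v ≤ lam * (E / 64) :=
        mul_le_mul_of_nonneg_left (by linarith) hlam_pos.le
      rcases le_or_gt t T with ht2 | ht2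
      · have hl := growthRate_ge_of_le hδ hδ1 ht2
        have hEl : E * δ / 64 ≤ lam * (E / 16) := by
          have := mul_le_mul_of_nonneg_right hl (by linarith : 0 ≤ E / 16)
          linarith
        obtain ⟨d1, d2⟩ := hBd ((T - t) / L)
        have hs1 : |deriv (phaseSlope a T L) t| ≤ a * B / L := by
          rw [deriv_phaseSlope, abs_mul, abs_neg, abs_of_nonneg (by positivity : 0 ≤ a / L)]
          calc a / L * _ ≤ a / L * B := mul_le_mul_of_nonneg_left d1 (by positivity)
            _ = a * B / L := by ring
        have hs1' : |deriv (phaseSlope a T L) t| ≤ a * B :=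
          hs1.trans (div_le_self haB hL1)
        have hs2 : |deriv (deriv (phaseSlope a T L)) t| ≤ a * B := by
          rw [deriv_deriv_phaseSlope, abs_mul, abs_of_nonneg (by positivity : 0 ≤ a / L ^ 2)]
          exact mul_le_mul (div_le_self ha0 (one_le_pow₀ hL1)) d2 (abs_nonneg _) ha0
        obtain ⟨g1, g2⟩ := phaseSlope_bounds ha0 T L t
        have k1 : -(E * δ / 64) ≤ 2 * phaseSlope a T L t * deriv (phaseSlope a T L) t := by
          have h1 : a * (a * B / L) ≤ E * δ / 128 := by
            rw [← mul_div_assoc, div_le_iff₀ hL]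
            linarith
          have h2 : |phaseSlope a T L t * deriv (phaseSlope a T L) t| ≤ a * (a * B / L) := by
            rw [abs_mul, abs_of_nonneg g1]
            exact mul_le_mul g2 hs1 (abs_nonneg _) ha0
          have := (abs_le.mp h2).1
          linarith
        have k2 : -(E * δ / 64) ≤ h * Real.exp (-t)
            * ((1 - lam) * deriv (phaseSlope a T L) t - deriv (deriv (phaseSlope a T L)) t) := by
          have h1 : |(1 - lam) * deriv (phaseSlope a T L) t
              - deriv (deriv (phaseSlope a T L)) t| ≤ 2 * a * B := by
            refine (abs_sub _ _).trans ?_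
            rw [abs_mul]
            have : |1 - lam| ≤ 1 := abs_le.mpr ⟨by linarith, by linarith⟩
            have := mul_le_mul this hs1' (abs_nonneg _) zero_le_one
            linarith
          -- The slope varies only where t ≥ T₀ ≥ 0, so e^{-t} does no harm.
          have h2 : Real.exp (-t) ≤ 1 := Real.exp_le_one_iff.mpr (by linarith)
          have h3 : |h * Real.exp (-t) * ((1 - lam) * deriv (phaseSlope a T L) t
              - deriv (deriv (phaseSlope a T L)) t)| ≤ h * (2 * a * B) := by
            rw [abs_mul, abs_of_nonneg (mul_nonneg hh0.le (Real.exp_pos _).le)]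
            exact mul_le_mul (mul_le_of_le_one_right hh0.le h2) h1 (abs_nonneg _) hh0.le
          have := (abs_le.mp h3).1
          linarith
        have k3 : 0 ≤ lam * phaseSlope a T L t ^ 2 := by positivity
        have k4 := mul_pos hlam_pos hE
        linarith
      · have hx : (T - t) / L < 0 := div_neg_of_neg_of_pos (by linarith) hL
        obtain ⟨e1, e2⟩ := smoothTransition_deriv_eq_zero (Or.inl hx)
        rw [deriv_phaseSlope, deriv_deriv_phaseSlope, e1, e2, phaseSlope_eq_zero a hL ht2.le]
        have hl := growthRate_ge_of_ge hδ hδ1 ht2.le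
        -- Beyond T the quantity to beat decays like e^{-δ₀ t} and the rate is at least (δ/4)
        -- e^{-δ(t-T)}; this comparison uses δ ≤ δ₀.
        have hp1 : p ≤ lam * (E / 16) := by
          have h1 : c * (1 + Real.exp t) ^ (-δ₀)
              ≤ c * Real.exp (-δ₀ * T₀) * Real.exp (-δ * (t - T)) := by
            rw [mul_assoc, ← Real.exp_add]
            refine mul_le_mul_of_nonneg_left ((rpow_one_add_exp_le_exp hδ₀.le t).trans ?_) hc.le
            refine Real.exp_le_exp.mpr ?_
            have h3 := mul_le_mul_of_nonneg_right hδδ (by linarith : 0 ≤ t - T)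
            have h4 := mul_le_mul_of_nonneg_left (by linarith : T₀ ≤ T) hδ₀.le
            linarith
          have h2 := mul_le_mul_of_nonneg_right hT₀c (Real.exp_pos (-δ * (t - T))).le
          have h3 := mul_le_mul_of_nonneg_left hl (by linarith : 0 ≤ E / 16)
          linarith
        have k4 := mul_pos hlam_pos hE
        linarith

/-! ### The Carleman estimate in the punctured plane -/

/-- The squared length of the gradient. -/
def gradSq (u : Plane → ℝ) (x : Plane) : ℝ := pd 0 u x ^ 2 + pd 1 u x ^ 2

/-- The differential expression `-h² Δ u + (V - E) u`. -/
def schr (V : Plane → ℝ) (E h : ℝ) (u : Plane → ℝ) (x : Plane) : ℝ :=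
  -h ^ 2 * lap u x + (V x - E) * u x

theorem eulerD_sq_le (u : Plane → ℝ) (x : Plane) : eulerD u x ^ 2 ≤ ‖x‖ ^ 2 * gradSq u x := by
  rw [eulerD, gradSq, plane_norm_sq]
  nlinarith [sq_nonneg (x 0 * pd 1 u x - x 1 * pd 0 u x)]

namespace CarlemanWeight

variable {E c δ₀ δ : ℝ} (W : CarlemanWeight E c δ₀ δ)

/-- The multiplier associated with the weight. -/
def mult (t : ℝ) : ℝ := W.w t * Real.exp (-2 * t)

/-- The logarithmic derivative of the conjugating factor. -/
def symb (h t : ℝ) : ℝ := Real.exp t * W.slope t + h / 2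

/-- The conjugating factor. -/
def conj (h t : ℝ) : ℝ := Real.exp (W.phase t / h + t / 2)

theorem contDiff_mult : ContDiff ℝ ∞ W.mult := W.w_smooth.mul contDiff_exp_neg_two

theorem contDiff_symb (h : ℝ) : ContDiff ℝ ∞ (W.symb h) :=
  (Real.contDiff_exp.mul W.slope_smooth).add contDiff_const

theorem contDiff_conj (h : ℝ) : ContDiff ℝ ∞ (W.conj h) := by
  have := W.phase_smooth
  unfold conj
  fun_prop

theorem deriv_conj {h : ℝ} (hh : h ≠ 0) (t : ℝ) :
    deriv (W.conj h) t = W.symb h t / h * W.conj h t := by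
  have h1 : HasDerivAt W.phase (Real.exp t * W.slope t) t := by
    rw [← W.deriv_phase t]
    exact (W.phase_smooth.differentiable (by simp) t).hasDerivAt
  have h2 : HasDerivAt (W.conj h) _ t :=
    ((h1.div_const h).fun_add ((hasDerivAt_id' t).div_const 2)).exp
  rw [h2.deriv]
  simp only [symb, conj]
  field_simp

theorem deriv_mult (t : ℝ) : deriv W.mult t = W.mult t * (W.rate t - 2) := by
  have h1 : HasDerivAt W.w (W.rate t * W.w t) t := by
    rw [← W.deriv_w t]
    exact (W.w_smooth.differentiable (by simp) t).hasDerivAt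
  have h2 : HasDerivAt (fun t : ℝ => Real.exp (-2 * t)) (-2 * Real.exp (-2 * t)) t := by
    rw [← deriv_exp_neg_two]
    exact (contDiff_exp_neg_two.differentiable (by simp) t).hasDerivAt
  have h3 : W.mult = W.w * fun t => Real.exp (-2 * t) := rfl
  rw [h3, (h1.mul h2).deriv]
  simp
  ring

theorem mult_mul_exp (t : ℝ) : W.mult t * Real.exp (2 * t) = W.w t := by
  rw [mult, mul_assoc, ← Real.exp_add]
  simp

theorem hasDerivAt_slope (t : ℝ) : HasDerivAt W.slope (deriv W.slope t) t :=
  (W.slope_smooth.differentiable (by simp) t).hasDerivAt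

theorem hasDerivAt_symb (h t : ℝ) :
    HasDerivAt (W.symb h) (Real.exp t * (W.slope t + deriv W.slope t)) t := by
  have := ((Real.hasDerivAt_exp t).mul (W.hasDerivAt_slope t)).add_const (h / 2)
  have h2 : Real.exp t * (W.slope t + deriv W.slope t)
      = Real.exp t * W.slope t + Real.exp t * deriv W.slope t := by ring
  rw [h2]
  exact this

/-- Expands the zeroth-order coefficient of the energy identity and factors out w. The bracket is
the expression that the field `coercive` bounds from below; its term in h²/4 comes from the square
of the summand h/2 of `symb`. -/
theorem potential_coeff (h t v p : ℝ) :
    -deriv (fun t => W.mult t * (h * deriv (W.symb h) t - W.symb h t ^ 2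
        - E * Real.exp (2 * t))) t
      - v * deriv (fun t => W.mult t * Real.exp (2 * t)) t
      - p * (W.mult t * Real.exp (2 * t))
    = W.w t * (W.rate t * (E - v + W.slope t ^ 2) + 2 * W.slope t * deriv W.slope t
      - (2 - W.rate t) * (h ^ 2 * Real.exp (-2 * t)) / 4
      + h * Real.exp (-t) * ((1 - W.rate t) * deriv W.slope t - deriv (deriv W.slope) t) - p) := by
  have hs1 := W.hasDerivAt_slope t
  have hs2 : HasDerivAt (deriv W.slope) (deriv (deriv W.slope) t) t :=
    ((contDiff_infty_iff_deriv.mp W.slope_smooth).2.differentiable (by simp) t).hasDerivAt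
  have hm : HasDerivAt W.mult (W.mult t * (W.rate t - 2)) t := by
    rw [← W.deriv_mult t]
    exact (W.contDiff_mult.differentiable (by simp) t).hasDerivAt
  have he := Real.hasDerivAt_exp t
  have he2 : HasDerivAt (fun t : ℝ => Real.exp (2 * t)) (Real.exp (2 * t) * 2) t := by
    have : HasDerivAt (fun t : ℝ => 2 * t) 2 t := by simpa using (hasDerivAt_id t).const_mul 2
    exact this.exp
  have hz1 : deriv (W.symb h) = fun t => Real.exp t * (W.slope t + deriv W.slope t) := by
    funext t
    exact (W.hasDerivAt_symb h t).deriv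
  have hz2 := he.mul (hs1.add hs2)
  have hN := ((hz2.const_mul h).sub ((W.hasDerivAt_symb h t).pow 2)).sub (he2.const_mul E)
  have hF := hm.mul hN
  have e1 : (fun t => W.mult t * (h * deriv (W.symb h) t - W.symb h t ^ 2 - E * Real.exp (2 * t)))
      = W.mult * (((fun y => h * (Real.exp * (W.slope + deriv W.slope)) y) - W.symb h ^ 2)
        - fun y => E * Real.exp (2 * y)) := by
    funext t
    simp [hz1]
  have e2 : (fun t => W.mult t * Real.exp (2 * t)) = W.w := by
    funext t
    exact W.mult_mul_exp t
  rw [e1, hF.deriv, e2, W.deriv_w, W.mult_mul_exp]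
  simp only [Pi.add_apply, Pi.mul_apply, Pi.sub_apply, Pi.pow_apply, symb, mult]
  have x1 : Real.exp (2 * t) = Real.exp t ^ 2 := by rw [two_mul, Real.exp_add, sq]
  have x2 : Real.exp (-2 * t) = Real.exp (-t) ^ 2 := by
    rw [sq, ← Real.exp_add]
    ring_nf
  have x3 : Real.exp (-t) = (Real.exp t)⁻¹ := Real.exp_neg t
  have x4 := Real.exp_pos t
  rw [x1, x2, x3]
  field_simp
  norm_num
  ring

theorem rate_pos (hδ : 0 < δ) (t : ℝ) : 0 < W.rate t := by
  refine lt_of_lt_of_le ?_ (W.rate_ge t)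
  have := one_lt_sigma W.T t
  positivity

theorem conj_sq (h t : ℝ) : W.conj h t ^ 2 = Real.exp (2 * W.phase t / h) * Real.exp t := by
  rw [conj, sq, ← Real.exp_add, ← Real.exp_add]
  ring_nf

/-- Pointwise lower bound behind the Carleman estimate. -/
theorem energyDefect_le (hδ : 0 < δ) {V : Plane → ℝ} {g : Plane → Plane} {h : ℝ} (hh : 0 < h)
    (hh₀ : h ≤ W.h₀) {u f r : Plane → ℝ} (hu : PuncturedTest u) {x : Plane} (hx : x ≠ 0)
    (hV : V x ≤ c * (1 + ‖x‖) ^ (-δ₀)) (hg : ‖g x‖ ≤ c * (1 + ‖x‖) ^ (-1 - δ₀))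
    (hc : 0 < c)
    (hf : schr V E h u x = f x + r x) :
    Real.exp (-2 * ell x)
        * energyDefect V g E h W.mult (W.symb h) (fun x => W.conj h (ell x) * u x) x
      ≤ Real.exp (2 * W.phase (ell x) / h) * (1 / h ^ 2 * (W.w (ell x) * ‖x‖ / W.rate (ell x))
          * f x ^ 2 + 2 * (W.w (ell x) / ‖x‖) * (r x * (eulerD u x
            + W.symb h (ell x) / h * u x))
        - E / 2 * (W.rate (ell x) * W.w (ell x) / ‖x‖) * u x ^ 2) := by
  have hn : 0 < ‖x‖ := norm_pos_iff.mpr hx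
  have h1 := conjOp_radial_mul V E hh.ne' (W.contDiff_conj h) (W.contDiff_symb h)
    (W.deriv_conj hh.ne') hu x
  have h2 := eulerD_radial_mul (W.contDiff_conj h) hu x
  rw [W.deriv_conj hh.ne'] at h2
  have hin : inner ℝ (g x) x ≤ c * (1 + Real.exp (ell x)) ^ (-δ₀) := by
    rw [exp_ell hx]
    have hp : (0 : ℝ) < 1 + ‖x‖ := by linarith
    have e1 : (1 + ‖x‖) ^ (-1 - δ₀) * (1 + ‖x‖) = (1 + ‖x‖) ^ (-δ₀) := by
      rw [show (-1 - δ₀ : ℝ) = -δ₀ - 1 by ring, Real.rpow_sub_one hp.ne']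
      field_simp
    calc inner ℝ (g x) x ≤ ‖g x‖ * ‖x‖ := real_inner_le_norm _ _
      _ ≤ c * (1 + ‖x‖) ^ (-1 - δ₀) * (1 + ‖x‖) := by
        gcongr
        linarith
      _ = c * (1 + ‖x‖) ^ (-δ₀) := by rw [mul_assoc, e1]
  have hV' : V x ≤ c * (1 + Real.exp (ell x)) ^ (-δ₀) := by rwa [exp_ell hx]
  have hco := W.coercive h hh hh₀ (ell x) (V x) (inner ℝ (g x) x) hV' hin
  have hco2 := mul_le_mul_of_nonneg_left hco (W.w_pos (ell x)).le
  rw [← W.potential_coeff h (ell x) (V x) (inner ℝ (g x) x)] at hco2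
  have hf' : -h ^ 2 * lap u x + (V x - E) * u x = f x + r x := hf
  have hr := W.rate_pos hδ (ell x)
  have hr2 := W.rate_le (ell x)
  have hs := W.slope_nonneg (ell x)
  have hw := W.w_pos (ell x)
  have hcs := W.conj_sq h (ell x)
  rw [exp_ell hx] at hcs
  have hm : W.mult (ell x) = W.w (ell x) / ‖x‖ ^ 2 := by
    rw [← W.mult_mul_exp (ell x), exp_two_ell hx]
    field_simp
  have he2 : Real.exp (-2 * ell x) = 1 / ‖x‖ ^ 2 := by
    rw [show -2 * ell x = -(2 * ell x) by ring, Real.exp_neg, exp_two_ell hx, one_div]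
  have hK := mul_le_mul_of_nonneg_right hco2 (sq_nonneg (W.conj h (ell x) * u x))
  rw [energyDefect, h1, h2, hf', W.deriv_mult, he2]
  set K := (-deriv (fun t => W.mult t * (h * deriv (W.symb h) t - W.symb h t ^ 2
      - E * Real.exp (2 * t))) (ell x)
    - V x * deriv (fun t => W.mult t * Real.exp (2 * t)) (ell x)
    - inner ℝ (g x) x * (W.mult (ell x) * Real.exp (2 * ell x)))
  have hz : W.symb h (ell x) = ‖x‖ * W.slope (ell x) + h / 2 := by rw [symb, exp_ell hx]
  set lam := W.conj h (ell x)
  set Q := eulerD u x + W.symb h (ell x) / h * u x with hQ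
  have hy : W.symb h (ell x) / h * lam * u x + lam * eulerD u x = lam * Q := by rw [hQ]; ring
  rw [hy]
  set κ := Real.exp (2 * W.phase (ell x) / h)
  set w := W.w (ell x)
  set L := W.rate (ell x)
  set s := W.slope (ell x)
  set n := ‖x‖
  set rt := rotD (fun x => W.conj h (ell x) * u x) x
  have hκ : 0 < κ := Real.exp_pos _
  -- The summand h/2 of `symb`, due to the factor |x|^{1/2}, contributes 2h² times the multiplier.
  -- It cancels the -2 from differentiating e^{-2t} and leaves the positive coefficient h²·rate.
  have hzM : h ^ 2 * (W.mult (ell x) * (L - 2)) + 4 * h * W.symb h (ell x) * W.mult (ell x)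
      = W.mult (ell x) * (h ^ 2 * L) + 4 * h * n * s * W.mult (ell x) := by
    rw [hz]
    ring
  rw [hzM, hm]
  have t1 : 0 ≤ 4 * h * n * s * (w / n ^ 2) * (lam * Q) ^ 2 := by positivity
  have t2 : 0 ≤ -(h ^ 2 * (w / n ^ 2 * (L - 2)) * rt ^ 2) := by
    have : 0 ≤ h ^ 2 * (w / n ^ 2 * (2 - L)) * rt ^ 2 :=
      mul_nonneg (mul_nonneg (sq_nonneg h) (mul_nonneg (by positivity) (by linarith)))
        (sq_nonneg _)
    linarith
  -- Completing the square spends the radial term h²·rate·(λQ)² on the source `f`; this produces the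
  -- 1/(h²·rate) of the right side. The slope term `t1` and the angular term `t2` are discarded by
  -- sign.
  have t3 : 2 * (w / n ^ 2) * (lam * (n ^ 2 * f x)) * (lam * Q)
      - w / n ^ 2 * (h ^ 2 * L) * (lam * Q) ^ 2 ≤ w / n ^ 2 * (lam ^ 2 * n ^ 4 * f x ^ 2
        / (h ^ 2 * L)) := by
    have hpos : 0 < h ^ 2 * L := by positivity
    have : 0 ≤ w / n ^ 2 * ((h ^ 2 * L * (lam * Q) - lam * (n ^ 2 * f x)) ^ 2 / (h ^ 2 * L)) := by
      positivity
    have e : w / n ^ 2 * ((h ^ 2 * L * (lam * Q) - lam * (n ^ 2 * f x)) ^ 2 / (h ^ 2 * L))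
        = w / n ^ 2 * (lam ^ 2 * n ^ 4 * f x ^ 2 / (h ^ 2 * L))
        - (2 * (w / n ^ 2) * (lam * (n ^ 2 * f x)) * (lam * Q)
          - w / n ^ 2 * (h ^ 2 * L) * (lam * Q) ^ 2) := by
      field_simp
      ring
    linarith
  have t4 : 2 * (w / n ^ 2) * (lam * (n ^ 2 * (f x + r x))) * (lam * Q)
      - ((w / n ^ 2 * (h ^ 2 * L) + 4 * h * n * s * (w / n ^ 2)) * (lam * Q) ^ 2
        - h ^ 2 * (w / n ^ 2 * (L - 2)) * rt ^ 2 + K * (lam * u x) ^ 2)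
      ≤ w / n ^ 2 * (lam ^ 2 * n ^ 4 * f x ^ 2 / (h ^ 2 * L))
        + 2 * w * lam ^ 2 * (r x * Q) - w * (L * (E / 2)) * (lam * u x) ^ 2 := by
    have e : 2 * (w / n ^ 2) * (lam * (n ^ 2 * (f x + r x))) * (lam * Q)
        = 2 * (w / n ^ 2) * (lam * (n ^ 2 * f x)) * (lam * Q) + 2 * w * lam ^ 2 * (r x * Q) := by
      field_simp
    rw [e]
    linarith
  have t5 := mul_le_mul_of_nonneg_left t4 (by positivity : 0 ≤ 1 / n ^ 2)
  refine t5.trans (le_of_eq ?_)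
  rw [mul_pow, hcs]
  field_simp

end CarlemanWeight

theorem PuncturedTest.lap {f : Plane → ℝ} (hf : PuncturedTest f) : PuncturedTest (lap f) :=
  ((hf.pd 0).pd 0).add ((hf.pd 1).pd 1)

theorem integrable_radial_mul_sq {V : Plane → ℝ} (hV : MemLp V ⊤ volume) {R : ℝ → ℝ}
    (hR : ContDiff ℝ ∞ R) {a b : Plane → ℝ} (ha : PuncturedTest a) (hb : PuncturedTest b) :
    Integrable (fun x => R (ell x) * (a x + V x * b x) ^ 2) := by
  have h1 := ((ha.mul ha).radial_mul hR).integrable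
  have h2 := (((ha.mul hb).const_mul 2).radial_mul hR).integrable.mul_memLp_top hV
  have h3 := (((hb.mul hb).radial_mul hR).integrable.mul_memLp_top hV).mul_memLp_top hV
  refine ((h1.add h2).add h3).congr (Filter.Eventually.of_forall fun x => ?_)
  simp only [Pi.add_apply]
  ring

/-- `A` and `B` stand for Euler derivatives, so dividing by n = |x| bounds them by gradients.
Young's inequality then puts one factor h on each derivative, and κ ≤ 1 lets the exponential weight
be dropped. -/
theorem cross_term_le {n h ε w κ a b A B G H : ℝ} (hn : 0 < n) (hh : 0 < h) (hε : 0 ≤ ε)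
    (hw : 0 < w) (hκ0 : 0 < κ) (hκ1 : κ ≤ 1) (hA : A ^ 2 ≤ n ^ 2 * G) (hB : B ^ 2 ≤ n ^ 2 * H) :
    κ * (2 * (w / n) * (ε * (a * B - b * A)))
      ≤ ε / h * (a ^ 2 + b ^ 2 + w ^ 2 * h ^ 2 * (G + H)) := by
  have b1 : (A / n) ^ 2 ≤ G := by
    rw [div_pow, div_le_iff₀ (by positivity)]
    linarith
  have b2 : (B / n) ^ 2 ≤ H := by
    rw [div_pow, div_le_iff₀ (by positivity)]
    linarith
  have e : κ * (2 * (w / n) * (ε * (a * B - b * A)))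
      = ε / h * (κ * (2 * (a * (h * w * (B / n)) - b * (h * w * (A / n))))) := by
    field_simp
  rw [e]
  refine mul_le_mul_of_nonneg_left ?_ (by positivity)
  generalize A / n = p at *
  generalize B / n = q at *
  have m1 : 2 * (a * (h * w * q) - b * (h * w * p))
      ≤ a ^ 2 + b ^ 2 + (h * w) ^ 2 * (p ^ 2 + q ^ 2) := by
    linarith [sq_nonneg (a - h * w * q), sq_nonneg (b + h * w * p)]
  have m2 := mul_le_mul_of_nonneg_left (add_le_add b1 b2) (sq_nonneg (h * w))
  have m3 : 0 ≤ a ^ 2 + b ^ 2 + (h * w) ^ 2 * (p ^ 2 + q ^ 2) := by positivity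
  calc κ * (2 * (a * (h * w * q) - b * (h * w * p)))
      ≤ κ * (a ^ 2 + b ^ 2 + (h * w) ^ 2 * (p ^ 2 + q ^ 2)) :=
        mul_le_mul_of_nonneg_left m1 hκ0.le
    _ ≤ a ^ 2 + b ^ 2 + (h * w) ^ 2 * (p ^ 2 + q ^ 2) := mul_le_of_le_one_left m3 hκ1
    _ ≤ _ := by linarith

namespace CarlemanWeight

variable {E c δ₀ δ : ℝ} (W : CarlemanWeight E c δ₀ δ)

/-- The weight on the left side of the Carleman estimate. -/
def lower (h : ℝ) (x : Plane) : ℝ :=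
  Real.exp (2 * W.phase (ell x) / h) * (W.rate (ell x) * W.w (ell x) / ‖x‖)

/-- The weight on the right side of the Carleman estimate. -/
def upper (h : ℝ) (x : Plane) : ℝ :=
  Real.exp (2 * W.phase (ell x) / h) * (W.w (ell x) * ‖x‖ / W.rate (ell x))

/-- The radial profile of `lower`. -/
def lowerProfile (h t : ℝ) : ℝ := Real.exp (2 * W.phase t / h) * (deriv W.w t * Real.exp (-t))

/-- The radial profile of `upper`. -/
def upperProfile (h t : ℝ) : ℝ :=
  Real.exp (2 * W.phase t / h) * (W.w t ^ 2 * Real.exp t / deriv W.w t)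

theorem deriv_w_pos (hδ : 0 < δ) (t : ℝ) : 0 < deriv W.w t := by
  rw [W.deriv_w]
  exact mul_pos (W.rate_pos hδ t) (W.w_pos t)

theorem contDiff_lowerProfile (h : ℝ) : ContDiff ℝ ∞ (W.lowerProfile h) := by
  have h1 := W.phase_smooth
  have h2 : ContDiff ℝ ∞ (deriv W.w) := (contDiff_infty_iff_deriv.mp W.w_smooth).2
  unfold lowerProfile
  fun_prop

theorem contDiff_upperProfile (hδ : 0 < δ) (h : ℝ) : ContDiff ℝ ∞ (W.upperProfile h) := by
  have h1 := W.phase_smooth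
  have h2 : ContDiff ℝ ∞ (deriv W.w) := (contDiff_infty_iff_deriv.mp W.w_smooth).2
  have h3 := W.w_smooth
  have h4 : ContDiff ℝ ∞ (fun t => W.w t ^ 2 * Real.exp t / deriv W.w t) :=
    ContDiff.div (by fun_prop) h2 fun t => (W.deriv_w_pos hδ t).ne'
  unfold upperProfile
  exact ContDiff.mul (by fun_prop) h4

theorem lower_eq (h : ℝ) {x : Plane} (hx : x ≠ 0) : W.lower h x = W.lowerProfile h (ell x) := by
  rw [lower, lowerProfile, W.deriv_w, Real.exp_neg, exp_ell hx]
  ring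

theorem upper_eq (hδ : 0 < δ) (h : ℝ) {x : Plane} (hx : x ≠ 0) :
    W.upper h x = W.upperProfile h (ell x) := by
  rw [upper, upperProfile, W.deriv_w, exp_ell hx]
  have := W.rate_pos hδ (ell x)
  have := W.w_pos (ell x)
  field_simp

theorem integrable_lower_mul (h : ℝ) {u₁ u₂ : Plane → ℝ} (hu₁ : PuncturedTest u₁)
    (hu₂ : PuncturedTest u₂) :
    Integrable (fun x => W.lower h x * (u₁ x ^ 2 + u₂ x ^ 2)) := by
  refine (((hu₁.mul hu₁).add (hu₂.mul hu₂)).radial_mul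
    (W.contDiff_lowerProfile h)).integrable.congr (Filter.Eventually.of_forall fun x => ?_)
  by_cases hx : x = 0
  · subst hx
    simp [hu₁.at_zero, hu₂.at_zero]
  · simp only
    rw [W.lower_eq h hx]
    ring

/-- The Carleman estimate for functions supported away from the origin. -/
theorem carleman_punctured (hδ : 0 < δ) (hc : 0 < c) {V : Plane → ℝ} {g : Plane → Plane}
    (hV : MemLp V ⊤ volume) (hgm : MemLp g ⊤ volume) (hg : IsWeakGradient V g)
    (hVd : ∀ᵐ x, V x ≤ c * (1 + ‖x‖) ^ (-δ₀))
    (hgd : ∀ᵐ x, ‖g x‖ ≤ c * (1 + ‖x‖) ^ (-1 - δ₀))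
    {h ε : ℝ} (hh : 0 < h) (hh₀ : h ≤ W.h₀) (hε : 0 ≤ ε) {u₁ u₂ : Plane → ℝ}
    (hu₁ : PuncturedTest u₁) (hu₂ : PuncturedTest u₂) :
    E / 2 * ∫ x, W.lower h x * (u₁ x ^ 2 + u₂ x ^ 2)
      ≤ 1 / h ^ 2 * (∫ x, W.upper h x * ((schr V E h u₁ x + ε * u₂ x) ^ 2
          + (schr V E h u₂ x - ε * u₁ x) ^ 2))
        + ε / h * ∫ x, (u₁ x ^ 2 + u₂ x ^ 2
          + W.w (ell x) ^ 2 * h ^ 2 * (gradSq u₁ x + gradSq u₂ x)) := by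
  have hne : ∀ᵐ x : Plane, x ≠ 0 := by
    rw [ae_iff]
    simp
  obtain ⟨i1, e1⟩ := integral_energyDefect hV hgm hg E h W.contDiff_mult (W.contDiff_symb h)
    (hu₁.radial_mul (W.contDiff_conj h))
  obtain ⟨i2, e2⟩ := integral_energyDefect hV hgm hg E h W.contDiff_mult (W.contDiff_symb h)
    (hu₂.radial_mul (W.contDiff_conj h))
  have iL := W.integrable_lower_mul h hu₁ hu₂
  have iU : Integrable (fun x => W.upper h x * ((schr V E h u₁ x + ε * u₂ x) ^ 2
          + (schr V E h u₂ x - ε * u₁ x) ^ 2)) := by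
    have j1 := integrable_radial_mul_sq hV (W.contDiff_upperProfile hδ h)
      (((hu₁.lap.const_mul (-h ^ 2)).add (hu₁.const_mul (-E))).add (hu₂.const_mul ε)) hu₁
    have j2 := integrable_radial_mul_sq hV (W.contDiff_upperProfile hδ h)
      (((hu₂.lap.const_mul (-h ^ 2)).add (hu₂.const_mul (-E))).add (hu₁.const_mul (-ε))) hu₂
    refine (j1.add j2).congr ?_
    filter_upwards [hne] with x hx
    simp only [Pi.add_apply]
    rw [W.upper_eq hδ h hx, schr, schr]
    ring
  have iC : Integrable (fun x => u₁ x ^ 2 + u₂ x ^ 2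
          + W.w (ell x) ^ 2 * h ^ 2 * (gradSq u₁ x + gradSq u₂ x)) := by
    have hw : ContDiff ℝ ∞ (fun t => W.w t ^ 2 * h ^ 2) :=
      (W.w_smooth.pow 2).mul contDiff_const
    have hgr : ∀ {u : Plane → ℝ}, PuncturedTest u → PuncturedTest (gradSq u) := by
      intro u hu
      have := ((hu.pd 0).mul (hu.pd 0)).add ((hu.pd 1).mul (hu.pd 1))
      convert this using 2 with x
      rw [gradSq]
      ring
    refine (((hu₁.mul hu₁).add (hu₂.mul hu₂)).integrable.add
      (((hgr hu₁).add (hgr hu₂)).radial_mul hw).integrable).congr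
        (Filter.Eventually.of_forall fun x => ?_)
    simp only [Pi.add_apply]
    ring
  have key : ∀ᵐ x, Real.exp (-2 * ell x) * energyDefect V g E h W.mult (W.symb h)
          (fun x => W.conj h (ell x) * u₁ x) x
        + Real.exp (-2 * ell x) * energyDefect V g E h W.mult (W.symb h)
          (fun x => W.conj h (ell x) * u₂ x) x
      ≤ 1 / h ^ 2 * (W.upper h x * ((schr V E h u₁ x + ε * u₂ x) ^ 2
          + (schr V E h u₂ x - ε * u₁ x) ^ 2))
        + ε / h * (u₁ x ^ 2 + u₂ x ^ 2
          + W.w (ell x) ^ 2 * h ^ 2 * (gradSq u₁ x + gradSq u₂ x))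
        - E / 2 * (W.lower h x * (u₁ x ^ 2 + u₂ x ^ 2)) := by
    filter_upwards [hne, hVd, hgd] with x hx hVx hgx
    have hn : 0 < ‖x‖ := norm_pos_iff.mpr hx
    -- `f` is a component of (P - iε)(u₁ + i u₂), and `r` gives back the ε-coupling to the other
    -- component.
    have k1 := W.energyDefect_le hδ hh hh₀ (f := fun x => schr V E h u₁ x + ε * u₂ x)
      (r := fun x => -(ε * u₂ x)) hu₁ hx hVx hgx hc (by ring)
    have k2 := W.energyDefect_le hδ hh hh₀ (f := fun x => schr V E h u₂ x - ε * u₁ x)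
      (r := fun x => ε * u₁ x) hu₂ hx hVx hgx hc (by ring)
    refine (add_le_add k1 k2).trans ?_
    have c1 := eulerD_sq_le u₁ x
    have c2 := eulerD_sq_le u₂ x
    rw [lower, upper]
    set κ := Real.exp (2 * W.phase (ell x) / h) with hκ
    have hκ0 : 0 < κ := Real.exp_pos _
    have hκ1 : κ ≤ 1 := by
      rw [hκ, Real.exp_le_one_iff]
      exact div_nonpos_of_nonpos_of_nonneg (by linarith [W.phase_nonpos (ell x)]) hh.le
    have hw := W.w_pos (ell x)
    set w := W.w (ell x)
    -- When the two components are added, the `symb` parts of the coupling cancel. Only u₁ ∂u₂ - u₂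
    -- ∂u₁ survives, so the slope of the phase, which would bring a factor 1/h, does not appear.
    have q : κ * (2 * (w / ‖x‖) * (ε * (u₁ x * eulerD u₂ x - u₂ x * eulerD u₁ x)))
        ≤ ε / h * (u₁ x ^ 2 + u₂ x ^ 2 + w ^ 2 * h ^ 2 * (gradSq u₁ x + gradSq u₂ x)) := by
      exact cross_term_le hn hh hε hw hκ0 hκ1 c1 c2
    refine le_trans (le_of_eq ?_) (sub_le_sub_right (add_le_add_right q _) _)
    ring
  have iR := ((iU.const_mul (1 / h ^ 2)).add (iC.const_mul (ε / h))).sub (iL.const_mul (E / 2))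
  have hfin := integral_mono_ae (i1.add i2) iR key
  rw [integral_add' i1 i2, e1, e2, integral_sub' ((iU.const_mul (1 / h ^ 2)).add
    (iC.const_mul (ε / h))) (iL.const_mul (E / 2)), integral_add' (iU.const_mul (1 / h ^ 2))
    (iC.const_mul (ε / h)), integral_const_mul, integral_const_mul, integral_const_mul] at hfin
  linarith

end CarlemanWeight

/-! ### Cutoff functions -/

theorem lap_mul {f g : Plane → ℝ} (hf : ContDiff ℝ ∞ f) (hg : ContDiff ℝ ∞ g) (x : Plane) :
    lap (fun y => f y * g y) x
      = lap f x * g x + 2 * (pd 0 f x * pd 0 g x + pd 1 f x * pd 1 g x) + f x * lap g x := by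
  have d : ∀ {f : Plane → ℝ}, ContDiff ℝ ∞ f → ∀ x, DifferentiableAt ℝ f x := fun hf x =>
    hf.contDiffAt.differentiableAt (by simp)
  have h : ∀ i, pd i (pd i (fun y => f y * g y)) x
      = pd i (pd i f) x * g x + 2 * (pd i f x * pd i g x) + f x * pd i (pd i g) x := by
    intro i
    have h1 : pd i (fun y => f y * g y) = fun y => pd i f y * g y + f y * pd i g y := by
      funext y
      exact pd_mul i (d hf y) (d hg y)
    have c1 := d (contDiff_pd i hf) x
    have c2 := d (contDiff_pd i hg) x
    rw [h1, pd_add i (c1.fun_mul (d hg x)) ((d hf x).fun_mul c2), pd_mul i c1 (d hg x),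
      pd_mul i (d hf x) c2]
    ring
  rw [lap, h, h, lap, lap]
  ring

theorem lap_sub {f g : Plane → ℝ} (hf : ContDiff ℝ ∞ f) (hg : ContDiff ℝ ∞ g) (x : Plane) :
    lap (fun y => f y - g y) x = lap f x - lap g x := by
  have d : ∀ {f : Plane → ℝ}, ContDiff ℝ ∞ f → ∀ x, DifferentiableAt ℝ f x := fun hf x =>
    hf.contDiffAt.differentiableAt (by simp)
  have h : ∀ i, pd i (pd i (fun y => f y - g y)) x = pd i (pd i f) x - pd i (pd i g) x := by
    intro i
    have h1 : pd i (fun y => f y - g y) = fun y => pd i f y - pd i g y := by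
      funext y
      exact pd_sub i (d hf y) (d hg y)
    rw [h1, pd_sub i (d (contDiff_pd i hf) x) (d (contDiff_pd i hg) x)]
  rw [lap, h, h, lap, lap]
  ring

theorem pd_comp_smul (i : Fin 2) {f : Plane → ℝ} (hf : ContDiff ℝ ∞ f) (k : ℝ) (x : Plane) :
    pd i (fun y => f (k • y)) x = k * pd i f (k • x) := by
  have h1 : HasFDerivAt (fun y : Plane => k • y) (k • ContinuousLinearMap.id ℝ Plane) x :=
    (hasFDerivAt_id x).const_smul k
  have h2 := (hf.contDiffAt.differentiableAt (by simp) :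
    DifferentiableAt ℝ f (k • x)).hasFDerivAt.comp x h1
  have h3 : (fun y => f (k • y)) = f ∘ fun y => k • y := rfl
  rw [pd, h3, h2.fderiv]
  simp [pd]

theorem lap_comp_smul {f : Plane → ℝ} (hf : ContDiff ℝ ∞ f) (k : ℝ) (x : Plane) :
    lap (fun y => f (k • y)) x = k ^ 2 * lap f (k • x) := by
  have d : ∀ {f : Plane → ℝ}, ContDiff ℝ ∞ f → ∀ x, DifferentiableAt ℝ f x := fun hf x =>
    hf.contDiffAt.differentiableAt (by simp)
  have h : ∀ i, pd i (pd i (fun y => f (k • y))) x = k ^ 2 * pd i (pd i f) (k • x) := by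
    intro i
    have h1 : pd i (fun y => f (k • y)) = fun y => k * pd i f (k • y) := by
      funext y
      exact pd_comp_smul i hf k y
    have hc : ContDiff ℝ ∞ (fun y => pd i f (k • y)) :=
      (contDiff_pd i hf).comp (contDiff_const_smul k)
    have h0 : pd i (fun _ : Plane => k) x = 0 := by simp [pd]
    rw [h1, pd_mul i (differentiableAt_const k) (d hc x), h0, pd_comp_smul i (contDiff_pd i hf)]
    ring
  rw [lap, h, h, lap]
  ring

/-- A smooth cutoff, equal to one for `k |x| ≤ 1` and to zero for `2 ≤ k² |x|²`. -/
def cutoff (k : ℝ) (x : Plane) : ℝ := 1 - Real.smoothTransition (k ^ 2 * ‖x‖ ^ 2 - 1)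

theorem contDiff_cutoff (k : ℝ) : ContDiff ℝ ∞ (cutoff k) := by
  have h : ContDiff ℝ ∞ (fun x : Plane => k ^ 2 * ‖x‖ ^ 2 - 1) :=
    (contDiff_const.mul (contDiff_norm_sq ℝ)).sub contDiff_const
  exact contDiff_const.sub (contDiff_smoothTransition.comp h)

theorem cutoff_nonneg (k : ℝ) (x : Plane) : 0 ≤ cutoff k x := by
  rw [cutoff]
  linarith [Real.smoothTransition.le_one (k ^ 2 * ‖x‖ ^ 2 - 1)]

theorem cutoff_le_one (k : ℝ) (x : Plane) : cutoff k x ≤ 1 := by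
  rw [cutoff]
  linarith [Real.smoothTransition.nonneg (k ^ 2 * ‖x‖ ^ 2 - 1)]

theorem cutoff_eq_one {k : ℝ} {x : Plane} (h : k ^ 2 * ‖x‖ ^ 2 ≤ 1) : cutoff k x = 1 := by
  rw [cutoff, Real.smoothTransition.zero_of_nonpos (by linarith), sub_zero]

theorem cutoff_eq_zero {k : ℝ} {x : Plane} (h : 2 ≤ k ^ 2 * ‖x‖ ^ 2) : cutoff k x = 0 := by
  rw [cutoff, Real.smoothTransition.one_of_one_le (by linarith), sub_self]

theorem cutoff_eq_comp (k : ℝ) : cutoff k = fun x => cutoff 1 (k • x) := by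
  funext x
  rw [cutoff, cutoff, norm_smul, mul_pow, Real.norm_eq_abs, sq_abs]
  simp

theorem tsupport_cutoff_subset {k : ℝ} (hk : 0 < k) :
    tsupport (cutoff k) ⊆ Metric.closedBall 0 (2 / k) := by
  refine closure_minimal (fun x hx => ?_) Metric.isClosed_closedBall
  by_contra h
  rw [mem_closedBall_zero_iff, not_le, div_lt_iff₀ hk] at h
  refine hx (cutoff_eq_zero ?_)
  rw [← mul_pow]
  nlinarith

theorem hasCompactSupport_cutoff {k : ℝ} (hk : 0 < k) : HasCompactSupport (cutoff k) :=
  (isCompact_closedBall (0 : Plane) (2 / k)).of_isClosed_subset (isClosed_tsupport _)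
    (tsupport_cutoff_subset hk)

theorem hasCompactSupport_pd (i : Fin 2) {f : Plane → ℝ} (hf : HasCompactSupport f) :
    HasCompactSupport (pd i f) :=
  (hf.fderiv (𝕜 := ℝ)).comp_left (g := fun L : Plane →L[ℝ] ℝ => L (basisVec i)) (by simp)

theorem tsupport_pd_subset (i : Fin 2) (f : Plane → ℝ) : tsupport (pd i f) ⊆ tsupport f := by
  refine (closure_mono ?_).trans (tsupport_fderiv_subset ℝ (f := f))
  intro x hx h
  exact hx (by simp [pd, h])

theorem contDiff_lap {f : Plane → ℝ} (hf : ContDiff ℝ ∞ f) : ContDiff ℝ ∞ (lap f) :=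
  (contDiff_pd 0 (contDiff_pd 0 hf)).add (contDiff_pd 1 (contDiff_pd 1 hf))

theorem hasCompactSupport_lap {f : Plane → ℝ} (hf : HasCompactSupport f) :
    HasCompactSupport (lap f) :=
  (hasCompactSupport_pd 0 (hasCompactSupport_pd 0 hf)).add
    (hasCompactSupport_pd 1 (hasCompactSupport_pd 1 hf))

/-- The cutoffs are dilates of one function. The same bound serves k → ∞, where a small disc around
the origin is removed, and k → 0, where functions are truncated at infinity. -/
theorem exists_cutoff_bound : ∃ B : ℝ, 0 ≤ B ∧ ∀ k : ℝ, 0 < k → ∀ x : Plane,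
    (∀ i, |pd i (cutoff k) x| ≤ B * k) ∧ |lap (cutoff k) x| ≤ B * k ^ 2 := by
  have hs := contDiff_cutoff 1
  have hc := hasCompactSupport_cutoff one_pos
  obtain ⟨B0, h0⟩ := (contDiff_pd 0 hs).continuous.bounded_above_of_compact_support
    (hasCompactSupport_pd 0 hc)
  obtain ⟨B1, h1⟩ := (contDiff_pd 1 hs).continuous.bounded_above_of_compact_support
    (hasCompactSupport_pd 1 hc)
  obtain ⟨B2, h2⟩ := (contDiff_lap hs).continuous.bounded_above_of_compact_support
    (hasCompactSupport_lap hc)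
  refine ⟨max 0 (max B0 (max B1 B2)), le_max_left _ _, fun k hk x => ?_⟩
  have b0 : B0 ≤ max 0 (max B0 (max B1 B2)) := (le_max_left _ _).trans (le_max_right _ _)
  have b1 : B1 ≤ max 0 (max B0 (max B1 B2)) :=
    (le_max_left _ _).trans ((le_max_right _ _).trans (le_max_right _ _))
  have b2 : B2 ≤ max 0 (max B0 (max B1 B2)) :=
    (le_max_right _ _).trans ((le_max_right _ _).trans (le_max_right _ _))
  refine ⟨fun i => ?_, ?_⟩
  · rw [cutoff_eq_comp, pd_comp_smul i hs, abs_mul, abs_of_pos hk, mul_comm]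
    refine mul_le_mul_of_nonneg_right ?_ hk.le
    fin_cases i
    exacts [(h0 _).trans b0, (h1 _).trans b1]
  · rw [cutoff_eq_comp, lap_comp_smul hs, abs_mul, abs_of_pos (by positivity), mul_comm]
    exact mul_le_mul_of_nonneg_right ((h2 _).trans b2) (by positivity)

theorem cutoff_derivs_eq_zero {k : ℝ} (hk : 0 < k) {x : Plane} (hx : 2 < k * ‖x‖) :
    (∀ i, pd i (cutoff k) x = 0) ∧ lap (cutoff k) x = 0 := by
  have hn : x ∉ tsupport (cutoff k) := by
    intro h
    have := tsupport_cutoff_subset hk h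
    rw [mem_closedBall_zero_iff, le_div_iff₀ hk] at this
    linarith
  have h1 : ∀ i, x ∉ tsupport (pd i (cutoff k)) := fun i h => hn (tsupport_pd_subset i _ h)
  have h2 : ∀ i, x ∉ tsupport (pd i (pd i (cutoff k))) := fun i h =>
    h1 i (tsupport_pd_subset i _ h)
  refine ⟨fun i => image_eq_zero_of_notMem_tsupport (h1 i), ?_⟩
  rw [lap, image_eq_zero_of_notMem_tsupport (h2 0), image_eq_zero_of_notMem_tsupport (h2 1),
    add_zero]

theorem puncturedTest_sub_cutoff {k : ℝ} (hk : 0 < k) {u : Plane → ℝ} (hu : ContDiff ℝ ∞ u)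
    (hc : HasCompactSupport u) : PuncturedTest (fun x => u x - cutoff k x * u x) := by
  refine ⟨hu.sub ((contDiff_cutoff k).mul hu), hc.sub (hc.mul_left), ?_⟩
  rw [notMem_tsupport_iff_eventuallyEq]
  have : Metric.ball (0 : Plane) (1 / k) ∈ nhds 0 := Metric.ball_mem_nhds _ (by positivity)
  filter_upwards [this] with x hx
  rw [mem_ball_zero_iff, lt_div_iff₀ hk] at hx
  rw [cutoff_eq_one]
  · simp
  · rw [← mul_pow]
    have : 0 ≤ k * ‖x‖ := by positivity
    nlinarith

/-- The commutator of the Laplacian with a cutoff. -/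
def comm (k : ℝ) (u : Plane → ℝ) (x : Plane) : ℝ :=
  lap (cutoff k) x * u x + 2 * (pd 0 (cutoff k) x * pd 0 u x + pd 1 (cutoff k) x * pd 1 u x)

theorem schr_cutoff_mul (V : Plane → ℝ) (E h k : ℝ) {u : Plane → ℝ} (hu : ContDiff ℝ ∞ u)
    (x : Plane) : schr V E h (fun x => cutoff k x * u x) x
      = cutoff k x * schr V E h u x - h ^ 2 * comm k u x := by
  rw [schr, schr, lap_mul (contDiff_cutoff k) hu, comm]
  ring

theorem schr_sub_cutoff (V : Plane → ℝ) (E h k : ℝ) {u : Plane → ℝ} (hu : ContDiff ℝ ∞ u)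
    (x : Plane) : schr V E h (fun x => u x - cutoff k x * u x) x
      = (1 - cutoff k x) * schr V E h u x + h ^ 2 * comm k u x := by
  rw [schr, schr, lap_sub hu ((contDiff_cutoff k).mul hu), lap_mul (contDiff_cutoff k) hu, comm]
  ring

/-! ### The Carleman estimate across the origin -/

namespace CarlemanWeight

variable {E c δ₀ δ : ℝ} (W : CarlemanWeight E c δ₀ δ)

theorem sigma_rpow_ge (hδ : 0 < δ) {x : Plane} (hx : x ≠ 0) :
    (1 + ‖x‖) ^ (-δ) ≤ (1 + Real.exp (2 * (ell x - W.T))) ^ (-(δ / 2)) := by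
  have hn : 0 < ‖x‖ := norm_pos_iff.mpr hx
  have h1 : 1 + Real.exp (2 * (ell x - W.T)) ≤ (1 + ‖x‖) ^ (2 : ℝ) := by
    have h2 : Real.exp (2 * (ell x - W.T)) ≤ ‖x‖ ^ 2 := by
      rw [← exp_two_ell hx]
      exact Real.exp_le_exp.mpr (by linarith [W.T_nonneg])
    rw [Real.rpow_two]
    nlinarith
  have h3 := Real.rpow_le_rpow_of_nonpos (by linarith [one_lt_sigma W.T (ell x)]) h1
    (by linarith : -(δ / 2) ≤ 0)
  rw [← Real.rpow_mul (by linarith)] at h3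
  convert h3 using 2
  ring

theorem rate_ge_rpow (hδ : 0 < δ) {x : Plane} (hx : x ≠ 0) :
    δ / 2 * (1 + ‖x‖) ^ (-δ) ≤ W.rate (ell x) :=
  (mul_le_mul_of_nonneg_left (W.sigma_rpow_ge hδ hx) (by linarith)).trans (W.rate_ge (ell x))

theorem phase_factor_le_one {h : ℝ} (hh : 0 < h) (t : ℝ) : Real.exp (2 * W.phase t / h) ≤ 1 := by
  rw [Real.exp_le_one_iff]
  exact div_nonpos_of_nonpos_of_nonneg (by linarith [W.phase_nonpos t]) hh.le

theorem upper_nonneg (hδ : 0 < δ) (h : ℝ) (x : Plane) : 0 ≤ W.upper h x := by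
  have := W.rate_pos hδ (ell x)
  have := W.w_pos (ell x)
  unfold upper
  positivity

theorem lower_nonneg (hδ : 0 < δ) (h : ℝ) (x : Plane) : 0 ≤ W.lower h x := by
  have := W.rate_pos hδ (ell x)
  have := W.w_pos (ell x)
  unfold lower
  positivity

theorem upper_le_aux (hδ : 0 < δ) {h : ℝ} (hh : 0 < h) {x : Plane} (hx : x ≠ 0) :
    W.upper h x ≤ W.w (ell x) * ‖x‖ * (2 / δ * (1 + ‖x‖) ^ δ) := by
  have hn : 0 < ‖x‖ := norm_pos_iff.mpr hx
  have hr := W.rate_pos hδ (ell x)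
  have hw := W.w_pos (ell x)
  have h1 : W.upper h x ≤ W.w (ell x) * ‖x‖ / W.rate (ell x) :=
    mul_le_of_le_one_left (by positivity) (W.phase_factor_le_one hh _)
  refine h1.trans ?_
  rw [div_eq_mul_inv]
  refine mul_le_mul_of_nonneg_left ?_ (by positivity)
  have h2 : 0 < δ / 2 * (1 + ‖x‖) ^ (-δ) := by positivity
  have h3 := inv_anti₀ h2 (W.rate_ge_rpow hδ hx)
  refine h3.trans (le_of_eq ?_)
  rw [mul_inv, ← Real.rpow_neg (by positivity)]
  simp

theorem upper_le (hδ : 0 < δ) {h : ℝ} (hh : 0 < h) (x : Plane) :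
    W.upper h x ≤ 4 / δ * (1 + ‖x‖) ^ (1 + δ) := by
  by_cases hx : x = 0
  · subst hx
    simp [upper]
    positivity
  · have hn : 0 < ‖x‖ := norm_pos_iff.mpr hx
    have hw := W.w_le_two (ell x)
    refine (W.upper_le_aux hδ hh hx).trans ?_
    rw [Real.rpow_add (by linarith), Real.rpow_one]
    calc W.w (ell x) * ‖x‖ * (2 / δ * (1 + ‖x‖) ^ δ)
        ≤ 2 * (1 + ‖x‖) * (2 / δ * (1 + ‖x‖) ^ δ) := by
          gcongr
          linarith
      _ = 4 / δ * ((1 + ‖x‖) * (1 + ‖x‖) ^ δ) := by ring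

theorem w_le_sq {x : Plane} (hx : x ≠ 0) : W.w (ell x) ≤ 2 * ‖x‖ ^ 2 := by
  rw [← exp_two_ell hx]
  exact W.w_le_exp (ell x)

/-- Two of the three powers come from the vanishing of w. Against a squared commutator of size k⁴ on
a disc of radius 2/k, the weight k⁻³ and the area k⁻² leave O(1/k), so the origin can be cut out at
no cost in the limit. -/
theorem upper_le_cube (hδ : 0 < δ) (hδ1 : δ ≤ 1) {h : ℝ} (hh : 0 < h) {x : Plane}
    (hx1 : ‖x‖ ≤ 1) : W.upper h x ≤ 8 / δ * ‖x‖ ^ 3 := by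
  by_cases hx : x = 0
  · subst hx
    simp [upper]
  · have hn : 0 < ‖x‖ := norm_pos_iff.mpr hx
    refine (W.upper_le_aux hδ hh hx).trans ?_
    have h1 : (1 + ‖x‖) ^ δ ≤ 2 := by
      have := Real.rpow_le_rpow_of_exponent_le (by linarith : 1 ≤ 1 + ‖x‖) hδ1
      rw [Real.rpow_one] at this
      linarith
    calc W.w (ell x) * ‖x‖ * (2 / δ * (1 + ‖x‖) ^ δ)
        ≤ 2 * ‖x‖ ^ 2 * ‖x‖ * (2 / δ * 2) := by
          gcongr
          exact W.w_le_sq hx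
      _ = 8 / δ * ‖x‖ ^ 3 := by ring

/-- The phase factor, bounded below: one outside a disc, exponentially small inside. -/
def _root_.SemiclassicalResolvent.damping (R C h : ℝ) (x : Plane) : ℝ :=
  if R ≤ ‖x‖ then 1 else Real.exp (-(C / h))

theorem damping_le_phase_factor {h : ℝ} (hh : 0 < h) (x : Plane) :
    damping (Real.exp W.T) (2 * (W.a * Real.exp W.T)) h x
      ≤ Real.exp (2 * W.phase (ell x) / h) := by
  rw [damping]
  split_ifs with hR
  · have : W.T ≤ ell x := by
      rw [← Real.log_exp W.T]
      exact Real.log_le_log (Real.exp_pos _) hR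
    simp [W.phase_eq_zero _ this]
  · rw [Real.exp_le_exp, ← neg_div]
    refine div_le_div_of_nonneg_right ?_ hh.le
    linarith [W.phase_ge (ell x)]

/-- The weight w degenerates at the origin, so a disc is excluded. Radius 1/2 is small enough for
the excluded discs of two centres at distance one to be disjoint. The constant 1/(1 + 4e^{2T}) is
the value at |x| = 1/2 of the lower bound `w_ge`. -/
theorem lower_ge (hδ : 0 < δ) {h : ℝ} (hh : 0 < h) {x : Plane} (hx : 1 / 2 ≤ ‖x‖) :
    damping (Real.exp W.T) (2 * (W.a * Real.exp W.T)) h x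
        * (δ / 2 / (1 + 4 * Real.exp (2 * W.T)) * (1 + ‖x‖) ^ (-(1 + δ)))
      ≤ W.lower h x := by
  have hn : 0 < ‖x‖ := by linarith
  have hx0 : x ≠ 0 := norm_pos_iff.mp hn
  have hr := W.rate_pos hδ (ell x)
  have hw := W.w_pos (ell x)
  rw [lower]
  refine mul_le_mul (W.damping_le_phase_factor hh x) ?_ (by positivity) (Real.exp_pos _).le
  have h1 : 1 / (1 + 4 * Real.exp (2 * W.T)) ≤ W.w (ell x) := by
    refine le_trans ?_ (W.w_ge (ell x))
    have e : Real.exp (2 * (ell x - W.T)) = ‖x‖ ^ 2 / Real.exp (2 * W.T) := by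
      rw [mul_sub, Real.exp_sub, exp_two_ell hx0]
    have hp := Real.exp_pos (2 * W.T)
    rw [e, div_le_div_iff₀ (by positivity) (by positivity)]
    have h4 : 1 ≤ 4 * ‖x‖ ^ 2 := by nlinarith
    have h5 : 1 ≤ ‖x‖ ^ 2 / Real.exp (2 * W.T) * (4 * Real.exp (2 * W.T)) := by
      have : ‖x‖ ^ 2 / Real.exp (2 * W.T) * (4 * Real.exp (2 * W.T)) = 4 * ‖x‖ ^ 2 := by
        field_simp
      linarith
    nlinarith
  have h2 := W.rate_ge_rpow hδ hx0
  have h3 : (1 + ‖x‖) ^ (-(1 + δ)) ≤ (1 + ‖x‖) ^ (-δ) * (1 / ‖x‖) := by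
    rw [show -(1 + δ) = -δ + (-1 : ℝ) by ring, Real.rpow_add (by linarith), Real.rpow_neg_one]
    refine mul_le_mul_of_nonneg_left ?_ (by positivity)
    rw [inv_eq_one_div]
    exact one_div_le_one_div_of_le hn (by linarith)
  calc δ / 2 / (1 + 4 * Real.exp (2 * W.T)) * (1 + ‖x‖) ^ (-(1 + δ))
      ≤ δ / 2 / (1 + 4 * Real.exp (2 * W.T)) * ((1 + ‖x‖) ^ (-δ) * (1 / ‖x‖)) :=
        mul_le_mul_of_nonneg_left h3 (by positivity)
    _ = (δ / 2 * (1 + ‖x‖) ^ (-δ)) * (1 / (1 + 4 * Real.exp (2 * W.T))) / ‖x‖ := by ring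
    _ ≤ W.rate (ell x) * W.w (ell x) / ‖x‖ := by
        gcongr

end CarlemanWeight

/-! ### Weighted integrals and the errors caused by cutting out the origin. -/

theorem measurable_pow_weight (s : ℝ) : Measurable (fun x : Plane => (1 + ‖x‖) ^ s) := by
  fun_prop

theorem continuous_pow_weight (s : ℝ) : Continuous (fun x : Plane => (1 + ‖x‖) ^ s) :=
  (continuous_const.add continuous_norm).rpow_const fun x =>
    Or.inl (by positivity : (0 : ℝ) < 1 + ‖x‖).ne'

theorem integrable_mul_sq {V : Plane → ℝ} (hV : MemLp V ⊤ volume) {R a b : Plane → ℝ}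
    (hR : Continuous R) (ha : Continuous a) (hac : HasCompactSupport a) (hb : Continuous b)
    (hbc : HasCompactSupport b) :
    Integrable (fun x => R x * (a x + V x * b x) ^ 2) := by
  have h1 : Integrable (fun x => R x * (a x * a x)) :=
    (hR.mul (ha.mul ha)).integrable_of_hasCompactSupport ((hac.mul_left).mul_left)
  have h2 : Integrable (fun x => R x * (2 * (a x * b x))) :=
    (hR.mul (continuous_const.mul (ha.mul hb))).integrable_of_hasCompactSupport
      (((hbc.mul_left).mul_left).mul_left)
  have h3 : Integrable (fun x => R x * (b x * b x)) :=
    (hR.mul (hb.mul hb)).integrable_of_hasCompactSupport ((hbc.mul_left).mul_left)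
  refine ((h1.add (h2.mul_memLp_top hV)).add ((h3.mul_memLp_top hV).mul_memLp_top hV)).congr
    (Filter.Eventually.of_forall fun x => ?_)
  simp only [Pi.add_apply]
  ring

/-- The squared size of `(-h² Δ + V - E - iε)(u₁ + i u₂)`. -/
def resSq (V : Plane → ℝ) (E h ε : ℝ) (u₁ u₂ : Plane → ℝ) (x : Plane) : ℝ :=
  (schr V E h u₁ x + ε * u₂ x) ^ 2 + (schr V E h u₂ x - ε * u₁ x) ^ 2

theorem resSq_nonneg (V : Plane → ℝ) (E h ε : ℝ) (u₁ u₂ : Plane → ℝ) (x : Plane) :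
    0 ≤ resSq V E h ε u₁ u₂ x := by
  rw [resSq]
  positivity

theorem integrable_mul_resSq {V : Plane → ℝ} (hV : MemLp V ⊤ volume) (E h ε : ℝ) {R : Plane → ℝ}
    (hR : Continuous R) {u₁ u₂ : Plane → ℝ} (hu₁ : ContDiff ℝ ∞ u₁) (hc₁ : HasCompactSupport u₁)
    (hu₂ : ContDiff ℝ ∞ u₂) (hc₂ : HasCompactSupport u₂) :
    Integrable (fun x => R x * resSq V E h ε u₁ u₂ x) := by
  have aux : ∀ {u v : Plane → ℝ} (η : ℝ), ContDiff ℝ ∞ u → HasCompactSupport u →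
      ContDiff ℝ ∞ v → HasCompactSupport v →
      Integrable (fun x => R x * (-h ^ 2 * lap u x + -E * u x + η * v x + V x * u x) ^ 2) := by
    intro u v η hu hcu hv hcv
    have s1 : HasCompactSupport (fun x => -h ^ 2 * lap u x) :=
      HasCompactSupport.mul_left (f := fun _ => -h ^ 2) (hasCompactSupport_lap hcu)
    have s2 : HasCompactSupport (fun x => -E * u x) :=
      HasCompactSupport.mul_left (f := fun _ => -E) hcu
    have s3 : HasCompactSupport (fun x => η * v x) :=
      HasCompactSupport.mul_left (f := fun _ => η) hcv
    have l1 := (contDiff_lap hu).continuous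
    have c1 := hu.continuous
    have c2 := hv.continuous
    exact integrable_mul_sq hV hR (by fun_prop) ((s1.add s2).add s3) c1 hcu
  have j1 := aux ε hu₁ hc₁ hu₂ hc₂
  have j2 := aux (-ε) hu₂ hc₂ hu₁ hc₁
  refine (j1.add j2).congr (Filter.Eventually.of_forall fun x => ?_)
  simp only [Pi.add_apply, resSq, schr]
  ring

theorem exists_deriv_bound {u : Plane → ℝ} (hu : ContDiff ℝ ∞ u) (hc : HasCompactSupport u) :
    ∃ S : ℝ, 0 ≤ S ∧ ∀ x, |u x| ≤ S ∧ ∀ i, |pd i u x| ≤ S := by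
  obtain ⟨B0, h0⟩ := hu.continuous.bounded_above_of_compact_support hc
  obtain ⟨B1, h1⟩ := (contDiff_pd 0 hu).continuous.bounded_above_of_compact_support
    (hasCompactSupport_pd 0 hc)
  obtain ⟨B2, h2⟩ := (contDiff_pd 1 hu).continuous.bounded_above_of_compact_support
    (hasCompactSupport_pd 1 hc)
  refine ⟨max 0 (max B0 (max B1 B2)), le_max_left _ _, fun x => ⟨?_, fun i => ?_⟩⟩
  · exact (h0 x).trans ((le_max_left _ _).trans (le_max_right _ _))
  · fin_cases i
    · exact (h1 x).trans ((le_max_left _ _).trans ((le_max_right _ _).trans (le_max_right _ _)))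
    · exact (h2 x).trans ((le_max_right _ _).trans ((le_max_right _ _).trans (le_max_right _ _)))

theorem comm_sq_le {B S k : ℝ} (hB : 0 ≤ B) (hS : 0 ≤ S) (hk : 1 ≤ k) {u : Plane → ℝ} {x : Plane}
    (hcut : (∀ i, |pd i (cutoff k) x| ≤ B * k) ∧ |lap (cutoff k) x| ≤ B * k ^ 2)
    (hu : |u x| ≤ S ∧ ∀ i, |pd i u x| ≤ S) : comm k u x ^ 2 ≤ (5 * B * S * k ^ 2) ^ 2 := by
  rw [← sq_abs]
  refine pow_le_pow_left₀ (abs_nonneg _) ?_ 2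
  have hk0 : 0 ≤ k := by linarith
  have a1 : |lap (cutoff k) x * u x| ≤ B * k ^ 2 * S := by
    rw [abs_mul]
    exact mul_le_mul hcut.2 hu.1 (abs_nonneg _) (by positivity)
  have a2 : ∀ i, |pd i (cutoff k) x * pd i u x| ≤ B * k * S := fun i => by
    rw [abs_mul]
    exact mul_le_mul (hcut.1 i) (hu.2 i) (abs_nonneg _) (by positivity)
  have a3 : B * k * S ≤ B * k ^ 2 * S := by
    have : k ≤ k ^ 2 := by nlinarith
    gcongr
  rw [comm]
  refine (abs_add_le _ _).trans ?_
  rw [abs_mul 2, abs_two]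
  have a4 := abs_add_le (pd 0 (cutoff k) x * pd 0 u x) (pd 1 (cutoff k) x * pd 1 u x)
  have := a2 0
  have := a2 1
  linarith

theorem gradSq_sub_cutoff_le (k : ℝ) {u : Plane → ℝ} (hu : ContDiff ℝ ∞ u) (x : Plane) :
    gradSq (fun x => u x - cutoff k x * u x) x
      ≤ 2 * gradSq u x + 2 * (gradSq (cutoff k) x * u x ^ 2) := by
  have d : ∀ {f : Plane → ℝ}, ContDiff ℝ ∞ f → DifferentiableAt ℝ f x := fun hf =>
    hf.contDiffAt.differentiableAt (by simp)
  have e : ∀ i, pd i (fun x => u x - cutoff k x * u x) x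
      = (1 - cutoff k x) * pd i u x - pd i (cutoff k) x * u x := by
    intro i
    rw [pd_sub i (d hu) ((d (contDiff_cutoff k)).fun_mul (d hu)),
      pd_mul i (d (contDiff_cutoff k)) (d hu)]
    ring
  have h0 := cutoff_nonneg k x
  have h1 := cutoff_le_one k x
  have h : ∀ i, pd i (fun x => u x - cutoff k x * u x) x ^ 2
      ≤ 2 * pd i u x ^ 2 + 2 * (pd i (cutoff k) x ^ 2 * u x ^ 2) := by
    intro i
    rw [e]
    have a1 : (1 - cutoff k x) ^ 2 * pd i u x ^ 2 ≤ pd i u x ^ 2 :=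
      mul_le_of_le_one_left (sq_nonneg _) (by nlinarith)
    nlinarith [sq_nonneg ((1 - cutoff k x) * pd i u x + pd i (cutoff k) x * u x)]
  rw [gradSq, gradSq, gradSq]
  have := h 0
  have := h 1
  linarith

theorem resSq_sub_cutoff_le (V : Plane → ℝ) (E h ε k : ℝ) {u₁ u₂ : Plane → ℝ}
    (hu₁ : ContDiff ℝ ∞ u₁) (hu₂ : ContDiff ℝ ∞ u₂) (x : Plane) :
    resSq V E h ε (fun x => u₁ x - cutoff k x * u₁ x) (fun x => u₂ x - cutoff k x * u₂ x) x
      ≤ 2 * resSq V E h ε u₁ u₂ x + 2 * h ^ 4 * (comm k u₁ x ^ 2 + comm k u₂ x ^ 2) := by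
  have h0 := cutoff_nonneg k x
  have h1 := cutoff_le_one k x
  have aux : ∀ F G : ℝ, ((1 - cutoff k x) * F + h ^ 2 * G) ^ 2 ≤ 2 * F ^ 2 + 2 * h ^ 4 * G ^ 2 := by
    intro F G
    have a1 : (1 - cutoff k x) ^ 2 * F ^ 2 ≤ F ^ 2 :=
      mul_le_of_le_one_left (sq_nonneg _) (by nlinarith)
    nlinarith [sq_nonneg ((1 - cutoff k x) * F - h ^ 2 * G)]
  have b1 := aux (schr V E h u₁ x + ε * u₂ x) (comm k u₁ x)
  have b2 := aux (schr V E h u₂ x - ε * u₁ x) (comm k u₂ x)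
  rw [resSq, resSq, schr_sub_cutoff V E h k hu₁, schr_sub_cutoff V E h k hu₂]
  refine le_trans (le_of_eq ?_) ((add_le_add b1 b2).trans (le_of_eq ?_)) <;> ring

theorem gradSq_nonneg (u : Plane → ℝ) (x : Plane) : 0 ≤ gradSq u x := by
  rw [gradSq]
  positivity

theorem integrable_gradSq {u : Plane → ℝ} (hu : ContDiff ℝ ∞ u) (hc : HasCompactSupport u) :
    Integrable (gradSq u) := by
  have h : ∀ i, Integrable (fun x => pd i u x * pd i u x) := fun i =>
    ((contDiff_pd i hu).continuous.mul (contDiff_pd i hu).continuous).integrable_of_hasCompactSupport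
      ((hasCompactSupport_pd i hc).mul_left)
  refine ((h 0).add (h 1)).congr (Filter.Eventually.of_forall fun x => ?_)
  simp only [Pi.add_apply, gradSq]
  ring

theorem integrable_sq {u : Plane → ℝ} (hu : ContDiff ℝ ∞ u) (hc : HasCompactSupport u) :
    Integrable (fun x => u x ^ 2) := by
  refine ((hu.continuous.mul hu.continuous).integrable_of_hasCompactSupport
    hc.mul_left).congr (Filter.Eventually.of_forall fun x => ?_)
  simp only [Pi.mul_apply]
  ring

namespace CarlemanWeight

variable {E c δ₀ δ : ℝ} (W : CarlemanWeight E c δ₀ δ)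

theorem upper_mul_resSq_le (hδ : 0 < δ) (hδ1 : δ ≤ 1) (V : Plane → ℝ) {h : ℝ} (hh : 0 < h)
    (ε : ℝ) {B S k : ℝ} (hB : 0 ≤ B) (hS : 0 ≤ S) (hk : 4 ≤ k) {u₁ u₂ : Plane → ℝ}
    (hu₁ : ContDiff ℝ ∞ u₁) (hu₂ : ContDiff ℝ ∞ u₂) {x : Plane}
    (hcut : (∀ i, |pd i (cutoff k) x| ≤ B * k) ∧ |lap (cutoff k) x| ≤ B * k ^ 2)
    (hS₁ : |u₁ x| ≤ S ∧ ∀ i, |pd i u₁ x| ≤ S) (hS₂ : |u₂ x| ≤ S ∧ ∀ i, |pd i u₂ x| ≤ S) :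
    W.upper h x * resSq V E h ε (fun x => u₁ x - cutoff k x * u₁ x)
        (fun x => u₂ x - cutoff k x * u₂ x) x
      ≤ 2 * (4 / δ * ((1 + ‖x‖) ^ (1 + δ) * resSq V E h ε u₁ u₂ x))
        + (Metric.closedBall 0 (2 / k)).indicator
          (fun _ => 6400 / δ * h ^ 4 * (B * S) ^ 2 * k) x := by
  have hk0 : 0 < k := by linarith
  have h1 := mul_le_mul_of_nonneg_left (resSq_sub_cutoff_le V E h ε k hu₁ hu₂ x)
    (W.upper_nonneg hδ h x)
  refine h1.trans ?_
  have h2 := mul_le_mul_of_nonneg_right (W.upper_le hδ hh x) (resSq_nonneg V E h ε u₁ u₂ x)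
  have h3 : W.upper h x * (2 * h ^ 4 * (comm k u₁ x ^ 2 + comm k u₂ x ^ 2))
      ≤ (Metric.closedBall 0 (2 / k)).indicator
          (fun _ => 6400 / δ * h ^ 4 * (B * S) ^ 2 * k) x := by
    by_cases hx : x ∈ Metric.closedBall (0 : Plane) (2 / k)
    · rw [Set.indicator_of_mem hx]
      rw [mem_closedBall_zero_iff] at hx
      have hx1 : ‖x‖ ≤ 1 := hx.trans (by rw [div_le_one hk0]; linarith)
      have a1 : W.upper h x ≤ 8 / δ * (2 / k) ^ 3 :=
        (W.upper_le_cube hδ hδ1 hh hx1).trans (by gcongr)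
      have a2 := comm_sq_le hB hS (by linarith) hcut hS₁
      have a3 := comm_sq_le hB hS (by linarith) hcut hS₂
      calc W.upper h x * (2 * h ^ 4 * (comm k u₁ x ^ 2 + comm k u₂ x ^ 2))
          ≤ 8 / δ * (2 / k) ^ 3
            * (2 * h ^ 4 * ((5 * B * S * k ^ 2) ^ 2 + (5 * B * S * k ^ 2) ^ 2)) := by
            gcongr
        _ = 6400 / δ * h ^ 4 * (B * S) ^ 2 * k := by
            field_simp
            ring
    · rw [Set.indicator_of_notMem hx]
      rw [mem_closedBall_zero_iff, not_le, div_lt_iff₀ hk0] at hx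
      obtain ⟨z1, z2⟩ := cutoff_derivs_eq_zero hk0 (by linarith : 2 < k * ‖x‖)
      simp [comm, z1, z2]
  linarith

theorem energy_sub_cutoff_le {h : ℝ} {B S k : ℝ}
    (hk : 4 ≤ k) {u : Plane → ℝ} (hu : ContDiff ℝ ∞ u) {x : Plane}
    (hcut : (∀ i, |pd i (cutoff k) x| ≤ B * k) ∧ |lap (cutoff k) x| ≤ B * k ^ 2)
    (hS₁ : |u x| ≤ S ∧ ∀ i, |pd i u x| ≤ S) (hx0 : x ≠ 0) :
    (u x - cutoff k x * u x) ^ 2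
        + W.w (ell x) ^ 2 * h ^ 2 * gradSq (fun x => u x - cutoff k x * u x) x
      ≤ u x ^ 2 + 8 * h ^ 2 * gradSq u x
        + (Metric.closedBall 0 (2 / k)).indicator (fun _ => 256 * h ^ 2 * (B * S) ^ 2 * k) x := by
  have hk0 : 0 < k := by linarith
  have h0 := cutoff_nonneg k x
  have h1 := cutoff_le_one k x
  have hw := W.w_pos (ell x)
  have a0 : (u x - cutoff k x * u x) ^ 2 ≤ u x ^ 2 := by
    have : (u x - cutoff k x * u x) ^ 2 = (1 - cutoff k x) ^ 2 * u x ^ 2 := by ring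
    rw [this]
    exact mul_le_of_le_one_left (sq_nonneg _) (by nlinarith)
  have a1 := mul_le_mul_of_nonneg_left (gradSq_sub_cutoff_le k hu x)
    (by positivity : 0 ≤ W.w (ell x) ^ 2 * h ^ 2)
  have a2 : W.w (ell x) ^ 2 * h ^ 2 * (2 * gradSq u x) ≤ 8 * h ^ 2 * gradSq u x := by
    have h4 : W.w (ell x) ^ 2 ≤ 4 := by nlinarith [W.w_le_two (ell x)]
    have := mul_le_mul_of_nonneg_right h4 (by have := gradSq_nonneg u x; positivity :
      0 ≤ h ^ 2 * (2 * gradSq u x))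
    linarith
  have a3 : W.w (ell x) ^ 2 * h ^ 2 * (2 * (gradSq (cutoff k) x * u x ^ 2))
      ≤ (Metric.closedBall 0 (2 / k)).indicator (fun _ => 256 * h ^ 2 * (B * S) ^ 2 * k) x := by
    by_cases hx : x ∈ Metric.closedBall (0 : Plane) (2 / k)
    · rw [Set.indicator_of_mem hx]
      rw [mem_closedBall_zero_iff] at hx
      have b1 : W.w (ell x) ^ 2 ≤ (2 * (2 / k) ^ 2) ^ 2 := by
        refine pow_le_pow_left₀ hw.le ((W.w_le_sq hx0).trans ?_) 2
        gcongr
      have b2 : gradSq (cutoff k) x ≤ 2 * (B * k) ^ 2 := by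
        have c1 := sq_le_sq' (abs_le.mp (hcut.1 0)).1 (abs_le.mp (hcut.1 0)).2
        have c2 := sq_le_sq' (abs_le.mp (hcut.1 1)).1 (abs_le.mp (hcut.1 1)).2
        rw [gradSq]
        linarith
      have b3 : u x ^ 2 ≤ S ^ 2 := sq_le_sq' (abs_le.mp hS₁.1).1 (abs_le.mp hS₁.1).2
      have b4 := gradSq_nonneg (cutoff k) x
      calc W.w (ell x) ^ 2 * h ^ 2 * (2 * (gradSq (cutoff k) x * u x ^ 2))
          ≤ (2 * (2 / k) ^ 2) ^ 2 * h ^ 2 * (2 * (2 * (B * k) ^ 2 * S ^ 2)) := by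
            gcongr
        _ = 256 * h ^ 2 * (B * S) ^ 2 * (1 / k ^ 2) := by
            field_simp
            ring
        -- A deliberately crude bound of 1/k² by k, so that this error and the commutator error have
        -- the same form.
        _ ≤ 256 * h ^ 2 * (B * S) ^ 2 * k := by
            refine mul_le_mul_of_nonneg_left ?_ (by positivity)
            rw [div_le_iff₀ (by positivity)]
            nlinarith [pow_pos hk0 2]
    · rw [Set.indicator_of_notMem hx]
      rw [mem_closedBall_zero_iff, not_le, div_lt_iff₀ hk0] at hx
      obtain ⟨z1, z2⟩ := cutoff_derivs_eq_zero hk0 (by linarith : 2 < k * ‖x‖)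
      simp [gradSq, z1]
  linarith

/-- The Carleman estimate without support condition; the control at the origin is lost. -/
theorem carleman_origin (hE : 0 < E) (hδ : 0 < δ) (hδ1 : δ ≤ 1) (hc : 0 < c)
    {V : Plane → ℝ} {g : Plane → Plane}
    (hV : MemLp V ⊤ volume) (hgm : MemLp g ⊤ volume) (hg : IsWeakGradient V g)
    (hVd : ∀ᵐ x, V x ≤ c * (1 + ‖x‖) ^ (-δ₀))
    (hgd : ∀ᵐ x, ‖g x‖ ≤ c * (1 + ‖x‖) ^ (-1 - δ₀))
    {h ε : ℝ} (hh : 0 < h) (hh₀ : h ≤ W.h₀) (hε : 0 ≤ ε) {u₁ u₂ : Plane → ℝ}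
    (hu₁ : ContDiff ℝ ∞ u₁) (hc₁ : HasCompactSupport u₁)
    (hu₂ : ContDiff ℝ ∞ u₂) (hc₂ : HasCompactSupport u₂) :
    E / 2 * ∫ x in {x : Plane | 1 / 2 ≤ ‖x‖}, W.lower h x * (u₁ x ^ 2 + u₂ x ^ 2)
      ≤ 8 / (δ * h ^ 2) * (∫ x, (1 + ‖x‖) ^ (1 + δ) * resSq V E h ε u₁ u₂ x)
        + ε / h * ∫ x, (u₁ x ^ 2 + u₂ x ^ 2 + 8 * h ^ 2 * (gradSq u₁ x + gradSq u₂ x)) := by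
  obtain ⟨B, hB, hcut⟩ := exists_cutoff_bound
  obtain ⟨S₁, hS₁, hb₁⟩ := exists_deriv_bound hu₁ hc₁
  obtain ⟨S₂, hS₂, hb₂⟩ := exists_deriv_bound hu₂ hc₂
  set S := max S₁ S₂
  have hS : 0 ≤ S := hS₁.trans (le_max_left _ _)
  have hb₁' : ∀ x, |u₁ x| ≤ S ∧ ∀ i, |pd i u₁ x| ≤ S := fun x =>
    ⟨(hb₁ x).1.trans (le_max_left _ _), fun i => ((hb₁ x).2 i).trans (le_max_left _ _)⟩
  have hb₂' : ∀ x, |u₂ x| ≤ S ∧ ∀ i, |pd i u₂ x| ≤ S := fun x =>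
    ⟨(hb₂ x).1.trans (le_max_right _ _), fun i => ((hb₂ x).2 i).trans (le_max_right _ _)⟩
  set A := 8 / (δ * h ^ 2) * (∫ x, (1 + ‖x‖) ^ (1 + δ) * resSq V E h ε u₁ u₂ x)
        + ε / h * ∫ x, (u₁ x ^ 2 + u₂ x ^ 2 + 8 * h ^ 2 * (gradSq u₁ x + gradSq u₂ x)) with hA
  set K₁ := 6400 / δ * h ^ 4 * (B * S) ^ 2
  set K₂ := 256 * h ^ 2 * (B * S) ^ 2
  have iU := integrable_mul_resSq hV E h ε (continuous_pow_weight (1 + δ)) hu₁ hc₁ hu₂ hc₂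
  have iC : Integrable (fun x => u₁ x ^ 2 + u₂ x ^ 2
      + 8 * h ^ 2 * (gradSq u₁ x + gradSq u₂ x)) :=
    ((integrable_sq hu₁ hc₁).add (integrable_sq hu₂ hc₂)).add
      (((integrable_gradSq hu₁ hc₁).add (integrable_gradSq hu₂ hc₂)).const_mul (8 * h ^ 2))
  have hne : ∀ᵐ x : Plane, x ≠ 0 := by
    rw [ae_iff]
    simp
  have hms : MeasurableSet {x : Plane | 1 / 2 ≤ ‖x‖} :=
    measurableSet_le measurable_const measurable_norm
  -- Both errors are at most a constant times k on a disc of area proportional to 1/k², hence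
  -- O(1/k). The condition k ≥ 4 makes the cutoff vanish on |x| ≥ 1/2, so the left side does not see
  -- it.
  have main : ∀ k : ℝ, 4 ≤ k →
      E / 2 * ∫ x in {x : Plane | 1 / 2 ≤ ‖x‖}, W.lower h x * (u₁ x ^ 2 + u₂ x ^ 2)
      ≤ A + (1 / h ^ 2 * K₁ + 2 * (ε / h) * K₂) * (4 * volume.real (Metric.closedBall (0 : Plane) 1))
        * (1 / k) := by
    intro k hk
    have hk0 : 0 < k := by linarith
    have p₁ := puncturedTest_sub_cutoff hk0 hu₁ hc₁
    have p₂ := puncturedTest_sub_cutoff hk0 hu₂ hc₂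
    have hcar := W.carleman_punctured hδ hc hV hgm hg hVd hgd hh hh₀ hε p₁ p₂
    have iI : ∀ K : ℝ, Integrable ((Metric.closedBall (0 : Plane) (2 / k)).indicator
        (fun _ => K)) := fun K =>
      (integrable_indicator_iff Metric.isClosed_closedBall.measurableSet).mpr
        (integrableOn_const (isCompact_closedBall _ _).measure_lt_top.ne)
    have vI : ∀ K : ℝ, ∫ x, (Metric.closedBall (0 : Plane) (2 / k)).indicator (fun _ => K) x
        = K * (4 * volume.real (Metric.closedBall (0 : Plane) 1)) * (1 / k ^ 2) := by
      intro K
      rw [integral_indicator Metric.isClosed_closedBall.measurableSet, setIntegral_const,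
        Measure.addHaar_real_closedBall' _ _ (by positivity), finrank_euclideanSpace_fin,
        smul_eq_mul]
      field_simp
      ring
    have e1 : ∫ x in {x : Plane | 1 / 2 ≤ ‖x‖}, W.lower h x * (u₁ x ^ 2 + u₂ x ^ 2)
        ≤ ∫ x, W.lower h x * ((u₁ x - cutoff k x * u₁ x) ^ 2
          + (u₂ x - cutoff k x * u₂ x) ^ 2) := by
      have : ∫ x in {x : Plane | 1 / 2 ≤ ‖x‖}, W.lower h x * (u₁ x ^ 2 + u₂ x ^ 2)
          = ∫ x in {x : Plane | 1 / 2 ≤ ‖x‖}, W.lower h x * ((u₁ x - cutoff k x * u₁ x) ^ 2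
          + (u₂ x - cutoff k x * u₂ x) ^ 2) := by
        refine setIntegral_congr_fun hms fun x hx => ?_
        have hx' : 1 / 2 ≤ ‖x‖ := hx
        have : cutoff k x = 0 := by
          have h2 : 2 ≤ k * ‖x‖ := by nlinarith
          exact cutoff_eq_zero (by rw [← mul_pow]; nlinarith)
        simp [this]
      rw [this]
      refine setIntegral_le_integral (W.integrable_lower_mul h p₁ p₂)
        (Filter.Eventually.of_forall fun x => ?_)
      have := W.lower_nonneg hδ h x
      simp only [Pi.zero_apply]
      positivity
    have e2 : ∫ x, W.upper h x * resSq V E h ε (fun x => u₁ x - cutoff k x * u₁ x)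
          (fun x => u₂ x - cutoff k x * u₂ x) x
        ≤ 2 * (4 / δ * ∫ x, (1 + ‖x‖) ^ (1 + δ) * resSq V E h ε u₁ u₂ x)
          + K₁ * k * (4 * volume.real (Metric.closedBall (0 : Plane) 1)) * (1 / k ^ 2) := by
      rw [← vI, ← integral_const_mul, ← integral_const_mul,
        ← integral_add ((iU.const_mul _).const_mul _) (iI _)]
      refine integral_mono_of_nonneg (Filter.Eventually.of_forall fun x =>
        mul_nonneg (W.upper_nonneg hδ h x) (resSq_nonneg _ _ _ _ _ _ _))
        (((iU.const_mul _).const_mul _).add (iI _)) (Filter.Eventually.of_forall fun x => ?_)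
      exact W.upper_mul_resSq_le hδ hδ1 V hh ε hB hS hk hu₁ hu₂ (hcut k hk0 x) (hb₁' x) (hb₂' x)
    have e3 : ∫ x, ((u₁ x - cutoff k x * u₁ x) ^ 2 + (u₂ x - cutoff k x * u₂ x) ^ 2
          + W.w (ell x) ^ 2 * h ^ 2 * (gradSq (fun x => u₁ x - cutoff k x * u₁ x) x
            + gradSq (fun x => u₂ x - cutoff k x * u₂ x) x))
        ≤ (∫ x, (u₁ x ^ 2 + u₂ x ^ 2 + 8 * h ^ 2 * (gradSq u₁ x + gradSq u₂ x)))
          + 2 * K₂ * k * (4 * volume.real (Metric.closedBall (0 : Plane) 1)) * (1 / k ^ 2) := by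
      rw [← vI, ← integral_add iC (iI _)]
      refine integral_mono_of_nonneg (Filter.Eventually.of_forall fun x => ?_)
        (iC.add (iI _)) ?_
      · have := gradSq_nonneg (fun x => u₁ x - cutoff k x * u₁ x) x
        have := gradSq_nonneg (fun x => u₂ x - cutoff k x * u₂ x) x
        simp only [Pi.zero_apply]
        positivity
      · filter_upwards [hne] with x hx
        have q1 := W.energy_sub_cutoff_le (h := h) hk hu₁ (hcut k hk0 x) (hb₁' x) hx
        have q2 := W.energy_sub_cutoff_le (h := h) hk hu₂ (hcut k hk0 x) (hb₂' x) hx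
        have q3 : (Metric.closedBall (0 : Plane) (2 / k)).indicator (fun _ => 2 * K₂ * k) x
            = 2 * (Metric.closedBall (0 : Plane) (2 / k)).indicator (fun _ => K₂ * k) x := by
          by_cases hx : x ∈ Metric.closedBall (0 : Plane) (2 / k)
          · simp only [Set.indicator_of_mem hx]
            ring
          · simp only [Set.indicator_of_notMem hx, mul_zero]
        rw [q3]
        linarith
    have f1 := mul_le_mul_of_nonneg_left e1 (by positivity : 0 ≤ E / 2)
    have f2 := mul_le_mul_of_nonneg_left e2 (by positivity : 0 ≤ 1 / h ^ 2)
    have f3 := mul_le_mul_of_nonneg_left e3 (by positivity : 0 ≤ ε / h)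
    refine (f1.trans (hcar.trans (add_le_add f2 f3))).trans (le_of_eq ?_)
    rw [hA]
    field_simp
    ring
  have lim : Filter.Tendsto (fun k : ℝ => A + (1 / h ^ 2 * K₁ + 2 * (ε / h) * K₂)
      * (4 * volume.real (Metric.closedBall (0 : Plane) 1)) * (1 / k)) Filter.atTop
      (nhds (A + (1 / h ^ 2 * K₁ + 2 * (ε / h) * K₂)
      * (4 * volume.real (Metric.closedBall (0 : Plane) 1)) * 0)) := by
    have h0 : Filter.Tendsto (fun k : ℝ => 1 / k) Filter.atTop (nhds 0) :=
      tendsto_const_nhds.div_atTop Filter.tendsto_id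
    exact tendsto_const_nhds.add (h0.const_mul _)
  rw [mul_zero, add_zero] at lim
  refine ge_of_tendsto lim ?_
  filter_upwards [Filter.eventually_ge_atTop (4 : ℝ)] with k hk using main k hk

end CarlemanWeight

/-! ### Translating the centre of the Carleman weight -/

theorem pd_comp_add_right (i : Fin 2) (f : Plane → ℝ) (p x : Plane) :
    pd i (fun y => f (y + p)) x = pd i f (x + p) := by
  simp only [pd, fderiv_comp_add_right]

theorem lap_comp_add_right (f : Plane → ℝ) (p x : Plane) :
    lap (fun y => f (y + p)) x = lap f (x + p) := by
  have h : ∀ i, pd i (fun y => f (y + p)) = fun y => pd i f (y + p) := fun i =>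
    funext fun y => pd_comp_add_right i f p y
  rw [lap, h, h, pd_comp_add_right, pd_comp_add_right, lap]

theorem resSq_comp_add_right (V : Plane → ℝ) (E h ε : ℝ) (u₁ u₂ : Plane → ℝ) (p x : Plane) :
    resSq (fun y => V (y + p)) E h ε (fun y => u₁ (y + p)) (fun y => u₂ (y + p)) x
      = resSq V E h ε u₁ u₂ (x + p) := by
  simp only [resSq, schr, lap_comp_add_right]

theorem gradSq_comp_add_right (u : Plane → ℝ) (p x : Plane) :
    gradSq (fun y => u (y + p)) x = gradSq u (x + p) := by
  simp only [gradSq, pd_comp_add_right]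

theorem hasCompactSupport_comp_add_right {u : Plane → ℝ} (hu : HasCompactSupport u) (p : Plane) :
    HasCompactSupport fun y => u (y + p) :=
  hu.comp_homeomorph (Homeomorph.addRight p)

theorem contDiff_comp_add_right {u : Plane → ℝ} (hu : ContDiff ℝ ∞ u) (p : Plane) :
    ContDiff ℝ ∞ fun y => u (y + p) :=
  hu.comp (contDiff_id.add contDiff_const)

theorem IsWeakGradient.comp_add_right {V : Plane → ℝ} {g : Plane → Plane}
    (hg : IsWeakGradient V g) (p : Plane) :
    IsWeakGradient (fun y => V (y + p)) (fun y => g (y + p)) := by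
  intro φ hφ hc v
  have h := hg (fun y => φ (y + -p)) (contDiff_comp_add_right hφ (-p))
    (hasCompactSupport_comp_add_right hc (-p)) v
  rw [← integral_add_right_eq_self _ p, ← integral_add_right_eq_self (fun x => inner ℝ (g x) v * _) p] at h
  simpa [fderiv_comp_add_right] using h

theorem ae_comp_add_right {q : Plane → Prop} (hq : ∀ᵐ x, q x) (p : Plane) : ∀ᵐ x, q (x + p) :=
  (measurePreserving_add_right volume p).quasiMeasurePreserving.ae hq

theorem one_add_norm_add_le {p : Plane} (hp : ‖p‖ ≤ 1) (x : Plane) :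
    1 + ‖x‖ ≤ 2 * (1 + ‖x + p‖) ∧ 1 + ‖x + p‖ ≤ 2 * (1 + ‖x‖) := by
  have h1 : ‖x‖ ≤ ‖x + p‖ + ‖p‖ := by
    simpa using norm_sub_le (x + p) p
  have h2 := norm_add_le x p
  have := norm_nonneg x
  have := norm_nonneg (x + p)
  constructor <;> linarith

theorem rpow_neg_le_of_le_two_mul {a b q : ℝ} (ha : 0 < a) (hb : 0 < b) (hab : a ≤ 2 * b)
    (hq : 0 ≤ q) : b ^ (-q) ≤ 2 ^ q * a ^ (-q) := by
  have h := Real.rpow_le_rpow_of_nonpos ha hab (by linarith : -q ≤ 0)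
  rw [Real.mul_rpow (by norm_num) hb.le] at h
  have h2 := mul_le_mul_of_nonneg_left h (by positivity : (0 : ℝ) ≤ 2 ^ q)
  rwa [← mul_assoc, ← Real.rpow_add (by norm_num), add_neg_cancel, Real.rpow_zero, one_mul] at h2

/-! ### Bounds for the damping factor. -/

theorem damping_pos (R C h : ℝ) (x : Plane) : 0 < damping R C h x := by
  rw [damping]
  split_ifs
  · exact one_pos
  · exact Real.exp_pos _

theorem damping_le_one {R C h : ℝ} (hC : 0 ≤ C) (hh : 0 < h) (x : Plane) :
    damping R C h x ≤ 1 := by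
  rw [damping]
  split_ifs
  · exact le_rfl
  · exact Real.exp_le_one_iff.mpr (by have := div_nonneg hC hh.le; linarith)

theorem exp_le_damping {R C h : ℝ} (hC : 0 ≤ C) (hh : 0 < h) (x : Plane) :
    Real.exp (-(C / h)) ≤ damping R C h x := by
  rw [damping]
  split_ifs
  · exact Real.exp_le_one_iff.mpr (by have := div_nonneg hC hh.le; linarith)
  · exact le_rfl

theorem measurable_damping (R C h : ℝ) : Measurable (damping R C h) :=
  Measurable.ite (measurableSet_le measurable_const measurable_norm) measurable_const
    measurable_const

theorem damping_add_le {R C h : ℝ} (hC : 0 ≤ C) (hh : 0 < h) {p : Plane} (hp : ‖p‖ ≤ 1)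
    (x : Plane) : damping (R + 1) C h (x + p) ≤ damping R C h x := by
  by_cases hx : R + 1 ≤ ‖x + p‖
  · have h2 := norm_add_le x p
    rw [damping, if_pos hx, damping, if_pos (by linarith)]
  · rw [damping, if_neg hx]
    exact exp_le_damping hC hh x

namespace CarlemanWeight

variable {E c δ₀ δ : ℝ} (W : CarlemanWeight E (c * 2 ^ (1 + δ₀)) δ₀ δ)

/-- Moving the centre by |p| ≤ 1 compares 1 + |x| and 1 + |x + p| up to a factor 2. The translated
potential obeys the same bounds with c enlarged by 2^{1+δ₀}, the constant for which `W` is built.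
The weights change by at most 2^{1+δ} ≤ 4, and the undamped region starts one unit farther out. -/
theorem carleman_translate (hE : 0 < E) (hδ₀ : 0 < δ₀) (hδ : 0 < δ) (hδ1 : δ ≤ 1) (hc : 0 < c)
    {V : Plane → ℝ} {g : Plane → Plane}
    (hV : MemLp V ⊤ volume) (hgm : MemLp g ⊤ volume) (hg : IsWeakGradient V g)
    (hVd : ∀ᵐ x, V x ≤ c * (1 + ‖x‖) ^ (-δ₀))
    (hgd : ∀ᵐ x, ‖g x‖ ≤ c * (1 + ‖x‖) ^ (-1 - δ₀))
    {h ε : ℝ} (hh : 0 < h) (hh₀ : h ≤ W.h₀) (hε : 0 ≤ ε) {u₁ u₂ : Plane → ℝ}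
    (hu₁ : ContDiff ℝ ∞ u₁) (hc₁ : HasCompactSupport u₁)
    (hu₂ : ContDiff ℝ ∞ u₂) (hc₂ : HasCompactSupport u₂) {p : Plane} (hp : ‖p‖ ≤ 1) :
    E / 2 * (δ / 8 / (1 + 4 * Real.exp (2 * W.T))) *
        ∫ x in {x : Plane | 1 / 2 ≤ ‖x - p‖},
          damping (Real.exp W.T + 1) (2 * (W.a * Real.exp W.T)) h x
            * ((1 + ‖x‖) ^ (-(1 + δ)) * (u₁ x ^ 2 + u₂ x ^ 2))
      ≤ 32 / (δ * h ^ 2) * (∫ x, (1 + ‖x‖) ^ (1 + δ) * resSq V E h ε u₁ u₂ x)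
        + ε / h * ∫ x, (u₁ x ^ 2 + u₂ x ^ 2 + 8 * h ^ 2 * (gradSq u₁ x + gradSq u₂ x)) := by
  have hC₁ : 0 ≤ 2 * (W.a * Real.exp W.T) := by
    have := W.a_nonneg
    positivity
  have hmp := measurePreserving_add_right (volume : Measure Plane) p
  have hV' : MemLp (fun x => V (x + p)) ⊤ volume := hV.comp_measurePreserving hmp
  have hg' : MemLp (fun x => g (x + p)) ⊤ volume := hgm.comp_measurePreserving hmp
  have hpow : ∀ q : ℝ, 0 ≤ q → q ≤ 1 + δ₀ → ∀ x : Plane,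
      c * (1 + ‖x + p‖) ^ (-q) ≤ c * 2 ^ (1 + δ₀) * (1 + ‖x‖) ^ (-q) := by
    intro q hq hq1 x
    have h1 := rpow_neg_le_of_le_two_mul (by positivity) (by positivity)
      (one_add_norm_add_le hp x).1 hq
    have h2 : (2 : ℝ) ^ q ≤ 2 ^ (1 + δ₀) := Real.rpow_le_rpow_of_exponent_le (by norm_num) hq1
    rw [mul_assoc]
    refine mul_le_mul_of_nonneg_left (h1.trans ?_) hc.le
    exact mul_le_mul_of_nonneg_right h2 (by positivity)
  have hVd' : ∀ᵐ x, V (x + p) ≤ c * 2 ^ (1 + δ₀) * (1 + ‖x‖) ^ (-δ₀) := by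
    filter_upwards [ae_comp_add_right hVd p] with x hx
    exact hx.trans (hpow δ₀ hδ₀.le (by linarith) x)
  have hgd' : ∀ᵐ x, ‖g (x + p)‖ ≤ c * 2 ^ (1 + δ₀) * (1 + ‖x‖) ^ (-1 - δ₀) := by
    filter_upwards [ae_comp_add_right hgd p] with x hx
    refine hx.trans ?_
    rw [show -1 - δ₀ = -(1 + δ₀) by ring]
    exact hpow (1 + δ₀) (by linarith) le_rfl x
  have hv₁ := contDiff_comp_add_right hu₁ p
  have hv₂ := contDiff_comp_add_right hu₂ p
  have hd₁ := hasCompactSupport_comp_add_right hc₁ p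
  have hd₂ := hasCompactSupport_comp_add_right hc₂ p
  have key := W.carleman_origin hE hδ hδ1 (by positivity) hV' hg' (hg.comp_add_right p) hVd' hgd'
    hh hh₀ hε hv₁ hd₁ hv₂ hd₂
  simp only [resSq_comp_add_right, gradSq_comp_add_right] at key
  rw [integral_add_right_eq_self (fun x => u₁ x ^ 2 + u₂ x ^ 2
    + 8 * h ^ 2 * (gradSq u₁ x + gradSq u₂ x)) p] at key
  have hms : MeasurableSet {x : Plane | 1 / 2 ≤ ‖x‖} :=
    measurableSet_le measurable_const measurable_norm
  have iR := integrable_mul_resSq hV E h ε (continuous_pow_weight (1 + δ)) hu₁ hc₁ hu₂ hc₂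
  have e1 : ∫ x, (1 + ‖x‖) ^ (1 + δ) * resSq V E h ε u₁ u₂ (x + p)
      ≤ 4 * ∫ x, (1 + ‖x‖) ^ (1 + δ) * resSq V E h ε u₁ u₂ x := by
    rw [← integral_add_right_eq_self (fun x => (1 + ‖x‖) ^ (1 + δ) * resSq V E h ε u₁ u₂ x) p,
      ← integral_const_mul]
    refine integral_mono_of_nonneg (Filter.Eventually.of_forall fun x =>
      mul_nonneg (by positivity) (resSq_nonneg _ _ _ _ _ _ _))
      ((iR.comp_add_right p).const_mul 4) (Filter.Eventually.of_forall fun x => ?_)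
    have h1 : (1 + ‖x‖) ^ (1 + δ) ≤ 4 * (1 + ‖x + p‖) ^ (1 + δ) := by
      have h2 := Real.rpow_le_rpow (by positivity) (one_add_norm_add_le hp x).1
        (by linarith : 0 ≤ 1 + δ)
      rw [Real.mul_rpow (by norm_num) (by positivity)] at h2
      refine h2.trans (mul_le_mul_of_nonneg_right ?_ (by positivity))
      calc (2 : ℝ) ^ (1 + δ) ≤ 2 ^ (2 : ℝ) :=
            Real.rpow_le_rpow_of_exponent_le (by norm_num) (by linarith)
        _ = 4 := by norm_num
    have := mul_le_mul_of_nonneg_right h1 (resSq_nonneg V E h ε u₁ u₂ (x + p))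
    simp only
    linarith
  have iL : IntegrableOn (fun x => W.lower h x * (u₁ (x + p) ^ 2 + u₂ (x + p) ^ 2))
      {x : Plane | 1 / 2 ≤ ‖x‖} := by
    refine (W.integrable_lower_mul h (puncturedTest_sub_cutoff (k := 4) (by norm_num) hv₁ hd₁)
      (puncturedTest_sub_cutoff (k := 4) (by norm_num) hv₂ hd₂)).integrableOn.congr_fun
      (fun x hx => ?_) hms
    have hx' : 1 / 2 ≤ ‖x‖ := hx
    have : cutoff 4 x = 0 := cutoff_eq_zero (by nlinarith)
    simp [this]
  have e2 : δ / 8 / (1 + 4 * Real.exp (2 * W.T)) * ∫ x in {x : Plane | 1 / 2 ≤ ‖x - p‖},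
          damping (Real.exp W.T + 1) (2 * (W.a * Real.exp W.T)) h x
            * ((1 + ‖x‖) ^ (-(1 + δ)) * (u₁ x ^ 2 + u₂ x ^ 2))
      ≤ ∫ x in {x : Plane | 1 / 2 ≤ ‖x‖}, W.lower h x * (u₁ (x + p) ^ 2 + u₂ (x + p) ^ 2) := by
    rw [← hmp.setIntegral_preimage_emb (MeasurableEquiv.addRight p).measurableEmbedding,
      ← integral_const_mul]
    have hs : (fun x => x + p) ⁻¹' {x : Plane | 1 / 2 ≤ ‖x - p‖} = {x : Plane | 1 / 2 ≤ ‖x‖} := by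
      ext x
      simp
    rw [hs]
    refine integral_mono_of_nonneg (Filter.Eventually.of_forall fun x => ?_) iL ?_
    · have := damping_pos (Real.exp W.T + 1) (2 * (W.a * Real.exp W.T)) h (x + p)
      simp only [Pi.zero_apply]
      positivity
    · filter_upwards [ae_restrict_mem hms] with x hx
      have h1 := W.lower_ge hδ hh hx
      have h2 := damping_add_le (R := Real.exp W.T) hC₁ hh hp x
      have h3 : (1 + ‖x + p‖) ^ (-(1 + δ)) ≤ 4 * (1 + ‖x‖) ^ (-(1 + δ)) := by
        refine (rpow_neg_le_of_le_two_mul (by positivity) (by positivity)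
          (one_add_norm_add_le hp x).1 (by linarith)).trans
          (mul_le_mul_of_nonneg_right ?_ (by positivity))
        calc (2 : ℝ) ^ (1 + δ) ≤ 2 ^ (2 : ℝ) :=
              Real.rpow_le_rpow_of_exponent_le (by norm_num) (by linarith)
          _ = 4 := by norm_num
      have h4 := mul_le_mul h2 h3 (by positivity)
        (damping_pos (Real.exp W.T) (2 * (W.a * Real.exp W.T)) h x).le
      have h5 := mul_le_mul_of_nonneg_left h4
        (by positivity : 0 ≤ δ / 8 / (1 + 4 * Real.exp (2 * W.T)))
      have h6 : δ / 8 / (1 + 4 * Real.exp (2 * W.T))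
          * (damping (Real.exp W.T + 1) (2 * (W.a * Real.exp W.T)) h (x + p)
            * (1 + ‖x + p‖) ^ (-(1 + δ))) ≤ W.lower h x := by
        refine h5.trans (le_trans (le_of_eq ?_) h1)
        ring
      have h7 := mul_le_mul_of_nonneg_right h6
        (by positivity : 0 ≤ u₁ (x + p) ^ 2 + u₂ (x + p) ^ 2)
      linarith
  have f1 := mul_le_mul_of_nonneg_left e1 (by positivity : 0 ≤ 8 / (δ * h ^ 2))
  have f2 := mul_le_mul_of_nonneg_left e2 (by positivity : 0 ≤ E / 2)
  have f3 : 8 / (δ * h ^ 2) * (4 * ∫ x, (1 + ‖x‖) ^ (1 + δ) * resSq V E h ε u₁ u₂ x)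
      = 32 / (δ * h ^ 2) * ∫ x, (1 + ‖x‖) ^ (1 + δ) * resSq V E h ε u₁ u₂ x := by ring
  rw [f3] at f1
  rw [mul_assoc]
  linarith

end CarlemanWeight

/-! ### The weighted estimate for test functions -/

/-- Green's first identity for test functions. -/
theorem integral_mul_lap {u v : Plane → ℝ} (hu : ContDiff ℝ ∞ u) (hv : ContDiff ℝ ∞ v)
    (hc : HasCompactSupport v) :
    ∫ x, u x * lap v x = -∫ x, (pd 0 u x * pd 0 v x + pd 1 u x * pd 1 v x) := by
  have hi : ∀ i, ∫ x, u x * pd i (pd i v) x = -∫ x, pd i u x * pd i v x := by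
    intro i
    have hv' := contDiff_pd i hv
    have h0 := integral_pd_eq_zero i (hu.mul hv') (hasCompactSupport_pd i hc).mul_left
    have h1 : ∀ x, pd i (fun y => u y * pd i v y) x
        = pd i u x * pd i v x + u x * pd i (pd i v) x := fun x =>
      pd_mul i (hu.differentiable (by simp) x) (hv'.differentiable (by simp) x)
    rw [funext h1, integral_add] at h0
    · linarith
    · exact ((contDiff_pd i hu).continuous.mul hv'.continuous).integrable_of_hasCompactSupport
        (hasCompactSupport_pd i hc).mul_left
    · exact (hu.continuous.mul (contDiff_pd i hv').continuous).integrable_of_hasCompactSupport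
        (hasCompactSupport_pd i (hasCompactSupport_pd i hc)).mul_left
  have j1 : ∀ i, Integrable fun x => u x * pd i (pd i v) x := fun i =>
    (hu.continuous.mul (contDiff_pd i (contDiff_pd i hv)).continuous).integrable_of_hasCompactSupport
        (hasCompactSupport_pd i (hasCompactSupport_pd i hc)).mul_left
  have j2 : ∀ i, Integrable fun x => pd i u x * pd i v x := fun i =>
    ((contDiff_pd i hu).continuous.mul (contDiff_pd i hv).continuous).integrable_of_hasCompactSupport
        (hasCompactSupport_pd i hc).mul_left
  simp only [lap, mul_add]
  rw [integral_add (j1 0) (j1 1), integral_add (j2 0) (j2 1), hi, hi]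
  ring

theorem integrable_mul_test {u v : Plane → ℝ} (hu : ContDiff ℝ ∞ u) (hv : ContDiff ℝ ∞ v)
    (hc : HasCompactSupport v) : Integrable fun x => u x * v x :=
  (hu.continuous.mul hv.continuous).integrable_of_hasCompactSupport hc.mul_left

theorem integrable_mul_schr {V : Plane → ℝ} (hV : MemLp V ⊤ volume) (E h : ℝ) {u v : Plane → ℝ}
    (hu : ContDiff ℝ ∞ u) (hv : ContDiff ℝ ∞ v) (hc : HasCompactSupport v) :
    Integrable fun x => u x * schr V E h v x := by
  have h1 := integrable_mul_test hu hv hc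
  have h2 := (integrable_mul_test hu (contDiff_lap hv) (hasCompactSupport_lap hc)).const_mul (-h ^ 2)
  refine ((h2.add (h1.mul_memLp_top hV)).sub (h1.const_mul E)).congr
    (Filter.Eventually.of_forall fun x => ?_)
  simp only [Pi.add_apply, Pi.sub_apply, schr]
  ring

theorem integral_mul_schr {V : Plane → ℝ} (hV : MemLp V ⊤ volume) (E h : ℝ) {u v : Plane → ℝ}
    (hu : ContDiff ℝ ∞ u) (hv : ContDiff ℝ ∞ v) (hc : HasCompactSupport v) :
    ∫ x, u x * schr V E h v x
      = h ^ 2 * (∫ x, (pd 0 u x * pd 0 v x + pd 1 u x * pd 1 v x))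
        + ∫ x, (V x - E) * (u x * v x) := by
  have h1 := integrable_mul_test hu hv hc
  have h2 := (integrable_mul_test hu (contDiff_lap hv) (hasCompactSupport_lap hc)).const_mul (-h ^ 2)
  have h3 : Integrable fun x => (V x - E) * (u x * v x) := by
    refine ((h1.mul_memLp_top hV).sub (h1.const_mul E)).congr
      (Filter.Eventually.of_forall fun x => ?_)
    simp only [Pi.sub_apply]
    ring
  have h4 : ∀ x, u x * schr V E h v x = -h ^ 2 * (u x * lap v x) + (V x - E) * (u x * v x) := by
    intro x
    rw [schr]
    ring
  rw [funext h4, integral_add h2 h3, integral_const_mul, integral_mul_lap hu hv hc]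
  ring

/-- The pairing of `(P - iε)u` with `u`: the imaginary part controls the mass and the real part
the kinetic energy. -/
theorem mass_energy_le {V : Plane → ℝ} (hV : MemLp V ⊤ volume) {M : ℝ} (hM : ∀ᵐ x, -M ≤ V x)
    {E h ε : ℝ} {u₁ u₂ q : Plane → ℝ}
    (hu₁ : ContDiff ℝ ∞ u₁) (hc₁ : HasCompactSupport u₁)
    (hu₂ : ContDiff ℝ ∞ u₂) (hc₂ : HasCompactSupport u₂) (hq : Integrable q)
    (hq₁ : ∀ x, (schr V E h u₁ x + ε * u₂ x) * u₂ x - (schr V E h u₂ x - ε * u₁ x) * u₁ x ≤ q x)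
    (hq₂ : ∀ x, (schr V E h u₁ x + ε * u₂ x) * u₁ x + (schr V E h u₂ x - ε * u₁ x) * u₂ x ≤ q x) :
    ε * (∫ x, (u₁ x ^ 2 + u₂ x ^ 2)) ≤ ∫ x, q x ∧
      h ^ 2 * (∫ x, (gradSq u₁ x + gradSq u₂ x))
        ≤ (∫ x, q x) + (M + E) * ∫ x, (u₁ x ^ 2 + u₂ x ^ 2) := by
  have i1 := integrable_sq hu₁ hc₁
  have i2 := integrable_sq hu₂ hc₂
  have s11 := integral_mul_schr hV E h hu₁ hu₁ hc₁
  have s12 := integral_mul_schr hV E h hu₁ hu₂ hc₂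
  have s21 := integral_mul_schr hV E h hu₂ hu₁ hc₁
  have s22 := integral_mul_schr hV E h hu₂ hu₂ hc₂
  have j11 := integrable_mul_schr hV E h hu₁ hu₁ hc₁
  have j12 := integrable_mul_schr hV E h hu₁ hu₂ hc₂
  have j21 := integrable_mul_schr hV E h hu₂ hu₁ hc₁
  have j22 := integrable_mul_schr hV E h hu₂ hu₂ hc₂
  -- Symmetry of P removes it from the imaginary part of the pairing, where only ε times the mass is
  -- left.
  have hsym : ∫ x, u₁ x * schr V E h u₂ x = ∫ x, u₂ x * schr V E h u₁ x := by
    rw [s12, s21]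
    congr 1
    · congr 1
      exact integral_congr_ae (Filter.Eventually.of_forall fun x => by simp only; ring)
    · exact integral_congr_ae (Filter.Eventually.of_forall fun x => by simp only; ring)
  constructor
  · have e : ∫ x, (u₂ x * schr V E h u₁ x - u₁ x * schr V E h u₂ x
        + ε * (u₁ x ^ 2 + u₂ x ^ 2)) = ε * (∫ x, (u₁ x ^ 2 + u₂ x ^ 2)) := by
      have i3 : Integrable fun x => u₁ x ^ 2 + u₂ x ^ 2 := i1.add i2
      have j3 : Integrable fun x => u₂ x * schr V E h u₁ x - u₁ x * schr V E h u₂ x := j21.sub j12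
      rw [integral_add j3 (i3.const_mul ε), integral_sub j21 j12,
        integral_const_mul, hsym, sub_self, zero_add]
    rw [← e]
    refine integral_mono ((j21.sub j12).add ((i1.add i2).const_mul ε)) hq fun x => ?_
    refine le_trans (le_of_eq ?_) (hq₁ x)
    simp only
    ring
  · have g1 : ∀ u : Plane → ℝ, ContDiff ℝ ∞ u → HasCompactSupport u →
        h ^ 2 * (∫ x, gradSq u x) ≤ (∫ x, u x * schr V E h u x) + (M + E) * ∫ x, u x ^ 2 := by
      intro u hu hc
      rw [integral_mul_schr hV E h hu hu hc]
      have i := integrable_sq hu hc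
      have hn : 0 ≤ ∫ x, (V x + M) * u x ^ 2 := by
        refine integral_nonneg_of_ae ?_
        filter_upwards [hM] with x hx
        simp only [Pi.zero_apply]
        exact mul_nonneg (by linarith) (sq_nonneg _)
      have e1 : ∫ x, (V x + M) * u x ^ 2 = (∫ x, (V x - E) * (u x * u x))
          + (M + E) * ∫ x, u x ^ 2 := by
        rw [← integral_const_mul, ← integral_add]
        · exact integral_congr_ae (Filter.Eventually.of_forall fun x => by simp only; ring)
        · refine ((i.mul_memLp_top hV).sub (i.const_mul E)).congr
            (Filter.Eventually.of_forall fun x => ?_)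
          simp only [Pi.sub_apply]
          ring
        · exact i.const_mul _
      have e2 : ∫ x, gradSq u x = ∫ x, (pd 0 u x * pd 0 u x + pd 1 u x * pd 1 u x) :=
        integral_congr_ae (Filter.Eventually.of_forall fun x => by simp only [gradSq]; ring)
      rw [e2]
      linarith
    have k1 := g1 u₁ hu₁ hc₁
    have k2 := g1 u₂ hu₂ hc₂
    rw [integral_add (integrable_gradSq hu₁ hc₁) (integrable_gradSq hu₂ hc₂), integral_add i1 i2]
    have e : (∫ x, u₁ x * schr V E h u₁ x) + ∫ x, u₂ x * schr V E h u₂ x ≤ ∫ x, q x := by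
      rw [← integral_add j11 j22]
      refine integral_mono (j11.add j22) hq fun x => ?_
      refine le_trans (le_of_eq ?_) (hq₂ x)
      simp only
      ring
    linarith

/-- Young's inequality with reciprocal weights, to be applied pointwise with a proportional to the
weight on the left side of the final estimate. -/
theorem pairing_le {a b x₁ x₂ f₁ f₂ : ℝ} (ha : 0 < a) (hab : a * b = 1) :
    f₁ * x₂ - f₂ * x₁ ≤ a / 2 * (x₁ ^ 2 + x₂ ^ 2) + b / 2 * (f₁ ^ 2 + f₂ ^ 2) ∧
      f₁ * x₁ + f₂ * x₂ ≤ a / 2 * (x₁ ^ 2 + x₂ ^ 2) + b / 2 * (f₁ ^ 2 + f₂ ^ 2) := by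
  have key : ∀ x y : ℝ, x * y ≤ a / 2 * y ^ 2 + b / 2 * x ^ 2 := by
    intro x y
    have hb : b = 1 / a := by
      field_simp
      linarith
    have h : a / 2 * y ^ 2 + b / 2 * x ^ 2 - x * y = (a * y - x) ^ 2 / (2 * a) := by
      rw [hb]
      field_simp
      ring
    have : 0 ≤ (a * y - x) ^ 2 / (2 * a) := by positivity
    linarith
  have h1 := key f₁ x₂
  have h2 := key (-f₂) x₁
  have h3 := key f₁ x₁
  have h4 := key f₂ x₂
  constructor <;> nlinarith

theorem exists_neg_le_of_memLp_top {V : Plane → ℝ} (hV : MemLp V ⊤ volume) :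
    ∃ M : ℝ, 0 ≤ M ∧ ∀ᵐ x, -M ≤ V x := by
  refine ⟨(eLpNormEssSup V volume).toReal, ENNReal.toReal_nonneg, ?_⟩
  have hfin : eLpNormEssSup V volume ≠ ⊤ := by
    have := hV.2
    rw [eLpNorm_exponent_top] at this
    exact this.ne
  filter_upwards [ae_le_eLpNormEssSup (f := V) (μ := (volume : Measure Plane))] with x hx
  have h1 := ENNReal.toReal_mono hfin hx
  rw [toReal_enorm, Real.norm_eq_abs] at h1
  linarith [neg_abs_le (V x)]

/-- Two translated Carleman estimates are added, and their common ε-term is bounded by the pairing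
of (P - iε)u with u. That pairing is split by Young's inequality: the part containing u is small
enough to be absorbed, and the remaining part has the same 1/h² as the Carleman term. -/
theorem exists_testFunction_bound {E : ℝ} (hE : 0 < E) {V : Plane → ℝ} (hV : MemLp V ⊤ volume)
    {g : Plane → Plane} (hg : IsWeakGradient V g) (hgm : MemLp g ⊤ volume) {δ₀ c : ℝ}
    (hδ₀ : 0 < δ₀) (hc : 0 < c) (hVd : ∀ᵐ x, V x ≤ c * (1 + ‖x‖) ^ (-δ₀))
    (hgd : ∀ᵐ x, ‖g x‖ ≤ c * (1 + ‖x‖) ^ (-1 - δ₀)) {δ : ℝ} (hδ : 0 < δ) (hδ1 : δ ≤ 1)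
    (hδδ : δ ≤ δ₀) :
    ∃ K R C h₀ : ℝ, 0 < K ∧ 0 < R ∧ 0 ≤ C ∧ 0 < h₀ ∧ ∀ h ε : ℝ, 0 < h → h ≤ h₀ → 0 < ε → ε ≤ 1 →
      ∀ u₁ u₂ : Plane → ℝ, ContDiff ℝ ∞ u₁ → HasCompactSupport u₁ → ContDiff ℝ ∞ u₂ →
        HasCompactSupport u₂ →
        ∫ x, damping R C h x * ((1 + ‖x‖) ^ (-(1 + δ)) * (u₁ x ^ 2 + u₂ x ^ 2))
          ≤ K / h ^ 2 * ∫ x, (damping R C h x)⁻¹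
            * ((1 + ‖x‖) ^ (1 + δ) * resSq V E h ε u₁ u₂ x) := by
  obtain ⟨W⟩ := exists_carlemanWeight (c := c * 2 ^ (1 + δ₀)) hE (by positivity) hδ₀ hδ hδ1 hδδ
  obtain ⟨M, hM0, hM⟩ := exists_neg_le_of_memLp_top hV
  set R := Real.exp W.T + 1 with hR
  set C := 2 * (W.a * Real.exp W.T) with hC
  have hC0 : 0 ≤ C := by
    have := W.a_nonneg
    positivity
  set A := E / 2 * (δ / 8 / (1 + 4 * Real.exp (2 * W.T))) with hA
  have hA0 : 0 < A := by positivity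
  -- One ∫q comes from the mass, and 8(1 + M + E) of them come from the kinetic term 8h²|∇u|²; ε ≤ 1
  -- is used for the latter.
  set B := 9 + 8 * (M + E) with hB
  have hB0 : 0 < B := by positivity
  refine ⟨2 / A * (64 / δ + 2 * B ^ 2 / A), R, C, W.h₀, by positivity, by positivity, hC0,
    W.h₀_pos, ?_⟩
  intro h ε hh hh₀ hε hε1 u₁ u₂ hu₁ hc₁ hu₂ hc₂
  set F : Plane → ℝ := fun x => damping R C h x * ((1 + ‖x‖) ^ (-(1 + δ)) * (u₁ x ^ 2 + u₂ x ^ 2))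
    with hF
  set Y : Plane → ℝ := fun x => (1 + ‖x‖) ^ (1 + δ) * resSq V E h ε u₁ u₂ x with hY
  set Z : Plane → ℝ := fun x => (damping R C h x)⁻¹ * Y x with hZ
  have hd0 := damping_pos R C h
  have hd1 := fun x => damping_le_one (R := R) hC0 hh x
  have hF0 : ∀ x, 0 ≤ F x := fun x => by
    have := hd0 x
    simp only [hF]
    positivity
  have hY0 : ∀ x, 0 ≤ Y x := fun x => mul_nonneg (by positivity) (resSq_nonneg _ _ _ _ _ _ _)
  have iF : Integrable F := by
    have h1 : Integrable fun x : Plane => (1 + ‖x‖) ^ (-(1 + δ)) * (u₁ x ^ 2 + u₂ x ^ 2) := by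
      refine ((continuous_pow_weight (-(1 + δ))).mul ((hu₁.continuous.mul hu₁.continuous).add
        (hu₂.continuous.mul hu₂.continuous))).integrable_of_hasCompactSupport
        (HasCompactSupport.mul_left ((hc₁.mul_left).add (hc₂.mul_left))) |>.congr
        (Filter.Eventually.of_forall fun x => ?_)
      simp only [sq, Pi.mul_apply, Pi.add_apply]
    refine h1.bdd_mul (c := 1) (measurable_damping R C h).aestronglyMeasurable
      (Filter.Eventually.of_forall fun x => ?_)
    rw [Real.norm_of_nonneg (hd0 x).le]
    exact hd1 x
  have iY : Integrable Y :=
    integrable_mul_resSq hV E h ε (continuous_pow_weight (1 + δ)) hu₁ hc₁ hu₂ hc₂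
  have iZ : Integrable Z := by
    refine iY.bdd_mul (c := (Real.exp (-(C / h)))⁻¹)
      (measurable_damping R C h).inv.aestronglyMeasurable
      (Filter.Eventually.of_forall fun x => ?_)
    rw [Real.norm_of_nonneg (inv_pos.mpr (hd0 x)).le]
    exact inv_anti₀ (Real.exp_pos _) (exp_le_damping hC0 hh x)
  have hYZ : ∫ x, Y x ≤ ∫ x, Z x :=
    integral_mono iY iZ fun x =>
      le_mul_of_one_le_left (hY0 x) ((one_le_inv₀ (hd0 x)).mpr (hd1 x))
  -- Chosen so that the ε-terms of both estimates together, 2(B/h)∫q, contain exactly (A/2)∫F, half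
  -- of the left side. The factor h in `q` offsets the 1/h.
  set θ := A / (2 * B) with hθ
  have hθ0 : 0 < θ := by positivity
  set q : Plane → ℝ := fun x => h * θ / 2 * F x + 1 / (2 * θ * h) * Z x with hq
  have iq : Integrable q := (iF.const_mul _).add (iZ.const_mul _)
  have hpair : ∀ x, (schr V E h u₁ x + ε * u₂ x) * u₂ x - (schr V E h u₂ x - ε * u₁ x) * u₁ x ≤ q x
      ∧ (schr V E h u₁ x + ε * u₂ x) * u₁ x + (schr V E h u₂ x - ε * u₁ x) * u₂ x ≤ q x := by
    intro x
    have hd := hd0 x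
    have hp : (1 + ‖x‖) ^ (-(1 + δ)) * (1 + ‖x‖) ^ (1 + δ) = 1 := by
      rw [← Real.rpow_add (by positivity), neg_add_cancel, Real.rpow_zero]
    have hab : (h * θ * (damping R C h x * (1 + ‖x‖) ^ (-(1 + δ))))
        * (1 / (θ * h) * ((damping R C h x)⁻¹ * (1 + ‖x‖) ^ (1 + δ))) = 1 := by
      calc _ = (damping R C h x * (damping R C h x)⁻¹) * ((h * θ) * (1 / (θ * h)))
            * ((1 + ‖x‖) ^ (-(1 + δ)) * (1 + ‖x‖) ^ (1 + δ)) := by ring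
        _ = 1 := by
          rw [hp, mul_inv_cancel₀ hd.ne', mul_one_div, mul_comm h θ, div_self (by positivity)]
          norm_num
    have := pairing_le (x₁ := u₁ x) (x₂ := u₂ x) (f₁ := schr V E h u₁ x + ε * u₂ x)
      (f₂ := schr V E h u₂ x - ε * u₁ x) (by positivity) hab
    have e : q x = h * θ * (damping R C h x * (1 + ‖x‖) ^ (-(1 + δ))) / 2 * (u₁ x ^ 2 + u₂ x ^ 2)
        + 1 / (θ * h) * ((damping R C h x)⁻¹ * (1 + ‖x‖) ^ (1 + δ)) / 2
          * ((schr V E h u₁ x + ε * u₂ x) ^ 2 + (schr V E h u₂ x - ε * u₁ x) ^ 2) := by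
      simp only [hq, hF, hZ, hY, resSq]
      rw [show 1 / (2 * θ * h) = 1 / (θ * h) / 2 by field_simp]
      ring
    rw [e]
    exact this
  obtain ⟨m1, m2⟩ := mass_energy_le hV hM hu₁ hc₁ hu₂ hc₂ iq (fun x => (hpair x).1)
    fun x => (hpair x).2
  have hQ : ∫ x, q x = h * θ / 2 * (∫ x, F x) + 1 / (2 * θ * h) * ∫ x, Z x := by
    rw [hq, integral_add (iF.const_mul _) (iZ.const_mul _), integral_const_mul, integral_const_mul]
  have iN : Integrable fun x => u₁ x ^ 2 + u₂ x ^ 2 :=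
    (integrable_sq hu₁ hc₁).add (integrable_sq hu₂ hc₂)
  have iG : Integrable fun x => gradSq u₁ x + gradSq u₂ x :=
    (integrable_gradSq hu₁ hc₁).add (integrable_gradSq hu₂ hc₂)
  have hQ0 : 0 ≤ ∫ x, q x := by
    refine le_trans ?_ m1
    exact mul_nonneg hε.le (integral_nonneg fun x => by positivity)
  have hT : ε * ∫ x, (u₁ x ^ 2 + u₂ x ^ 2 + 8 * h ^ 2 * (gradSq u₁ x + gradSq u₂ x))
      ≤ B * ∫ x, q x := by
    rw [integral_add iN (iG.const_mul _), integral_const_mul]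
    have k1 := mul_le_mul_of_nonneg_left m2 hε.le
    have k2 := mul_le_mul_of_nonneg_left m1 (by positivity : 0 ≤ M + E)
    have k3 := mul_le_mul_of_nonneg_right hε1 hQ0
    rw [hB]
    nlinarith
  have hcar : ∀ p : Plane, ‖p‖ ≤ 1 → A * ∫ x in {x : Plane | 1 / 2 ≤ ‖x - p‖}, F x
      ≤ 32 / (δ * h ^ 2) * (∫ x, Y x) + ε / h * ∫ x, (u₁ x ^ 2 + u₂ x ^ 2
        + 8 * h ^ 2 * (gradSq u₁ x + gradSq u₂ x)) := fun p hp =>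
    W.carleman_translate hE hδ₀ hδ hδ1 hc hV hgm hg hVd hgd hh hh₀ hε.le hu₁ hc₁ hu₂ hc₂ hp
  -- The centres 0 and `basisVec 0` are at distance one, so every point is at distance at least 1/2
  -- from one of them.
  have p0 := hcar 0 (by simp)
  have p1 := hcar (basisVec 0) (by simp [basisVec])
  have hcov : ∫ x, F x ≤ (∫ x in {x : Plane | 1 / 2 ≤ ‖x - 0‖}, F x)
      + ∫ x in {x : Plane | 1 / 2 ≤ ‖x - basisVec 0‖}, F x := by
    have hms : ∀ p : Plane, MeasurableSet {x : Plane | 1 / 2 ≤ ‖x - p‖} := fun p =>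
      measurableSet_le measurable_const (by fun_prop)
    rw [← integral_indicator (hms _), ← integral_indicator (hms _),
      ← integral_add (iF.indicator (hms _)) (iF.indicator (hms _))]
    refine integral_mono iF ((iF.indicator (hms _)).add (iF.indicator (hms _))) fun x => ?_
    have hn : ∀ p : Plane, 0 ≤ {x : Plane | 1 / 2 ≤ ‖x - p‖}.indicator F x := fun p =>
      Set.indicator_nonneg (fun x _ => hF0 x) x
    by_cases hx : x ∈ {x : Plane | 1 / 2 ≤ ‖x - 0‖}
    · have := hn (basisVec 0)
      simp only
      rw [Set.indicator_of_mem hx]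
      linarith
    · have hx2 : x ∈ {x : Plane | 1 / 2 ≤ ‖x - basisVec 0‖} := by
        simp only [Set.mem_ofPred_eq, sub_zero, not_le] at hx ⊢
        have h1 : ‖basisVec 0‖ = 1 := by simp [basisVec]
        have h2 := norm_sub_norm_le (basisVec 0) x
        rw [norm_sub_rev] at h2
        linarith
      have := hn 0
      simp only
      rw [Set.indicator_of_mem hx2]
      linarith
  have r1 := mul_le_mul_of_nonneg_left hcov hA0.le
  have r2 : ε / h * ∫ x, (u₁ x ^ 2 + u₂ x ^ 2 + 8 * h ^ 2 * (gradSq u₁ x + gradSq u₂ x))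
      ≤ B / h * ∫ x, q x := by
    have := mul_le_mul_of_nonneg_left hT (by positivity : 0 ≤ 1 / h)
    calc _ = 1 / h * (ε * ∫ x, (u₁ x ^ 2 + u₂ x ^ 2
          + 8 * h ^ 2 * (gradSq u₁ x + gradSq u₂ x))) := by ring
      _ ≤ _ := this
      _ = _ := by ring
  have r3 := mul_le_mul_of_nonneg_left hYZ (by positivity : 0 ≤ 32 / (δ * h ^ 2))
  have r4 : A * ∫ x, F x ≤ 64 / (δ * h ^ 2) * (∫ x, Z x) + 2 * (B / h * ∫ x, q x) := by
    have t1 : 64 / (δ * h ^ 2) * (∫ x, Z x) = 2 * (32 / (δ * h ^ 2) * ∫ x, Z x) := by ring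
    rw [t1]
    linarith
  have r5 : 2 * (B / h * ∫ x, q x) = A / 2 * (∫ x, F x) + 2 * B ^ 2 / (A * h ^ 2) * ∫ x, Z x := by
    rw [hQ, hθ]
    field_simp
  have r6 : A / 2 * ∫ x, F x ≤ 64 / (δ * h ^ 2) * (∫ x, Z x)
      + 2 * B ^ 2 / (A * h ^ 2) * ∫ x, Z x := by
    rw [r5] at r4
    linarith
  have r7 := mul_le_mul_of_nonneg_left r6 (by positivity : 0 ≤ 2 / A)
  calc ∫ x, F x = 2 / A * (A / 2 * ∫ x, F x) := by field_simp
    _ ≤ _ := r7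
    _ = _ := by
      field_simp

/-! ### Multiplication operators -/

theorem coeFn_mulOp (f : Plane → ℝ) (hf : MemLp f ⊤ volume) (u : L2) :
    mulOp f hf u =ᵐ[volume] fun x => (f x : ℂ) * u x := by
  have h := (ContinuousLinearMap.mul ℂ ℂ).coeFn_holder (r := 2)
    (MemLp.toLp (fun x => (f x : ℂ)) hf.ofReal) u
  have h2 := MemLp.coeFn_toLp (f := fun x => (f x : ℂ)) hf.ofReal
  change (ContinuousLinearMap.mul ℂ ℂ).holder 2 (MemLp.toLp (fun x => (f x : ℂ)) hf.ofReal) u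
    =ᵐ[volume] _
  filter_upwards [h, h2] with x hx hx2
  rw [hx, hx2]
  rfl

theorem norm_mulOp_le {f g : Plane → ℝ} (hf : MemLp f ⊤ volume) (hg : MemLp g ⊤ volume) {a : ℝ}
    (ha : 0 ≤ a) (hfg : ∀ x, |f x| ≤ a * |g x|) (u : L2) :
    ‖mulOp f hf u‖ ≤ a * ‖mulOp g hg u‖ := by
  refine Lp.norm_le_mul_norm_of_ae_le_mul ?_
  filter_upwards [coeFn_mulOp f hf u, coeFn_mulOp g hg u] with x h1 h2
  rw [h1, h2, norm_mul, norm_mul, Complex.norm_real, Complex.norm_real, ← mul_assoc]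
  exact mul_le_mul_of_nonneg_right (hfg x) (norm_nonneg _)

theorem norm_mulOp_le_norm {f : Plane → ℝ} (hf : MemLp f ⊤ volume) {a : ℝ}
    (hfa : ∀ x, |f x| ≤ a) (u : L2) : ‖mulOp f hf u‖ ≤ a * ‖u‖ := by
  refine Lp.norm_le_mul_norm_of_ae_le_mul ?_
  filter_upwards [coeFn_mulOp f hf u] with x h1
  rw [h1, norm_mul, Complex.norm_real]
  exact mul_le_mul_of_nonneg_right (hfa x) (norm_nonneg _)

theorem mulOp_mulOp {f g k : Plane → ℝ} (hf : MemLp f ⊤ volume) (hg : MemLp g ⊤ volume)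
    (hk : MemLp k ⊤ volume) (hfg : ∀ x, f x * g x = k x) (u : L2) :
    mulOp f hf (mulOp g hg u) = mulOp k hk u := by
  refine Lp.ext ?_
  filter_upwards [coeFn_mulOp f hf (mulOp g hg u), coeFn_mulOp g hg u, coeFn_mulOp k hk u]
    with x h1 h2 h3
  rw [h1, h2, h3, ← hfg x, Complex.ofReal_mul, mul_assoc]

theorem mulOp_add {f g k : Plane → ℝ} (hf : MemLp f ⊤ volume) (hg : MemLp g ⊤ volume)
    (hk : MemLp k ⊤ volume) (hfg : ∀ x, f x + g x = k x) (u : L2) :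
    mulOp f hf u + mulOp g hg u = mulOp k hk u := by
  refine Lp.ext ?_
  filter_upwards [Lp.coeFn_add (mulOp f hf u) (mulOp g hg u), coeFn_mulOp f hf u,
    coeFn_mulOp g hg u, coeFn_mulOp k hk u] with x h0 h1 h2 h3
  rw [h0, Pi.add_apply, h1, h2, h3, ← hfg x, Complex.ofReal_add, add_mul]

theorem inner_mulOp_left (f : Plane → ℝ) (hf : MemLp f ⊤ volume) (u v : L2) :
    inner ℂ (mulOp f hf u) v = inner ℂ u (mulOp f hf v) := by
  rw [L2.inner_def, L2.inner_def]
  refine integral_congr_ae ?_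
  filter_upwards [coeFn_mulOp f hf u, coeFn_mulOp f hf v] with x h1 h2
  rw [h1, h2]
  simp only [RCLike.inner_apply, map_mul, Complex.conj_ofReal]
  ring

/-! ### The Laplacian on `H²` -/

/-- `v` represents the distributional Laplacian of `u`. -/
def IsLaplacian (u v : L2) : Prop := Δ (u : 𝓢'(Plane, ℂ)) = (v : 𝓢'(Plane, ℂ))

theorem isLaplacian_iff {u v : L2} :
    IsLaplacian u v ↔ ∀ φ : 𝓢(Plane, ℂ), ∫ x, Δ φ x * u x = ∫ x, φ x * v x := by
  constructor
  · intro h φ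
    have := congrArg (fun T : 𝓢'(Plane, ℂ) => T φ) h
    simpa [laplacian_apply_apply, Lp.toTemperedDistribution_apply] using this
  · intro h
    ext φ
    rw [laplacian_apply_apply, Lp.toTemperedDistribution_apply, Lp.toTemperedDistribution_apply]
    simpa using h φ

theorem isLaplacian_laplacianL2 (u : H2) : IsLaplacian u (laplacianL2 u) :=
  (exists_laplacian u).choose_spec.symm

theorem IsLaplacian.unique {u v w : L2} (hv : IsLaplacian u v) (hw : IsLaplacian u w) : v = w :=
  toTemperedDistribution_injective (hv.symm.trans hw)

theorem isLaplacian_toLp (φ : 𝓢(Plane, ℂ)) : IsLaplacian (φ.toLp 2) ((Δ φ).toLp 2) := by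
  rw [IsLaplacian, Lp.toTemperedDistribution_toLp_eq, Lp.toTemperedDistribution_toLp_eq,
    laplacian_toTemperedDistributionCLM_eq]

/-- For each fixed Schwartz function the defining equation is continuous in the pair of L²
functions, so the graph is an intersection of closed sets. -/
theorem isClosed_isLaplacian : IsClosed {p : L2 × L2 | IsLaplacian p.1 p.2} := by
  have h : {p : L2 × L2 | IsLaplacian p.1 p.2} = ⋂ φ : 𝓢(Plane, ℂ),
      {p : L2 × L2 | Lp.toTemperedDistributionCLM ℂ volume 2 p.1 (Δ φ)
        = Lp.toTemperedDistributionCLM ℂ volume 2 p.2 φ} := by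
    ext p
    simp [isLaplacian_iff]
  rw [h]
  refine isClosed_iInter fun φ => isClosed_eq ?_ ?_
  · exact (PointwiseConvergenceCLM.evalCLM (RingHom.id ℂ) ℂ (Δ φ)).continuous.comp
      ((Lp.toTemperedDistributionCLM ℂ volume 2).continuous.comp continuous_fst)
  · exact (PointwiseConvergenceCLM.evalCLM (RingHom.id ℂ) ℂ φ).continuous.comp
      ((Lp.toTemperedDistributionCLM ℂ volume 2).continuous.comp continuous_snd)

/-- The Fourier transform has kernel e^{-2πi x·ξ}, so Δ has symbol -(2π)²|ξ|². This explains the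
constant that accompanies Δ below. -/
theorem besselPotential_two_apply (f : 𝓢'(Plane, ℂ)) :
    besselPotential Plane ℂ 2 f = f - ((2 * Real.pi) ^ 2)⁻¹ • Δ f := by
  have h1 : (fun x : Plane => (((1 + ‖x‖ ^ 2) ^ ((2 : ℝ) / 2) : ℝ) : ℂ))
      = (fun _ => (1 : ℂ)) + fun x => Complex.ofReal (‖x‖ ^ 2) := by
    ext x
    simp
  have h2 : fourierMultiplierCLM ℂ ((fun _ : Plane => (1 : ℂ)) + fun x => Complex.ofReal (‖x‖ ^ 2)) f
      = f + fourierMultiplierCLM ℂ (fun x : Plane => Complex.ofReal (‖x‖ ^ 2)) f := by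
    rw [fourierMultiplierCLM_apply, smulLeftCLM_add (by fun_prop) (by fun_prop)]
    simp [FourierTransform.fourierInv_add, fourierMultiplierCLM_apply]
  rw [besselPotential, h1, h2, laplacian_eq_fourierMultiplierCLM, smul_smul,
    mul_neg, inv_mul_cancel₀ (by positivity)]
  simp

/-- Elliptic regularity: for u to lie in H² it is enough that u and its distributional Laplacian lie
in L², since then the Bessel potential of order 2 maps u into L². -/
theorem IsLaplacian.mem_H2 {u v : L2} (h : IsLaplacian u v) : u ∈ H2 := by
  refine ⟨u - ((2 * Real.pi) ^ 2)⁻¹ • v, ?_⟩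
  rw [besselPotential_two_apply, h]
  simp only [← Lp.toTemperedDistributionCLM_apply, map_sub, ContinuousLinearMap.map_smul_of_tower]

theorem IsLaplacian.laplacianL2_eq {u v : L2} (h : IsLaplacian u v) :
    laplacianL2 ⟨u, h.mem_H2⟩ = v :=
  (isLaplacian_laplacianL2 ⟨u, h.mem_H2⟩).unique h

theorem IsLaplacian.sub {u v u' v' : L2} (h : IsLaplacian u v) (h' : IsLaplacian u' v') :
    IsLaplacian (u - u') (v - v') := by
  have := congrArg₂ (· - ·) h h'
  simp only [← Lp.toTemperedDistributionCLM_apply, ← laplacianCLM_apply, ← map_sub] at this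
  rw [IsLaplacian]
  simpa only [← Lp.toTemperedDistributionCLM_apply, ← laplacianCLM_apply] using this

/-- The elliptic estimate `‖u‖ ≤ ‖(1 - (2π)⁻² Δ) u‖`. -/
theorem IsLaplacian.norm_le {u v : L2} (h : IsLaplacian u v) :
    ‖u‖ ≤ ‖u - ((2 * Real.pi) ^ 2)⁻¹ • v‖ := by
  set w := u - ((2 * Real.pi) ^ 2)⁻¹ • v with hw
  have hb : besselPotential Plane ℂ 2 u = (w : 𝓢'(Plane, ℂ)) := by
    rw [besselPotential_two_apply, h, hw]
    simp only [← Lp.toTemperedDistributionCLM_apply, map_sub,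
      ContinuousLinearMap.map_smul_of_tower]
  -- On the Fourier side u is w multiplied by (1+|ξ|²)⁻¹, a factor bounded by one; Plancherel
  -- finishes.
  have hb' := (besselPotential_neg_apply_eq_iff 2 (w : 𝓢'(Plane, ℂ)) u).mpr hb
  have hF := congrArg FourierTransform.fourier hb'
  rw [fourier_besselPotential_eq_smulLeftCLM_fourier_apply, Lp.fourier_toTemperedDistribution_eq,
    Lp.fourier_toTemperedDistribution_eq] at hF
  have hbound : ∀ x : Plane, ‖(((1 + ‖x‖ ^ 2) ^ (-2 / 2 : ℝ) : ℝ) : ℂ)‖ ≤ 1 := by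
    intro x
    rw [Complex.norm_real, Real.norm_of_nonneg (by positivity)]
    exact Real.rpow_le_one_of_one_le_of_nonpos (by simp) (by norm_num)
  have htg : (fun x : Plane => (((1 + ‖x‖ ^ 2) ^ (-2 / 2 : ℝ) : ℝ) : ℂ)).HasTemperateGrowth := by
    fun_prop
  have hmem : MemLp (fun x : Plane => (((1 + ‖x‖ ^ 2) ^ (-2 / 2 : ℝ) : ℝ) : ℂ)) ⊤ volume :=
    memLp_top_of_bound htg.1.continuous.aestronglyMeasurable 1 (Filter.Eventually.of_forall hbound)
  rw [← Lp.toTemperedDistribution_smul_eq (p := ⊤) (q := 2) (r := 2) htg hmem] at hF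
  have hu := toTemperedDistribution_injective hF
  rw [← Lp.norm_fourier_eq u, ← hu, ← Lp.norm_fourier_eq w, ← one_mul ‖FourierTransform.fourier w‖]
  refine Lp.norm_le_mul_norm_of_ae_le_mul ?_
  filter_upwards [Lp.coeFn_lpSMul (r := 2) (hmem.toLp _) (FourierTransform.fourier w : L2),
    hmem.coeFn_toLp] with x h1 h2
  rw [h1, Pi.smul_apply', h2, norm_smul]
  exact mul_le_mul_of_nonneg_right (hbound x) (norm_nonneg _)

/-- Schwartz functions are dense in `H²` for the graph norm of the Laplacian. -/
theorem exists_schwartz_tendsto (u : H2) : ∃ φ : ℕ → 𝓢(Plane, ℂ),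
    Filter.Tendsto (fun n => (φ n).toLp 2) Filter.atTop (nhds (u : L2)) ∧
      Filter.Tendsto (fun n => (Δ (φ n)).toLp 2) Filter.atTop (nhds (laplacianL2 u)) := by
  set a : ℝ := ((2 * Real.pi) ^ 2)⁻¹ with ha
  have ha0 : 0 < a := by positivity
  set g : L2 := (u : L2) - a • laplacianL2 u with hg
  have hd := SchwartzMap.denseRange_toLpCLM (E := Plane) (F := ℂ) (p := 2) (by simp)
    (μ := (volume : Measure Plane))
  obtain ⟨s, hs, hlim⟩ := mem_closure_iff_seq_limit.mp (hd g)
  choose ψ hψ using hs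
  -- The function (1 - aΔ)u is approximated in L² by Schwartz functions ψ, and (1 - aΔ)⁻¹ preserves
  -- the Schwartz space. Convergence of φ follows from the elliptic estimate, and that of Δφ by
  -- solving φ - aΔφ = s for Δφ.
  set φ : ℕ → 𝓢(Plane, ℂ) := fun n =>
    SchwartzMap.fourierMultiplierCLM ℂ (fun x : Plane => (((1 + ‖x‖ ^ 2) ^ (-2 / 2 : ℝ) : ℝ) : ℂ)) (ψ n)
    with hφ
  have hφψ : ∀ n, ((φ n).toLp 2 : L2) - a • ((Δ (φ n)).toLp 2 : L2) = s n := by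
    intro n
    apply toTemperedDistribution_injective
    have h1 : besselPotential Plane ℂ (-2) (ψ n : 𝓢'(Plane, ℂ)) = (φ n : 𝓢'(Plane, ℂ)) := by
      rw [besselPotential, fourierMultiplierCLM_toTemperedDistributionCLM_eq (by fun_prop)]
    rw [besselPotential_neg_apply_eq_iff, besselPotential_two_apply] at h1
    rw [← hψ n, SchwartzMap.toLpCLM_apply, Lp.toTemperedDistribution_toLp_eq, ← h1,
      laplacian_toTemperedDistributionCLM_eq, ← Lp.toTemperedDistribution_toLp_eq (p := 2),
      ← Lp.toTemperedDistribution_toLp_eq (p := 2)]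
    simp only [← Lp.toTemperedDistributionCLM_apply, map_sub,
      ContinuousLinearMap.map_smul_of_tower, ha]
  have hle : ∀ n, ‖((φ n).toLp 2 : L2) - (u : L2)‖ ≤ ‖s n - g‖ := by
    intro n
    refine ((isLaplacian_toLp (φ n)).sub (isLaplacian_laplacianL2 u)).norm_le.trans (le_of_eq ?_)
    rw [← hφψ n, hg, ← ha, smul_sub]
    congr 1
    abel
  have hlim' := tendsto_iff_norm_sub_tendsto_zero.mp hlim
  have l1 : Filter.Tendsto (fun n => (φ n).toLp 2) Filter.atTop (nhds (u : L2)) :=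
    tendsto_iff_norm_sub_tendsto_zero.mpr
      (squeeze_zero (fun n => norm_nonneg _) hle hlim')
  refine ⟨φ, l1, ?_⟩
  have e1 : (fun n => ((Δ (φ n)).toLp 2 : L2)) = fun n => a⁻¹ • (((φ n).toLp 2 : L2) - s n) := by
    ext1 n
    rw [← hφψ n, sub_sub_cancel, smul_smul, inv_mul_cancel₀ ha0.ne', one_smul]
  have e2 : laplacianL2 u = a⁻¹ • ((u : L2) - g) := by
    rw [hg, sub_sub_cancel, smul_smul, inv_mul_cancel₀ ha0.ne', one_smul]
  rw [e1, e2]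
  exact (l1.sub hlim).const_smul a⁻¹

/-! ### The resolvent -/

theorem inner_laplacian_toLp (φ ψ : 𝓢(Plane, ℂ)) :
    inner ℂ ((Δ φ).toLp 2 : L2) (ψ.toLp 2 : L2) = inner ℂ (φ.toLp 2 : L2) ((Δ ψ).toLp 2 : L2) := by
  rw [SchwartzMap.inner_toL2_toL2_eq _ _ volume, SchwartzMap.inner_toL2_toL2_eq _ _ volume]
  have h := SchwartzMap.integral_bilinear_laplacian_right_eq_left
    (μ := (volume : Measure Plane)) φ ψ
    ((ContinuousLinearMap.mul ℝ ℂ).comp (Complex.conjCLE : ℂ →L[ℝ] ℂ))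
  simp only [RCLike.inner_apply']
  simpa using h.symm

theorem inner_laplacianL2 (u v : H2) :
    inner ℂ (laplacianL2 u) (v : L2) = inner ℂ (u : L2) (laplacianL2 v) := by
  obtain ⟨φ, hφ, hφ'⟩ := exists_schwartz_tendsto u
  obtain ⟨ψ, hψ, hψ'⟩ := exists_schwartz_tendsto v
  have h1 := hφ'.inner (𝕜 := ℂ) hψ
  have h2 := hφ.inner (𝕜 := ℂ) hψ'
  simp only [inner_laplacian_toLp] at h1
  exact tendsto_nhds_unique h1 h2

theorem schrodinger_apply (V : Plane → ℝ) (hV : MemLp V ⊤ volume) (E h : ℝ) (u : H2) :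
    schrodinger V hV E h u = -((h : ℂ) ^ 2) • laplacianL2 u + mulOp V hV u - (E : ℂ) • (u : L2) :=
  rfl

theorem schrodinger_symm (V : Plane → ℝ) (hV : MemLp V ⊤ volume) (E h : ℝ) (u v : H2) :
    inner ℂ (schrodinger V hV E h u) (v : L2) = inner ℂ (u : L2) (schrodinger V hV E h v) := by
  simp only [schrodinger_apply, inner_sub_left, inner_add_left, inner_smul_left, inner_sub_right,
    inner_add_right, inner_smul_right, inner_laplacianL2, inner_mulOp_left, map_neg, map_pow,
    Complex.conj_ofReal]

/-- `P - iε` as a linear map on `H²`. -/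
def shifted (V : Plane → ℝ) (hV : MemLp V ⊤ volume) (E h ε : ℝ) : H2 →ₗ[ℂ] L2 :=
  -((h : ℂ) ^ 2) • laplacianL2 + (mulOp V hV : L2 →ₗ[ℂ] L2) ∘ₗ H2.subtype
    - (E : ℂ) • H2.subtype - (Complex.I * ε) • H2.subtype

theorem shifted_apply (V : Plane → ℝ) (hV : MemLp V ⊤ volume) (E h ε : ℝ) (u : H2) :
    shifted V hV E h ε u = schrodinger V hV E h u - (Complex.I * ε) • (u : L2) := rfl

/-- Symmetry makes ⟨u, Pu⟩ real, so the imaginary part of ⟨u, (P - iε)u⟩ is -ε‖u‖². -/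
theorem norm_le_norm_shifted (V : Plane → ℝ) (hV : MemLp V ⊤ volume) (E h : ℝ) {ε : ℝ} (hε : 0 < ε)
    (u : H2) : ε * ‖(u : L2)‖ ≤ ‖shifted V hV E h ε u‖ := by
  have him : (inner ℂ (u : L2) (schrodinger V hV E h u)).im = 0 := by
    have h1 := schrodinger_symm V hV E h u u
    rw [← inner_conj_symm] at h1
    exact Complex.conj_eq_iff_im.mp h1
  have h2 : (inner ℂ (u : L2) (shifted V hV E h ε u)).im = -(ε * ‖(u : L2)‖ ^ 2) := by
    rw [shifted_apply, inner_sub_right, inner_smul_right, Complex.sub_im, him,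
      inner_self_eq_norm_sq_to_K]
    have : (Complex.I * (ε : ℂ) * ((‖(u : L2)‖ : ℂ)) ^ 2).im = ε * ‖(u : L2)‖ ^ 2 := by
      rw [mul_assoc, ← Complex.ofReal_pow, ← Complex.ofReal_mul, Complex.I_mul_im,
        Complex.ofReal_re]
    rw [zero_sub]
    exact congrArg Neg.neg this
  have h3 : ε * ‖(u : L2)‖ ^ 2 ≤ ‖(u : L2)‖ * ‖shifted V hV E h ε u‖ := by
    have h4 := (Complex.abs_im_le_norm _).trans
      (norm_inner_le_norm (𝕜 := ℂ) (u : L2) (shifted V hV E h ε u))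
    rw [h2, abs_neg, abs_of_nonneg (by positivity)] at h4
    exact h4
  rcases (norm_nonneg (u : L2)).eq_or_lt with h0 | h0
  · rw [← h0, mul_zero]
    exact norm_nonneg _
  · refine le_of_mul_le_mul_left ?_ h0
    linarith

/-- Since h ≠ 0, the equation can be solved for Δu, so convergence of u and of (P - iε)u forces
convergence of Δu; closedness of the Laplacian identifies the limit. -/
theorem exists_shifted_eq_of_tendsto (V : Plane → ℝ) (hV : MemLp V ⊤ volume) (E : ℝ) {h ε : ℝ}
    (hh : 0 < h) {u : ℕ → H2} {v f : L2}
    (hu : Filter.Tendsto (fun n => (u n : L2)) Filter.atTop (nhds v))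
    (hf : Filter.Tendsto (fun n => shifted V hV E h ε (u n)) Filter.atTop (nhds f)) :
    ∃ w : H2, shifted V hV E h ε w = f := by
  have hne : (h : ℂ) ^ 2 ≠ 0 := pow_ne_zero 2 (Complex.ofReal_ne_zero.mpr hh.ne')
  have hlap : ∀ w : H2, laplacianL2 w = ((h : ℂ) ^ 2)⁻¹ •
      (mulOp V hV w - (E : ℂ) • (w : L2) - (Complex.I * ε) • (w : L2) - shifted V hV E h ε w) := by
    intro w
    rw [shifted_apply, schrodinger_apply, eq_inv_smul_iff₀ hne]
    module
  have hl : Filter.Tendsto (fun n => laplacianL2 (u n)) Filter.atTop (nhds (((h : ℂ) ^ 2)⁻¹ •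
      (mulOp V hV v - (E : ℂ) • v - (Complex.I * ε) • v - f))) := by
    simp only [hlap]
    exact (((((mulOp V hV).continuous.tendsto v).comp hu |>.sub (hu.const_smul _)).sub
      (hu.const_smul _)).sub hf).const_smul _
  have hL := isClosed_isLaplacian.mem_of_tendsto (hu.prodMk_nhds hl)
    (Filter.Eventually.of_forall fun n => isLaplacian_laplacianL2 (u n))
  refine ⟨⟨v, hL.mem_H2⟩, ?_⟩
  rw [shifted_apply, schrodinger_apply, hL.laplacianL2_eq, smul_smul, neg_mul,
    mul_inv_cancel₀ hne]
  module

/-- A Schwartz function as an element of `H²`. -/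
def schwartzH2 (φ : 𝓢(Plane, ℂ)) : H2 := ⟨φ.toLp 2 volume, (isLaplacian_toLp φ).mem_H2⟩

theorem coe_schwartzH2 (φ : 𝓢(Plane, ℂ)) : (schwartzH2 φ : L2) = φ.toLp 2 volume := rfl

theorem laplacianL2_schwartzH2 (φ : 𝓢(Plane, ℂ)) :
    laplacianL2 (schwartzH2 φ) = (Δ φ).toLp 2 volume :=
  (isLaplacian_toLp φ).laplacianL2_eq

theorem shifted_schwartzH2 (V : Plane → ℝ) (hV : MemLp V ⊤ volume) (E h ε : ℝ) (φ : 𝓢(Plane, ℂ)) :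
    shifted V hV E h ε (schwartzH2 φ) = -((h : ℂ) ^ 2) • (Δ φ).toLp 2 volume
      + mulOp V hV (φ.toLp 2 volume) - (E : ℂ) • φ.toLp 2 volume
      - (Complex.I * ε) • φ.toLp 2 volume := by
  rw [shifted_apply, schrodinger_apply, laplacianL2_schwartzH2, coe_schwartzH2]

theorem inner_toLp_eq_integral (g : L2) (φ : 𝓢(Plane, ℂ)) :
    inner ℂ g (φ.toLp 2 : L2) = ∫ x, φ x * (star g : L2) x := by
  rw [L2.inner_def]
  refine integral_congr_ae ?_
  filter_upwards [φ.coeFn_toLp 2 volume, Lp.coeFn_star g] with x h1 h2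
  rw [h1, h2, RCLike.inner_apply]
  rfl

/-- A function g orthogonal to the range satisfies (P + iε)g = 0 in the sense of distributions. The
coefficients of P are real, so the conjugate of g is annihilated by P - iε itself. Elliptic
regularity puts it in H², where the lower bound makes it zero. -/
theorem dense_range_shifted (V : Plane → ℝ) (hV : MemLp V ⊤ volume) (E : ℝ) {h ε : ℝ}
    (hh : 0 < h) (hε : 0 < ε) :
    (LinearMap.range (shifted V hV E h ε)).topologicalClosure = ⊤ := by
  rw [Submodule.topologicalClosure_eq_top_iff, Submodule.eq_bot_iff]
  intro g hg
  have hne : (h : ℂ) ^ 2 ≠ 0 := pow_ne_zero 2 (Complex.ofReal_ne_zero.mpr hh.ne')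
  set w : L2 := ((h : ℂ) ^ 2)⁻¹ • (mulOp V hV (star g) - (E : ℂ) • star g
    - (Complex.I * ε) • star g) with hw
  set w' : L2 := ((h : ℂ) ^ 2)⁻¹ • (mulOp V hV g - (E : ℂ) • g + (Complex.I * ε) • g) with hw'
  have hstar : star w' = w := by
    refine Lp.ext ?_
    filter_upwards [Lp.coeFn_star w', Lp.coeFn_star g,
      Lp.coeFn_smul ((h : ℂ) ^ 2)⁻¹ (mulOp V hV g - (E : ℂ) • g + (Complex.I * ε) • g),
      Lp.coeFn_add (mulOp V hV g - (E : ℂ) • g) ((Complex.I * ε) • g),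
      Lp.coeFn_sub (mulOp V hV g) ((E : ℂ) • g), coeFn_mulOp V hV g, Lp.coeFn_smul (E : ℂ) g,
      Lp.coeFn_smul (Complex.I * ε) g,
      Lp.coeFn_smul ((h : ℂ) ^ 2)⁻¹ (mulOp V hV (star g) - (E : ℂ) • star g
        - (Complex.I * ε) • star g),
      Lp.coeFn_sub (mulOp V hV (star g) - (E : ℂ) • star g) ((Complex.I * ε) • star g),
      Lp.coeFn_sub (mulOp V hV (star g)) ((E : ℂ) • star g), coeFn_mulOp V hV (star g),
      Lp.coeFn_smul (E : ℂ) (star g), Lp.coeFn_smul (Complex.I * ε) (star g)]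
      with x a1 a2 a3 a4 a5 a6 a7 a8 b3 b4 b5 b6 b7 b8
    rw [a1, Pi.star_apply]
    simp only [Pi.star_apply, hw', a3, Pi.smul_apply, a4, Pi.add_apply, a5, Pi.sub_apply, a6,
      a7, a8, hw, b3, b4, b5, b6, b7, b8, a2, smul_eq_mul, star_add, star_sub, star_mul',
      star_inv₀, star_pow, RCLike.star_def, Complex.conj_ofReal, Complex.conj_I]
    ring
  -- The distributional pairing is bilinear whereas the inner product is conjugate linear in g,
  -- hence the conjugate of g.
  have hL : IsLaplacian (star g) w := by
    rw [isLaplacian_iff]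
    intro φ
    have h1 := Submodule.inner_left_of_mem_orthogonal (LinearMap.mem_range_self
      (shifted V hV E h ε) (schwartzH2 φ)) hg
    rw [shifted_schwartzH2] at h1
    rw [← hstar, ← inner_toLp_eq_integral, ← inner_toLp_eq_integral, hw']
    simp only [inner_sub_right, inner_add_right, inner_smul_right, inner_sub_left, inner_add_left,
      inner_smul_left, inner_mulOp_left, map_inv₀, map_pow, map_mul, Complex.conj_ofReal,
      Complex.conj_I] at h1 ⊢
    rw [eq_inv_mul_iff_mul_eq₀ hne]
    linear_combination -h1
  have hm : star g ∈ H2 := hL.mem_H2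
  have hlap : laplacianL2 ⟨star g, hm⟩ = w := hL.laplacianL2_eq
  have h0 : shifted V hV E h ε ⟨star g, hm⟩ = 0 := by
    rw [shifted_apply, schrodinger_apply, hlap, hw, smul_smul, neg_mul,
      mul_inv_cancel₀ hne]
    module
  have h1 := norm_le_norm_shifted V hV E h hε ⟨star g, hm⟩
  rw [h0, norm_zero] at h1
  have h2 : ‖star g‖ = 0 := le_antisymm (by
    by_contra! hlt
    have := mul_pos hε hlt
    simp only at h1
    linarith) (norm_nonneg _)
  rw [norm_eq_zero] at h2
  rw [← star_star g, h2]
  refine Lp.ext ?_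
  filter_upwards [Lp.coeFn_star (0 : L2), Lp.coeFn_zero ℂ 2 (volume : Measure Plane)] with x h1 h2
  rw [h1, Pi.star_apply, h2, Pi.zero_apply, star_zero]

theorem shifted_bijective (V : Plane → ℝ) (hV : MemLp V ⊤ volume) (E : ℝ) {h ε : ℝ}
    (hh : 0 < h) (hε : 0 < ε) : Function.Bijective (shifted V hV E h ε) := by
  have hlow := norm_le_norm_shifted V hV E h hε
  constructor
  · rw [← LinearMap.ker_eq_bot, LinearMap.ker_eq_bot']
    intro u hu
    have := hlow u
    rw [hu, norm_zero] at this
    have h2 : ‖(u : L2)‖ = 0 := le_antisymm (by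
      by_contra! hlt
      have := mul_pos hε hlt
      linarith) (norm_nonneg _)
    exact Subtype.ext (norm_eq_zero.mp h2)
  · intro f
    have hf : f ∈ (LinearMap.range (shifted V hV E h ε)).topologicalClosure := by
      rw [dense_range_shifted V hV E hh hε]
      trivial
    obtain ⟨s, hs, hlim⟩ := mem_closure_iff_seq_limit.mp hf
    choose u hu using hs
    have hc : CauchySeq fun n => (u n : L2) := by
      rw [Metric.cauchySeq_iff]
      intro η hη
      obtain ⟨N, hN⟩ := Metric.cauchySeq_iff.mp hlim.cauchySeq (ε * η) (by positivity)
      refine ⟨N, fun m hm n hn => ?_⟩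
      have h1 := hN m hm n hn
      have h2 := hlow (u m - u n)
      rw [map_sub, hu, hu, Submodule.coe_sub] at h2
      rw [dist_eq_norm] at h1 ⊢
      exact lt_of_mul_lt_mul_left (h2.trans_lt h1) hε.le
    obtain ⟨v, hv⟩ := cauchySeq_tendsto_of_complete hc
    exact exists_shifted_eq_of_tendsto V hV E hh hv (by simpa only [hu] using hlim)

/-- `P - iε` has a bounded inverse, of norm at most `1/ε`. -/
theorem exists_isResolvent (V : Plane → ℝ) (hV : MemLp V ⊤ volume) (E : ℝ) {h ε : ℝ}
    (hh : 0 < h) (hε : 0 < ε) : ∃ G : L2 →L[ℂ] L2,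
      IsResolvent (schrodinger V hV E h) (Complex.I * ε) G ∧ ∀ f, ‖G f‖ ≤ ε⁻¹ * ‖f‖ := by
  set e := LinearEquiv.ofBijective (shifted V hV E h ε) (shifted_bijective V hV E hh hε) with he
  have hb : ∀ f, ‖(H2.subtype ∘ₗ (e.symm : L2 →ₗ[ℂ] H2)) f‖ ≤ ε⁻¹ * ‖f‖ := by
    intro f
    have h1 := norm_le_norm_shifted V hV E h hε (e.symm f)
    have h2 : shifted V hV E h ε (e.symm f) = f := e.apply_symm_apply f
    rw [h2] at h1
    rw [← div_eq_inv_mul, le_div_iff₀ hε, mul_comm]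
    exact h1
  refine ⟨(H2.subtype ∘ₗ (e.symm : L2 →ₗ[ℂ] H2)).mkContinuous ε⁻¹ hb, ⟨fun f => ?_, fun u => ?_⟩,
    hb⟩
  · exact ⟨(e.symm f).2, e.apply_symm_apply f⟩
  · exact congrArg Subtype.val (e.symm_apply_apply u)

end

end SemiclassicalResolvent

open scoped LineDeriv

namespace SemiclassicalResolvent

noncomputable section

/-! ### Real and imaginary parts of Schwartz functions -/

/-- The real part of a Schwartz function. -/
def rePart (φ : 𝓢(Plane, ℂ)) (x : Plane) : ℝ := (φ x).re

/-- The imaginary part of a Schwartz function. -/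
def imPart (φ : 𝓢(Plane, ℂ)) (x : Plane) : ℝ := (φ x).im

theorem contDiff_rePart (φ : 𝓢(Plane, ℂ)) : ContDiff ℝ ∞ (rePart φ) :=
  Complex.reCLM.contDiff.comp φ.smooth'

theorem contDiff_imPart (φ : 𝓢(Plane, ℂ)) : ContDiff ℝ ∞ (imPart φ) :=
  Complex.imCLM.contDiff.comp φ.smooth'

theorem pd_rePart (i : Fin 2) (φ : 𝓢(Plane, ℂ)) : pd i (rePart φ) = rePart (∂_{basisVec i} φ) := by
  ext x
  have h : HasFDerivAt (rePart φ) (Complex.reCLM ∘L fderiv ℝ φ x) x :=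
    Complex.reCLM.hasFDerivAt.comp x φ.differentiableAt.hasFDerivAt
  rw [pd, h.fderiv, rePart, SchwartzMap.lineDerivOp_apply_eq_fderiv]
  rfl

theorem pd_imPart (i : Fin 2) (φ : 𝓢(Plane, ℂ)) : pd i (imPart φ) = imPart (∂_{basisVec i} φ) := by
  ext x
  have h : HasFDerivAt (imPart φ) (Complex.imCLM ∘L fderiv ℝ φ x) x :=
    Complex.imCLM.hasFDerivAt.comp x φ.differentiableAt.hasFDerivAt
  rw [pd, h.fderiv, imPart, SchwartzMap.lineDerivOp_apply_eq_fderiv]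
  rfl

theorem laplacian_schwartz (φ : 𝓢(Plane, ℂ)) :
    Δ φ = ∂_{basisVec 0} (∂_{basisVec 0} φ) + ∂_{basisVec 1} (∂_{basisVec 1} φ) := by
  rw [SchwartzMap.laplacian_eq_sum (EuclideanSpace.basisFun (Fin 2) ℝ), Fin.sum_univ_two]
  simp [basisVec]

theorem lap_rePart (φ : 𝓢(Plane, ℂ)) (x : Plane) : lap (rePart φ) x = (Δ φ x).re := by
  rw [lap, pd_rePart, pd_rePart, pd_rePart, pd_rePart, laplacian_schwartz]
  rfl

theorem lap_imPart (φ : 𝓢(Plane, ℂ)) (x : Plane) : lap (imPart φ) x = (Δ φ x).im := by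
  rw [lap, pd_imPart, pd_imPart, pd_imPart, pd_imPart, laplacian_schwartz]
  rfl

/-! ### L² norms and gradients of Schwartz functions as integrals. -/

theorem integrable_norm_sq (u : L2) : Integrable fun x => ‖u x‖ ^ 2 :=
  (memLp_two_iff_integrable_sq_norm (Lp.aestronglyMeasurable u)).mp (Lp.memLp u)

theorem norm_sq_eq_integral (u : L2) : ‖u‖ ^ 2 = ∫ x, ‖u x‖ ^ 2 := by
  have h : ((‖u‖ ^ 2 : ℝ) : ℂ) = ((∫ x, ‖u x‖ ^ 2 : ℝ) : ℂ) := by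
    rw [← integral_complex_ofReal, Complex.ofReal_pow]
    refine (inner_self_eq_norm_sq_to_K (𝕜 := ℂ) u).symm.trans ((L2.inner_def u u).trans ?_)
    refine integral_congr_ae (Filter.Eventually.of_forall fun x => ?_)
    simp only [inner_self_eq_norm_sq_to_K, Complex.ofReal_pow]
    rfl
  exact Complex.ofReal_injective h

theorem norm_toLp_sq (φ : 𝓢(Plane, ℂ)) : ‖(φ.toLp 2 : L2)‖ ^ 2 = ∫ x, ‖φ x‖ ^ 2 := by
  rw [norm_sq_eq_integral]
  refine integral_congr_ae ?_
  filter_upwards [φ.coeFn_toLp 2 volume] with x hx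
  rw [hx]

theorem integrable_schwartz_norm_sq (φ : 𝓢(Plane, ℂ)) : Integrable fun x => ‖φ x‖ ^ 2 := by
  refine (integrable_norm_sq (φ.toLp 2 : L2)).congr ?_
  filter_upwards [φ.coeFn_toLp 2 volume] with x hx
  rw [hx]

theorem norm_sq_eq_parts (φ : 𝓢(Plane, ℂ)) (x : Plane) :
    ‖φ x‖ ^ 2 = rePart φ x ^ 2 + imPart φ x ^ 2 := by
  rw [Complex.sq_norm, Complex.normSq_apply, rePart, imPart]
  ring

theorem gradSq_parts (φ : 𝓢(Plane, ℂ)) (x : Plane) :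
    gradSq (rePart φ) x + gradSq (imPart φ) x
      = ‖∂_{basisVec 0} φ x‖ ^ 2 + ‖∂_{basisVec 1} φ x‖ ^ 2 := by
  rw [gradSq, gradSq, pd_rePart, pd_rePart, pd_imPart, pd_imPart, norm_sq_eq_parts,
    norm_sq_eq_parts]
  ring

theorem integrable_gradSq_parts (φ : 𝓢(Plane, ℂ)) :
    Integrable fun x => gradSq (rePart φ) x + gradSq (imPart φ) x := by
  simp only [gradSq_parts]
  exact (integrable_schwartz_norm_sq _).add (integrable_schwartz_norm_sq _)

/-- Integration by parts gives ∫|∇φ|² = -∫⟨φ, Δφ⟩. The graph norm of the Laplacian therefore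
controls the gradients that occur in commutators with cutoffs. -/
theorem integral_gradSq_parts_le (φ : 𝓢(Plane, ℂ)) :
    ∫ x, (gradSq (rePart φ) x + gradSq (imPart φ) x)
      ≤ (∫ x, ‖φ x‖ ^ 2) + ∫ x, ‖Δ φ x‖ ^ 2 := by
  have hp : ∀ i, ∫ x, ‖∂_{basisVec i} φ x‖ ^ 2
      = -∫ x, inner ℝ (φ x) (∂_{basisVec i} (∂_{basisVec i} φ) x) := by
    intro i
    have h : ∫ x, inner ℝ (φ x) (∂_{basisVec i} (∂_{basisVec i} φ) x)
        = -∫ x, inner ℝ (∂_{basisVec i} φ x) (∂_{basisVec i} φ x) :=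
      SchwartzMap.integral_bilinear_lineDerivOp_right_eq_neg_left (μ := (volume : Measure Plane)) φ (∂_{basisVec i} φ) (innerSL ℝ (E := ℂ)) (basisVec i)
    simp only [real_inner_self_eq_norm_sq] at h
    linarith
  have hi : ∀ ψ : 𝓢(Plane, ℂ), Integrable fun x => inner ℝ (φ x) (ψ x) := fun ψ =>
    (SchwartzMap.pairing (innerSL ℝ (E := ℂ)) φ ψ).integrable
  simp only [gradSq_parts]
  rw [integral_add (integrable_schwartz_norm_sq _) (integrable_schwartz_norm_sq _), hp, hp,
    ← neg_add, ← integral_add (hi _) (hi _), ← integral_neg,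
    ← integral_add (integrable_schwartz_norm_sq _) (integrable_schwartz_norm_sq _)]
  refine integral_mono ((hi _).add (hi _)).neg
    ((integrable_schwartz_norm_sq _).add (integrable_schwartz_norm_sq _)) fun x => ?_
  have h1 : inner ℝ (φ x) (∂_{basisVec 0} (∂_{basisVec 0} φ) x)
      + inner ℝ (φ x) (∂_{basisVec 1} (∂_{basisVec 1} φ) x) = inner ℝ (φ x) (Δ φ x) := by
    rw [← inner_add_right, laplacian_schwartz]
    rfl
  simp only [h1]
  have h2 := abs_real_inner_le_norm (φ x) (Δ φ x)
  have h3 := neg_abs_le (inner ℝ (φ x) (Δ φ x))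
  nlinarith [sq_nonneg (‖φ x‖ - ‖Δ φ x‖), sq_nonneg ‖φ x‖, sq_nonneg ‖Δ φ x‖]

/-- The pointwise size of `(P - iε)φ`. -/
theorem norm_sq_shifted (V : Plane → ℝ) (hV : MemLp V ⊤ volume) (E h ε : ℝ) (φ : 𝓢(Plane, ℂ)) :
    ∀ᵐ x, ‖shifted V hV E h ε (schwartzH2 φ) x‖ ^ 2
      = resSq V E h ε (rePart φ) (imPart φ) x := by
  rw [shifted_schwartzH2]
  filter_upwards [Lp.coeFn_sub (-((h : ℂ) ^ 2) • (Δ φ).toLp 2 volume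
      + mulOp V hV (φ.toLp 2 volume) - (E : ℂ) • φ.toLp 2 volume)
      ((Complex.I * ε) • φ.toLp 2 volume),
    Lp.coeFn_sub (-((h : ℂ) ^ 2) • (Δ φ).toLp 2 volume + mulOp V hV (φ.toLp 2 volume))
      ((E : ℂ) • φ.toLp 2 volume),
    Lp.coeFn_add (-((h : ℂ) ^ 2) • (Δ φ).toLp 2 volume) (mulOp V hV (φ.toLp 2 volume)),
    Lp.coeFn_smul (-((h : ℂ) ^ 2)) ((Δ φ).toLp 2 volume), coeFn_mulOp V hV (φ.toLp 2 volume),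
    Lp.coeFn_smul (E : ℂ) (φ.toLp 2 volume), Lp.coeFn_smul (Complex.I * ε) (φ.toLp 2 volume),
    φ.coeFn_toLp 2 volume, (Δ φ).coeFn_toLp 2 volume] with x a1 a2 a3 a4 a5 a6 a7 a8 a9
  rw [a1, Pi.sub_apply, a2, Pi.sub_apply, a3, Pi.add_apply, a4, a5, a6, a7]
  simp only [Pi.smul_apply, a8, a9, smul_eq_mul]
  rw [Complex.sq_norm, Complex.normSq_apply, resSq, schr, schr, lap_rePart, lap_imPart, rePart,
    imPart]
  have e2 : ((h : ℂ)) ^ 2 = ((h ^ 2 : ℝ) : ℂ) := by norm_cast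
  rw [e2]
  simp only [Complex.sub_re, Complex.add_re, Complex.mul_re, Complex.neg_re, Complex.neg_im,
    Complex.ofReal_re, Complex.ofReal_im, Complex.I_re, Complex.I_im, Complex.sub_im,
    Complex.add_im, Complex.mul_im]
  ring

/-! ### The weight of the resolvent estimate -/

/-- The square root of the weight on the left of the estimate for test functions. -/
def halfWeight (R C h δ : ℝ) (x : Plane) : ℝ :=
  Real.sqrt (damping R C h x) * (1 + ‖x‖) ^ (-((1 + δ) / 2))

theorem halfWeight_pos (R C h δ : ℝ) (x : Plane) : 0 < halfWeight R C h δ x := by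
  have := Real.sqrt_pos.mpr (damping_pos R C h x)
  rw [halfWeight]
  positivity

theorem measurable_halfWeight (R C h δ : ℝ) : Measurable (halfWeight R C h δ) :=
  (measurable_damping R C h).sqrt.mul (measurable_pow_weight _)

theorem halfWeight_sq (R C h δ : ℝ) (x : Plane) :
    halfWeight R C h δ x ^ 2 = damping R C h x * (1 + ‖x‖) ^ (-(1 + δ)) := by
  rw [halfWeight, mul_pow, Real.sq_sqrt (damping_pos R C h x).le, ← Real.rpow_natCast,
    ← Real.rpow_mul (by positivity)]
  congr 2
  push_cast
  ring

theorem halfWeight_inv_sq (R C h δ : ℝ) (x : Plane) :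
    (halfWeight R C h δ x)⁻¹ ^ 2 = (damping R C h x)⁻¹ * (1 + ‖x‖) ^ (1 + δ) := by
  rw [inv_pow, halfWeight_sq, mul_inv, Real.rpow_neg (by positivity), inv_inv]

theorem halfWeight_le_rpow {R C h δ : ℝ} (hC : 0 ≤ C) (hh : 0 < h) (x : Plane) :
    halfWeight R C h δ x ≤ (1 + ‖x‖) ^ (-((1 + δ) / 2)) :=
  mul_le_of_le_one_left (by positivity) (Real.sqrt_le_one.mpr (damping_le_one hC hh x))

/-- The exponential loss of the global estimate arises here. Bounding the square root of the damping
below by e^{-C/h}, rather than its half power, is wasteful but only changes the constant in the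
exponent. -/
theorem rpow_le_halfWeight {R C h δ : ℝ} (hC : 0 ≤ C) (hh : 0 < h) (x : Plane) :
    (1 + ‖x‖) ^ (-((1 + δ) / 2)) ≤ Real.exp (C / h) * halfWeight R C h δ x := by
  have h1 : Real.exp (-(C / h)) ≤ Real.sqrt (damping R C h x) :=
    (exp_le_damping hC hh x).trans (Real.le_sqrt_of_sq_le (by
      nlinarith [damping_pos R C h x, damping_le_one (R := R) hC hh x]))
  have h2 := mul_le_mul_of_nonneg_left h1 (Real.exp_pos (C / h)).le
  rw [← Real.exp_add, add_neg_cancel, Real.exp_zero] at h2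
  rw [halfWeight, ← mul_assoc]
  exact le_mul_of_one_le_left (by positivity) h2

theorem rpow_eq_halfWeight {R C h δ : ℝ} {x : Plane} (hx : R ≤ ‖x‖) :
    (1 + ‖x‖) ^ (-((1 + δ) / 2)) = halfWeight R C h δ x := by
  rw [halfWeight, damping, if_pos hx, Real.sqrt_one, one_mul]

/-! ### The weighted estimate on `H²` -/

theorem comm_sq_le_of_le_one {B k : ℝ} (hB : 0 ≤ B) (hk : 0 < k) (hk1 : k ≤ 1) (u : Plane → ℝ)
    {x : Plane}
    (hcut : (∀ i, |pd i (cutoff k) x| ≤ B * k) ∧ |lap (cutoff k) x| ≤ B * k ^ 2) :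
    comm k u x ^ 2 ≤ 9 * B ^ 2 * k ^ 2 * (u x ^ 2 + gradSq u x) := by
  have a1 : |lap (cutoff k) x * u x| ≤ B * k * |u x| := by
    rw [abs_mul]
    refine mul_le_mul_of_nonneg_right (hcut.2.trans ?_) (abs_nonneg _)
    exact mul_le_mul_of_nonneg_left (by nlinarith) hB
  have a2 : ∀ i, |pd i (cutoff k) x * pd i u x| ≤ B * k * |pd i u x| := fun i => by
    rw [abs_mul]
    exact mul_le_mul_of_nonneg_right (hcut.1 i) (abs_nonneg _)
  have a3 : |comm k u x| ≤ B * k * (|u x| + 2 * |pd 0 u x| + 2 * |pd 1 u x|) := by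
    rw [comm, abs_le]
    have b1 := abs_le.mp a1
    have b2 := abs_le.mp (a2 0)
    have b3 := abs_le.mp (a2 1)
    constructor <;> linarith [b1.1, b1.2, b2.1, b2.2, b3.1, b3.2]
  have a4 : (|u x| + 2 * |pd 0 u x| + 2 * |pd 1 u x|) ^ 2 ≤ 9 * (u x ^ 2 + gradSq u x) := by
    rw [gradSq, ← sq_abs (u x), ← sq_abs (pd 0 u x), ← sq_abs (pd 1 u x)]
    nlinarith [sq_nonneg (2 * |u x| - |pd 0 u x|), sq_nonneg (2 * |u x| - |pd 1 u x|),
      sq_nonneg (|pd 0 u x| - |pd 1 u x|)]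
  rw [← sq_abs]
  calc |comm k u x| ^ 2 ≤ (B * k * (|u x| + 2 * |pd 0 u x| + 2 * |pd 1 u x|)) ^ 2 :=
        pow_le_pow_left₀ (abs_nonneg _) a3 2
    _ = (B * k) ^ 2 * (|u x| + 2 * |pd 0 u x| + 2 * |pd 1 u x|) ^ 2 := by ring
    _ ≤ (B * k) ^ 2 * (9 * (u x ^ 2 + gradSq u x)) :=
        mul_le_mul_of_nonneg_left a4 (by positivity)
    _ = _ := by ring

/-- On the support of the cutoff 1 + |x| ≤ 3/k, and 9 bounds 3^{1+δ}. -/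
theorem inv_damping_mul_rpow_le {R C h δ k : ℝ} (hC : 0 ≤ C) (hh : 0 < h) (hδ : 0 < δ)
    (hδ1 : δ ≤ 1) (hk : 0 < k) (hk1 : k ≤ 1) {x : Plane} (hx : k * ‖x‖ ≤ 2) :
    (damping R C h x)⁻¹ * (1 + ‖x‖) ^ (1 + δ) ≤ 9 * Real.exp (C / h) * k ^ (-(1 + δ)) := by
  have h1 : (damping R C h x)⁻¹ ≤ Real.exp (C / h) := by
    have := inv_anti₀ (Real.exp_pos _) (exp_le_damping (R := R) hC hh x)
    rwa [← Real.exp_neg, neg_neg] at this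
  have h2 : (1 + ‖x‖) ^ (1 + δ) ≤ 9 * k ^ (-(1 + δ)) := by
    have h3 : 1 + ‖x‖ ≤ 3 * k⁻¹ := by
      rw [← div_eq_mul_inv, le_div_iff₀ hk]
      nlinarith
    refine (Real.rpow_le_rpow (by positivity) h3 (by linarith)).trans ?_
    rw [Real.mul_rpow (by norm_num) (by positivity), Real.inv_rpow hk.le, ← Real.rpow_neg hk.le]
    refine mul_le_mul_of_nonneg_right ?_ (by positivity)
    calc (3 : ℝ) ^ (1 + δ) ≤ 3 ^ (2 : ℝ) :=
          Real.rpow_le_rpow_of_exponent_le (by norm_num) (by linarith)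
      _ = 9 := by norm_num
  calc _ ≤ Real.exp (C / h) * (9 * k ^ (-(1 + δ))) :=
        mul_le_mul h1 h2 (by positivity) (Real.exp_pos _).le
    _ = _ := by ring

theorem resSq_cutoff_mul_le (V : Plane → ℝ) (E h ε k : ℝ) {u₁ u₂ : Plane → ℝ}
    (hu₁ : ContDiff ℝ ∞ u₁) (hu₂ : ContDiff ℝ ∞ u₂) (x : Plane) :
    resSq V E h ε (fun x => cutoff k x * u₁ x) (fun x => cutoff k x * u₂ x) x
      ≤ 2 * (cutoff k x ^ 2 * resSq V E h ε u₁ u₂ x)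
        + 2 * h ^ 4 * (comm k u₁ x ^ 2 + comm k u₂ x ^ 2) := by
  rw [resSq, resSq, schr_cutoff_mul V E h k hu₁, schr_cutoff_mul V E h k hu₂]
  nlinarith [sq_nonneg (cutoff k x * (schr V E h u₁ x + ε * u₂ x) + h ^ 2 * comm k u₁ x),
    sq_nonneg (cutoff k x * (schr V E h u₂ x - ε * u₁ x) + h ^ 2 * comm k u₂ x)]

theorem memLp_top_halfWeight_mul_cutoff {R C h δ k : ℝ} (hC : 0 ≤ C) (hh : 0 < h) (hδ : 0 < δ) :
    MemLp (fun x => halfWeight R C h δ x * cutoff k x) ⊤ volume := by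
  refine memLp_top_of_bound ((measurable_halfWeight R C h δ).mul
    (contDiff_cutoff k).continuous.measurable).aestronglyMeasurable 1
    (Filter.Eventually.of_forall fun x => ?_)
  have h1 : halfWeight R C h δ x ≤ 1 := (halfWeight_le_rpow hC hh x).trans
    (Real.rpow_le_one_of_one_le_of_nonpos (by simp) (by linarith))
  have h0 := (halfWeight_pos R C h δ x).le
  rw [Real.norm_of_nonneg (mul_nonneg h0 (cutoff_nonneg k x))]
  exact mul_le_one₀ h1 (cutoff_nonneg k x) (cutoff_le_one k x)

/-- The inverse weight grows at infinity and defines a bounded operator on L² only after truncation.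
-/
theorem memLp_top_inv_halfWeight_mul_cutoff {R C h δ k : ℝ} (hC : 0 ≤ C) (hh : 0 < h) (hδ : 0 < δ)
    (hδ1 : δ ≤ 1) (hk : 0 < k) (hk1 : k ≤ 1) :
    MemLp (fun x => (halfWeight R C h δ x)⁻¹ * cutoff k x) ⊤ volume := by
  refine memLp_top_of_bound ((measurable_halfWeight R C h δ).inv.mul
    (contDiff_cutoff k).continuous.measurable).aestronglyMeasurable
    (1 + 9 * Real.exp (C / h) * k ^ (-(1 + δ))) (Filter.Eventually.of_forall fun x => ?_)
  have h0 := (inv_pos.mpr (halfWeight_pos R C h δ x)).le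
  rw [Real.norm_of_nonneg (mul_nonneg h0 (cutoff_nonneg k x))]
  by_cases hx : k * ‖x‖ ≤ 2
  · have h1 := inv_damping_mul_rpow_le (R := R) hC hh hδ hδ1 hk hk1 hx
    rw [← halfWeight_inv_sq] at h1
    have h2 : (halfWeight R C h δ x)⁻¹ * cutoff k x ≤ (halfWeight R C h δ x)⁻¹ :=
      mul_le_of_le_one_right h0 (cutoff_le_one k x)
    nlinarith
  · rw [cutoff_eq_zero (by rw [← mul_pow]; nlinarith), mul_zero]
    positivity

/-- The estimate for test functions, applied to truncations of a Schwartz function. -/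
theorem schwartz_bound {B : ℝ} (hB : 0 ≤ B)
    (hcut : ∀ k : ℝ, 0 < k → ∀ x : Plane,
      (∀ i, |pd i (cutoff k) x| ≤ B * k) ∧ |lap (cutoff k) x| ≤ B * k ^ 2)
    {V : Plane → ℝ} (hV : MemLp V ⊤ volume) {E h ε K R C δ : ℝ} (hK : 0 < K) (hC : 0 ≤ C)
    (hh : 0 < h) (hδ : 0 < δ) (hδ1 : δ ≤ 1)
    (htest : ∀ u₁ u₂ : Plane → ℝ, ContDiff ℝ ∞ u₁ → HasCompactSupport u₁ → ContDiff ℝ ∞ u₂ →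
        HasCompactSupport u₂ →
        ∫ x, damping R C h x * ((1 + ‖x‖) ^ (-(1 + δ)) * (u₁ x ^ 2 + u₂ x ^ 2))
          ≤ K / h ^ 2 * ∫ x, (damping R C h x)⁻¹
            * ((1 + ‖x‖) ^ (1 + δ) * resSq V E h ε u₁ u₂ x))
    {k : ℝ} (hk : 0 < k) (hk1 : k ≤ 1) (φ : 𝓢(Plane, ℂ)) :
    ‖mulOp (fun x => halfWeight R C h δ x * cutoff k x)
        (memLp_top_halfWeight_mul_cutoff hC hh hδ) (schwartzH2 φ : L2)‖ ^ 2
      ≤ 2 * K / h ^ 2 * ‖mulOp (fun x => (halfWeight R C h δ x)⁻¹ * cutoff k x)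
          (memLp_top_inv_halfWeight_mul_cutoff hC hh hδ hδ1 hk hk1)
          (shifted V hV E h ε (schwartzH2 φ))‖ ^ 2
        + 324 * K * h ^ 2 * Real.exp (C / h) * B ^ 2 * k ^ (1 - δ)
          * (‖(schwartzH2 φ : L2)‖ ^ 2 + ‖laplacianL2 (schwartzH2 φ)‖ ^ 2) := by
  have hc₁ := HasCompactSupport.mul_right (f' := rePart φ) (hasCompactSupport_cutoff hk)
  have hc₂ := HasCompactSupport.mul_right (f' := imPart φ) (hasCompactSupport_cutoff hk)
  have hu₁ := contDiff_rePart φ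
  have hu₂ := contDiff_imPart φ
  have ht := htest _ _ ((contDiff_cutoff k).mul hu₁) hc₁ ((contDiff_cutoff k).mul hu₂) hc₂
  set A : L2 := mulOp (fun x => halfWeight R C h δ x * cutoff k x)
        (memLp_top_halfWeight_mul_cutoff hC hh hδ) (schwartzH2 φ : L2) with hA
  set D : L2 := mulOp (fun x => (halfWeight R C h δ x)⁻¹ * cutoff k x)
          (memLp_top_inv_halfWeight_mul_cutoff hC hh hδ hδ1 hk hk1)
          (shifted V hV E h ε (schwartzH2 φ)) with hD
  have hA2 : ‖A‖ ^ 2 = ∫ x, damping R C h x * ((1 + ‖x‖) ^ (-(1 + δ))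
      * ((cutoff k x * rePart φ x) ^ 2 + (cutoff k x * imPart φ x) ^ 2)) := by
    rw [norm_sq_eq_integral]
    refine integral_congr_ae ?_
    filter_upwards [coeFn_mulOp (fun x => halfWeight R C h δ x * cutoff k x)
      (memLp_top_halfWeight_mul_cutoff hC hh hδ) (schwartzH2 φ : L2),
      φ.coeFn_toLp 2 volume] with x h1 h2
    rw [hA, h1, coe_schwartzH2, h2, norm_mul, mul_pow, norm_sq_eq_parts, Complex.norm_real,
      Real.norm_eq_abs, sq_abs, mul_pow, halfWeight_sq]
    ring
  have hD2 : ∀ᵐ x, ‖D x‖ ^ 2 = (damping R C h x)⁻¹ * ((1 + ‖x‖) ^ (1 + δ)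
      * (cutoff k x ^ 2 * resSq V E h ε (rePart φ) (imPart φ) x)) := by
    filter_upwards [coeFn_mulOp (fun x => (halfWeight R C h δ x)⁻¹ * cutoff k x)
      (memLp_top_inv_halfWeight_mul_cutoff hC hh hδ hδ1 hk hk1)
      (shifted V hV E h ε (schwartzH2 φ)), norm_sq_shifted V hV E h ε φ] with x h1 h2
    rw [hD, h1, norm_mul, mul_pow, h2, Complex.norm_real, Real.norm_eq_abs, sq_abs, mul_pow,
      halfWeight_inv_sq]
    ring
  set M := 162 * h ^ 4 * Real.exp (C / h) * B ^ 2 * k ^ (1 - δ) with hM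
  have hM0 : 0 ≤ M := by positivity
  have iN := integrable_schwartz_norm_sq φ
  have iG := integrable_gradSq_parts φ
  have iNG : Integrable fun x => ‖φ x‖ ^ 2 + (gradSq (rePart φ) x + gradSq (imPart φ) x) :=
    iN.add iG
  have hle : ∫ x, (damping R C h x)⁻¹ * ((1 + ‖x‖) ^ (1 + δ) * resSq V E h ε
      (fun x => cutoff k x * rePart φ x) (fun x => cutoff k x * imPart φ x) x)
      ≤ 2 * ‖D‖ ^ 2 + M * ((∫ x, ‖φ x‖ ^ 2) + ∫ x, (gradSq (rePart φ) x + gradSq (imPart φ) x)) := by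
    rw [norm_sq_eq_integral D, ← integral_add iN iG, ← integral_const_mul, ← integral_const_mul,
      ← integral_add ((integrable_norm_sq D).const_mul 2) (iNG.const_mul M)]
    refine integral_mono_of_nonneg (Filter.Eventually.of_forall fun x => ?_)
      (((integrable_norm_sq D).const_mul 2).add (iNG.const_mul M)) ?_
    · have := damping_pos R C h x
      have := resSq_nonneg V E h ε (fun x => cutoff k x * rePart φ x)
        (fun x => cutoff k x * imPart φ x) x
      simp only [Pi.zero_apply]
      positivity
    · filter_upwards [hD2] with x hx
      have hd := inv_pos.mpr (damping_pos R C h x)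
      have q0 : 0 ≤ (damping R C h x)⁻¹ * (1 + ‖x‖) ^ (1 + δ) := by positivity
      have q1 := mul_le_mul_of_nonneg_left (resSq_cutoff_mul_le V E h ε k hu₁ hu₂ x) q0
      have q2 : (damping R C h x)⁻¹ * (1 + ‖x‖) ^ (1 + δ)
          * (2 * h ^ 4 * (comm k (rePart φ) x ^ 2 + comm k (imPart φ) x ^ 2))
          ≤ M * (‖φ x‖ ^ 2 + (gradSq (rePart φ) x + gradSq (imPart φ) x)) := by
        have hg1 := gradSq_nonneg (rePart φ) x
        have hg2 := gradSq_nonneg (imPart φ) x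
        by_cases hx2 : k * ‖x‖ ≤ 2
        · have r1 := inv_damping_mul_rpow_le (R := R) hC hh hδ hδ1 hk hk1 hx2
          have r2 := comm_sq_le_of_le_one hB hk hk1 (rePart φ) (hcut k hk x)
          have r3 := comm_sq_le_of_le_one hB hk hk1 (imPart φ) (hcut k hk x)
          -- The weight grows like k^{-(1+δ)} on the support of the cutoff and the squared
          -- commutator gains k². The net power tends to zero with k when δ < 1.
          have hpow : k ^ (-(1 + δ)) * k ^ 2 = k ^ (1 - δ) := by
            rw [← Real.rpow_natCast, ← Real.rpow_add hk]
            congr 1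
            push_cast
            ring
          calc _ ≤ 9 * Real.exp (C / h) * k ^ (-(1 + δ)) * (2 * h ^ 4
                * (9 * B ^ 2 * k ^ 2 * (rePart φ x ^ 2 + gradSq (rePart φ) x)
                  + 9 * B ^ 2 * k ^ 2 * (imPart φ x ^ 2 + gradSq (imPart φ) x))) := by
                refine mul_le_mul r1 ?_ (by positivity) (by positivity)
                exact mul_le_mul_of_nonneg_left (add_le_add r2 r3) (by positivity)
            _ = 162 * h ^ 4 * Real.exp (C / h) * B ^ 2 * (k ^ (-(1 + δ)) * k ^ 2)
                * (rePart φ x ^ 2 + imPart φ x ^ 2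
                  + (gradSq (rePart φ) x + gradSq (imPart φ) x)) := by ring
            _ = _ := by rw [hpow, norm_sq_eq_parts, hM]
        · obtain ⟨z1, z2⟩ := cutoff_derivs_eq_zero hk (not_le.mp hx2)
          simp only [comm, z1, z2, zero_mul, mul_zero, add_zero, zero_pow two_ne_zero]
          positivity
      rw [hx]
      linarith
  have hgr := integral_gradSq_parts_le φ
  have e1 : ‖(schwartzH2 φ : L2)‖ ^ 2 = ∫ x, ‖φ x‖ ^ 2 := norm_toLp_sq φ
  have e2 : ‖laplacianL2 (schwartzH2 φ)‖ ^ 2 = ∫ x, ‖Δ φ x‖ ^ 2 := by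
    rw [laplacianL2_schwartzH2]
    exact norm_toLp_sq (Δ φ)
  have n2 : 0 ≤ ∫ x, ‖Δ φ x‖ ^ 2 := integral_nonneg fun x => by positivity
  rw [hA2, e1, e2]
  refine ht.trans ?_
  have s1 : 2 * ‖D‖ ^ 2 + M * ((∫ x, ‖φ x‖ ^ 2)
      + ∫ x, (gradSq (rePart φ) x + gradSq (imPart φ) x))
      ≤ 2 * ‖D‖ ^ 2 + M * (2 * ((∫ x, ‖φ x‖ ^ 2) + ∫ x, ‖Δ φ x‖ ^ 2)) := by
    have := mul_le_mul_of_nonneg_left (by linarith : (∫ x, ‖φ x‖ ^ 2)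
      + ∫ x, (gradSq (rePart φ) x + gradSq (imPart φ) x)
      ≤ 2 * ((∫ x, ‖φ x‖ ^ 2) + ∫ x, ‖Δ φ x‖ ^ 2)) hM0
    linarith
  have s2 := mul_le_mul_of_nonneg_left (hle.trans s1) (by positivity : 0 ≤ K / h ^ 2)
  refine s2.trans (le_of_eq ?_)
  rw [hM]
  field_simp
  ring

theorem memLp_top_halfWeight {R C h δ : ℝ} (hC : 0 ≤ C) (hh : 0 < h) (hδ : 0 < δ) :
    MemLp (halfWeight R C h δ) ⊤ volume := by
  refine memLp_top_of_bound (measurable_halfWeight R C h δ).aestronglyMeasurable 1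
    (Filter.Eventually.of_forall fun x => ?_)
  rw [Real.norm_of_nonneg (halfWeight_pos R C h δ x).le]
  exact (halfWeight_le_rpow hC hh x).trans
    (Real.rpow_le_one_of_one_le_of_nonpos (by simp) (by linarith))

theorem memLp_top_cutoff (k : ℝ) : MemLp (cutoff k) ⊤ volume := by
  refine memLp_top_of_bound (contDiff_cutoff k).continuous.aestronglyMeasurable 1
    (Filter.Eventually.of_forall fun x => ?_)
  rw [Real.norm_of_nonneg (cutoff_nonneg k x)]
  exact cutoff_le_one k x

theorem halfWeight_mul_one_sub_cutoff_le {R C h δ k : ℝ} (hC : 0 ≤ C) (hh : 0 < h) (hδ : 0 < δ)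
    (hk : 0 < k) (x : Plane) :
    |halfWeight R C h δ x * (1 - cutoff k x)| ≤ k ^ ((1 + δ) / 2) := by
  have h1 : 0 ≤ 1 - cutoff k x := by linarith [cutoff_le_one k x]
  have h0 := (halfWeight_pos R C h δ x).le
  rw [abs_of_nonneg (mul_nonneg h0 h1)]
  by_cases hx : k ^ 2 * ‖x‖ ^ 2 ≤ 1
  · rw [cutoff_eq_one hx, sub_self, mul_zero]
    positivity
  · have h2 : k⁻¹ ≤ 1 + ‖x‖ := by
      rw [not_le, ← mul_pow] at hx
      have h3 : 1 < k * ‖x‖ := by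
        by_contra! hle
        have := pow_le_one₀ (n := 2) (by positivity) hle
        linarith
      rw [inv_le_iff_one_le_mul₀ hk]
      linarith
    calc _ ≤ halfWeight R C h δ x :=
          mul_le_of_le_one_right h0 (by linarith [cutoff_nonneg k x])
      _ ≤ (1 + ‖x‖) ^ (-((1 + δ) / 2)) := halfWeight_le_rpow hC hh x
      _ ≤ k⁻¹ ^ (-((1 + δ) / 2)) :=
          Real.rpow_le_rpow_of_nonpos (by positivity) h2 (by linarith)
      _ = _ := by rw [Real.inv_rpow hk.le, ← Real.rpow_neg hk.le, neg_neg]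

theorem tendsto_shifted (V : Plane → ℝ) (hV : MemLp V ⊤ volume) (E h ε : ℝ) {u : ℕ → H2} {v : H2}
    (hu : Filter.Tendsto (fun n => (u n : L2)) Filter.atTop (nhds (v : L2)))
    (hl : Filter.Tendsto (fun n => laplacianL2 (u n)) Filter.atTop (nhds (laplacianL2 v))) :
    Filter.Tendsto (fun n => shifted V hV E h ε (u n)) Filter.atTop
      (nhds (shifted V hV E h ε v)) := by
  simp only [shifted_apply, schrodinger_apply]
  exact (((hl.const_smul _).add (((mulOp V hV).continuous.tendsto _).comp hu)).sub
    (hu.const_smul _)).sub (hu.const_smul _)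

/-- The weighted estimate on `H²`. -/
theorem norm_halfWeight_le {V : Plane → ℝ} (hV : MemLp V ⊤ volume) {E h ε K R C δ : ℝ}
    (hK : 0 < K) (hC : 0 ≤ C) (hh : 0 < h) (hδ : 0 < δ) (hδ1 : δ < 1)
    (htest : ∀ u₁ u₂ : Plane → ℝ, ContDiff ℝ ∞ u₁ → HasCompactSupport u₁ → ContDiff ℝ ∞ u₂ →
        HasCompactSupport u₂ →
        ∫ x, damping R C h x * ((1 + ‖x‖) ^ (-(1 + δ)) * (u₁ x ^ 2 + u₂ x ^ 2))
          ≤ K / h ^ 2 * ∫ x, (damping R C h x)⁻¹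
            * ((1 + ‖x‖) ^ (1 + δ) * resSq V E h ε u₁ u₂ x))
    {u : H2} {F : L2}
    (huF : shifted V hV E h ε u = mulOp (halfWeight R C h δ) (memLp_top_halfWeight hC hh hδ) F) :
    ‖mulOp (halfWeight R C h δ) (memLp_top_halfWeight hC hh hδ) (u : L2)‖
      ≤ Real.sqrt (2 * K) / h * ‖F‖ := by
  obtain ⟨B, hB, hcut⟩ := exists_cutoff_bound
  set D := 324 * K * h ^ 2 * Real.exp (C / h) * B ^ 2 with hD
  set N := ‖(u : L2)‖ ^ 2 + ‖laplacianL2 u‖ ^ 2 with hN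
  have hbound : ∀ k : ℝ, 0 < k → k ≤ 1 →
      ‖mulOp (halfWeight R C h δ) (memLp_top_halfWeight hC hh hδ) (u : L2)‖
        ≤ Real.sqrt (2 * K / h ^ 2 * ‖F‖ ^ 2 + D * k ^ (1 - δ) * N)
          + k ^ ((1 + δ) / 2) * ‖(u : L2)‖ := by
    intro k hk hk1
    set p := memLp_top_halfWeight_mul_cutoff (R := R) (k := k) hC hh hδ
    set q := memLp_top_inv_halfWeight_mul_cutoff (R := R) hC hh hδ hδ1.le hk hk1
    obtain ⟨φ, hφ, hφ'⟩ := exists_schwartz_tendsto u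
    have l1 : Filter.Tendsto (fun n => (schwartzH2 (φ n) : L2)) Filter.atTop (nhds (u : L2)) := hφ
    have l2 : Filter.Tendsto (fun n => laplacianL2 (schwartzH2 (φ n))) Filter.atTop
        (nhds (laplacianL2 u)) := by
      simpa only [laplacianL2_schwartzH2] using hφ'
    have l3 := tendsto_shifted V hV E h ε l1 l2
    have key : ‖mulOp _ p (u : L2)‖ ^ 2 ≤ 2 * K / h ^ 2 * ‖mulOp _ q (shifted V hV E h ε u)‖ ^ 2
        + D * k ^ (1 - δ) * N :=
      le_of_tendsto_of_tendsto' ((((mulOp _ p).continuous.tendsto _).comp l1).norm.pow 2)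
        ((((((mulOp _ q).continuous.tendsto _).comp l3).norm.pow 2).const_mul _).add
          (((l1.norm.pow 2).add (l2.norm.pow 2)).const_mul _))
        fun n => schwartz_bound hB hcut hV hK hC hh hδ hδ1.le htest hk hk1 (φ n)
    -- Because (P - iε)u is given as the weight times F, the truncated inverse weight acts on it
    -- with norm at most ‖F‖, uniformly in k.
    have e1 : mulOp _ q (shifted V hV E h ε u) = mulOp (cutoff k) (memLp_top_cutoff k) F := by
      rw [huF]
      refine mulOp_mulOp _ _ _ (fun x => ?_) F
      have := (halfWeight_pos R C h δ x).ne'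
      field_simp
    have e2 : ‖mulOp _ q (shifted V hV E h ε u)‖ ≤ ‖F‖ := by
      rw [e1, ← one_mul ‖F‖]
      refine norm_mulOp_le_norm _ (fun x => ?_) F
      rw [abs_of_nonneg (cutoff_nonneg k x)]
      exact cutoff_le_one k x
    have e3 : ‖mulOp _ p (u : L2)‖ ≤ Real.sqrt (2 * K / h ^ 2 * ‖F‖ ^ 2 + D * k ^ (1 - δ) * N) := by
      refine Real.le_sqrt_of_sq_le (key.trans (add_le_add ?_ le_rfl))
      exact mul_le_mul_of_nonneg_left (pow_le_pow_left₀ (norm_nonneg _) e2 2) (by positivity)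
    have q' : MemLp (fun x => halfWeight R C h δ x * (1 - cutoff k x)) ⊤ volume :=
      memLp_top_of_bound ((measurable_halfWeight R C h δ).mul (measurable_const.sub
        (contDiff_cutoff k).continuous.measurable)).aestronglyMeasurable _
        (Filter.Eventually.of_forall (halfWeight_mul_one_sub_cutoff_le hC hh hδ hk))
    rw [← mulOp_add p q' (memLp_top_halfWeight hC hh hδ) (fun x => by ring) (u : L2)]
    refine (norm_add_le _ _).trans (add_le_add e3 ?_)
    exact norm_mulOp_le_norm q' (halfWeight_mul_one_sub_cutoff_le hC hh hδ hk) _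
  -- The bound is evaluated at k = 0 by continuity. The graph norm of u enters only through terms
  -- that vanish there, so it does not affect the constant.
  have hcont : Continuous fun k : ℝ =>
      Real.sqrt (2 * K / h ^ 2 * ‖F‖ ^ 2 + D * k ^ (1 - δ) * N)
        + k ^ ((1 + δ) / 2) * ‖(u : L2)‖ := by
    have c1 := Real.continuous_rpow_const (by linarith : 0 ≤ 1 - δ)
    have c2 := Real.continuous_rpow_const (by linarith : 0 ≤ (1 + δ) / 2)
    fun_prop
  have hlim := (hcont.tendsto 0).mono_left (nhdsWithin_le_nhds (s := Set.Ioi 0))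
  rw [Real.zero_rpow (by linarith), Real.zero_rpow (by linarith), mul_zero, zero_mul, zero_mul,
    add_zero, add_zero, Real.sqrt_mul' _ (by positivity), Real.sqrt_div' _ (by positivity),
    Real.sqrt_sq hh.le, Real.sqrt_sq (norm_nonneg _)] at hlim
  refine ge_of_tendsto hlim ?_
  filter_upwards [Ioc_mem_nhdsGT (zero_lt_one' ℝ)] with k hk using hbound k hk.1 hk.2

/-- A resolvent estimate for any weight dominated by `halfWeight`. -/
theorem norm_mulOp_resolvent_le {V : Plane → ℝ} (hV : MemLp V ⊤ volume) {E h ε K R C δ : ℝ}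
    (hC : 0 ≤ C) (hh : 0 < h) (hδ : 0 < δ)
    (hest : ∀ (u : H2) (F : L2), shifted V hV E h ε u
        = mulOp (halfWeight R C h δ) (memLp_top_halfWeight hC hh hδ) F →
      ‖mulOp (halfWeight R C h δ) (memLp_top_halfWeight hC hh hδ) (u : L2)‖ ≤ K / h * ‖F‖)
    (hK : 0 ≤ K) {G : L2 →L[ℂ] L2} (hG : IsResolvent (schrodinger V hV E h) (Complex.I * ε) G)
    {p : Plane → ℝ} (hp : MemLp p ⊤ volume) {a : ℝ} (ha : 0 ≤ a)
    (hpa : ∀ x, |p x| ≤ a * halfWeight R C h δ x) (f : L2) :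
    ‖mulOp p hp (G (mulOp p hp f))‖ ≤ a ^ 2 * (K / h) * ‖f‖ := by
  -- The weight p is `halfWeight` times a multiplier bounded by a. This gives one factor a on the
  -- source side and another when p is compared with `halfWeight` on the solution side.
  have hb : ∀ x, |p x * (halfWeight R C h δ x)⁻¹| ≤ a := by
    intro x
    have h0 := halfWeight_pos R C h δ x
    rw [abs_mul, abs_of_pos (inv_pos.mpr h0), ← div_eq_mul_inv, div_le_iff₀ h0]
    exact hpa x
  have hr : MemLp (fun x => p x * (halfWeight R C h δ x)⁻¹) ⊤ volume :=
    memLp_top_of_bound (hp.1.mul (measurable_halfWeight R C h δ).inv.aestronglyMeasurable) a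
      (Filter.Eventually.of_forall hb)
  have e1 : mulOp p hp f
      = mulOp (halfWeight R C h δ) (memLp_top_halfWeight hC hh hδ) (mulOp _ hr f) := by
    refine (mulOp_mulOp _ _ hp (fun x => ?_) f).symm
    have := (halfWeight_pos R C h δ x).ne'
    field_simp
  obtain ⟨hm, hGf⟩ := hG.1 (mulOp p hp f)
  have h1 := hest ⟨G (mulOp p hp f), hm⟩ (mulOp _ hr f) (hGf.trans e1)
  have h2 := norm_mulOp_le hp (memLp_top_halfWeight (R := R) hC hh hδ) ha
    (fun x => by rw [abs_of_pos (halfWeight_pos R C h δ x)]; exact hpa x) (G (mulOp p hp f))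
  have h3 := norm_mulOp_le_norm hr hb f
  calc _ ≤ a * (K / h * (a * ‖f‖)) :=
        h2.trans (mul_le_mul_of_nonneg_left
          (h1.trans (mul_le_mul_of_nonneg_left h3 (by positivity))) ha)
    _ = _ := by ring

end

end SemiclassicalResolvent

theorem mainTheorem1
    (E : ℝ) (hE : 0 < E)
    (V : Plane → ℝ) (hV : MemLp V ⊤ volume)
    (gradV : Plane → Plane) (hgrad : IsWeakGradient V gradV) (hgradV : MemLp gradV ⊤ volume)
    (δ₀ c : ℝ) (hδ₀ : 0 < δ₀) (hc : 0 < c)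
    (hVdecay : ∀ᵐ x ∂(volume : Measure Plane), V x ≤ c * (1 + ‖x‖) ^ (-δ₀))
    (hgradVdecay : ∀ᵐ x ∂(volume : Measure Plane), ‖gradV x‖ ≤ c * (1 + ‖x‖) ^ (-1 - δ₀))
    (s : ℝ) (hs : 1 / 2 < s) :
    ∃ C R h₀ : ℝ, 0 < C ∧ 0 < R ∧ 0 < h₀ ∧
      ∀ ε : ℝ, 0 < ε → ∀ h : ℝ, 0 < h → h ≤ h₀ →
        ∃ G : L2 →L[ℂ] L2, IsResolvent (schrodinger V hV E h) (Complex.I * ε) G ∧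
          ‖weightOp s hs ∘L G ∘L weightOp s hs‖ ≤ Real.exp (C / h) ∧
          ‖weightOp s hs ∘L exteriorOp R ∘L G ∘L exteriorOp R ∘L weightOp s hs‖ ≤ C / h := by
  -- The last entry gives (1+δ)/2 ≤ s, the second is required by the Carleman weight, and the first
  -- keeps δ < 1 for the truncation argument.
  set δ := min (1 / 2) (min δ₀ (2 * s - 1)) with hδdef
  have hδ : 0 < δ := lt_min (by norm_num) (lt_min hδ₀ (by linarith))
  have hδ1 : δ < 1 := (min_le_left _ _).trans_lt (by norm_num)
  have hδδ : δ ≤ δ₀ := (min_le_right _ _).trans (min_le_left _ _)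
  have hδs : δ ≤ 2 * s - 1 := (min_le_right _ _).trans (min_le_right _ _)
  obtain ⟨K, R, C, h₀, hK, hR, hC, hh₀, htest⟩ := exists_testFunction_bound hE hV hgrad hgradV hδ₀
    hc hVdecay hgradVdecay hδ hδ1.le hδδ
  set κ := Real.sqrt (2 * K) with hκ
  have hκ0 : 0 ≤ κ := Real.sqrt_nonneg _
  -- Here 2C pays for the two factors e^{C/h} and κ for κ/h ≤ e^{κ/h}. The 1, together with h ≤ 1,
  -- covers the exterior bound for ε > 1.
  refine ⟨1 + κ + 2 * C, R, min h₀ 1, by positivity, hR, lt_min hh₀ one_pos, ?_⟩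
  intro ε hε h hh hhle
  have hh1 : h ≤ 1 := hhle.trans (min_le_right _ _)
  obtain ⟨G, hG, hGn⟩ := exists_isResolvent V hV E hh hε
  have hweight : ∀ x, weight s x ≤ (1 + ‖x‖) ^ (-((1 + δ) / 2)) := fun x =>
    Real.rpow_le_rpow_of_exponent_le (by simp) (by linarith)
  have hweight0 : ∀ x, 0 ≤ weight s x := fun x => by
    rw [weight]
    positivity
  have hweight1 : ∀ x, |weight s x| ≤ 1 := fun x => by
    rw [abs_of_nonneg (hweight0 x)]
    exact (hweight x).trans (Real.rpow_le_one_of_one_le_of_nonpos (by simp) (by linarith))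
  have hext : ∀ x, 0 ≤ exterior R x ∧ exterior R x ≤ 1 := fun x => by
    by_cases hx : x ∈ {x : Plane | R ≤ ‖x‖} <;> simp [exterior, hx]
  have hwe1 : ∀ x, |weight s x * exterior R x| ≤ 1 := fun x => by
    rw [abs_mul, abs_of_nonneg (hext x).1]
    exact mul_le_one₀ (hweight1 x) (hext x).1 (hext x).2
  have hwe : MemLp (fun x => weight s x * exterior R x) ⊤ volume :=
    memLp_top_of_bound ((memLp_weight hs).1.mul (memLp_exterior R).1) 1
      (Filter.Eventually.of_forall hwe1)
  have eq1 : ∀ f : L2, (weightOp s hs ∘L G ∘L weightOp s hs) f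
      = mulOp (weight s) (memLp_weight hs) (G (mulOp (weight s) (memLp_weight hs) f)) :=
    fun f => rfl
  have eq2 : ∀ f : L2,
      (weightOp s hs ∘L exteriorOp R ∘L G ∘L exteriorOp R ∘L weightOp s hs) f
      = mulOp _ hwe (G (mulOp _ hwe f)) := fun f => by
    rw [← mulOp_mulOp (memLp_weight hs) (memLp_exterior R) hwe (fun x => rfl),
      ← mulOp_mulOp (memLp_exterior R) (memLp_weight hs) hwe (fun x => mul_comm _ _)]
    rfl
  -- The test function estimate needs ε ≤ 1. For larger ε the resolvent already has norm at most
  -- one.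
  have trivial_bound : 1 < ε → ∀ {p : Plane → ℝ} (hp : MemLp p ⊤ volume), (∀ x, |p x| ≤ 1) →
      ∀ f, ‖mulOp p hp (G (mulOp p hp f))‖ ≤ 1 * ‖f‖ := by
    intro hε1 p hp hp1 f
    have h1 := norm_mulOp_le_norm hp hp1 (G (mulOp p hp f))
    have h2 := norm_mulOp_le_norm hp hp1 f
    have h3 := (hGn (mulOp p hp f)).trans
      (mul_le_mul_of_nonneg_right (inv_le_one_of_one_le₀ hε1.le) (norm_nonneg _))
    linarith
  have weighted_bound : ε ≤ 1 → ∀ {p : Plane → ℝ} (hp : MemLp p ⊤ volume) {a : ℝ}, 0 ≤ a →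
      (∀ x, |p x| ≤ a * halfWeight R C h δ x) →
      ∀ f, ‖mulOp p hp (G (mulOp p hp f))‖ ≤ a ^ 2 * (κ / h) * ‖f‖ :=
    fun hε1 _ hp _ ha hpa f => norm_mulOp_resolvent_le hV hC hh hδ
      (fun _ _ huF => norm_halfWeight_le hV hK hC hh hδ hδ1
        (htest h ε hh (hhle.trans (min_le_left _ _)) hε hε1) huF) hκ0 hG hp ha hpa f
  refine ⟨G, hG, ?_, ?_⟩
  · refine ContinuousLinearMap.opNorm_le_bound _ (Real.exp_pos _).le fun f => ?_
    rw [eq1]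
    rcases le_or_gt ε 1 with hε1 | hε1
    · refine (weighted_bound hε1 (memLp_weight hs) (Real.exp_pos (C / h)).le (fun x => ?_) f).trans
        (mul_le_mul_of_nonneg_right ?_ (norm_nonneg _))
      · rw [abs_of_nonneg (hweight0 x)]
        exact (hweight x).trans (rpow_le_halfWeight hC hh x)
      · have h1 : κ / h ≤ Real.exp (κ / h) := by linarith [Real.add_one_le_exp (κ / h)]
        calc Real.exp (C / h) ^ 2 * (κ / h) ≤ Real.exp (C / h) ^ 2 * Real.exp (κ / h) :=
              mul_le_mul_of_nonneg_left h1 (by positivity)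
          _ = Real.exp ((κ + 2 * C) / h) := by
              rw [sq, ← Real.exp_add, ← Real.exp_add]
              congr 1
              ring
          _ ≤ Real.exp ((1 + κ + 2 * C) / h) :=
              Real.exp_le_exp.mpr (div_le_div_of_nonneg_right (by linarith) hh.le)
    · exact (trivial_bound hε1 (memLp_weight hs) hweight1 f).trans
        (mul_le_mul_of_nonneg_right (Real.one_le_exp (by positivity)) (norm_nonneg _))
  · refine ContinuousLinearMap.opNorm_le_bound _ (by positivity) fun f => ?_
    rw [eq2]
    rcases le_or_gt ε 1 with hε1 | hε1
    · refine (weighted_bound hε1 hwe zero_le_one (fun x => ?_) f).trans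
        (mul_le_mul_of_nonneg_right ?_ (norm_nonneg _))
      · have h0 := (halfWeight_pos R C h δ x).le
        rw [abs_of_nonneg (mul_nonneg (hweight0 x) (hext x).1), one_mul]
        by_cases hx : R ≤ ‖x‖
        · rw [← rpow_eq_halfWeight hx]
          exact (mul_le_of_le_one_right (hweight0 x) (hext x).2).trans (hweight x)
        · have : exterior R x = 0 := Set.indicator_of_notMem (s := {x : Plane | R ≤ ‖x‖}) hx _
          rw [this, mul_zero]
          exact h0
      · rw [one_pow, one_mul]
        exact div_le_div_of_nonneg_right (by linarith) hh.le
    · refine (trivial_bound hε1 hwe hwe1 f).trans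
        (mul_le_mul_of_nonneg_right ?_ (norm_nonneg _))
      rw [le_div_iff₀ hh]
      linarith
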